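/- Let $d\ge 1$ be an integer, $1\le p<\infty$, $A>0$, $\gamma>1$, $\bar{\mathcal N}>0$, and $P(\rho)=A\rho^\gamma$ for $\rho\ge 0$. Fix a smooth function $\chi:\mathbb R^d\to[0,1]$ supported in the open ball $B(0,4/3)$ with $\chi\equiv 1$ on the closed ball $\bar B(0,3/4)$, and put $\varphi(\xi)=\chi(\xi/2)-\chi(\xi)$, $\dot S_j=\chi(2^{-j}D)$ and $\dot\Delta_j=\varphi(2^{-j}D)$ for $j\in\mathbb Z$. For $s\in\mathbb R$, the homogeneous Besov space $\dot{\mathbb B}^s_{p,1}$ is the set of tempered distributions $z$ on $\mathbb R^d$ such that $\lim_{j\to-\infty}\|\dot S_jz\|_{L^\infty}=0$ and $\|z\|_{\dot{\mathbb B}^s_{p,1}}:=\sum_{j\in\mathbb Z}2^{js}\|\dot\Delta_jz\|_{L^p}<\infty$. Then there exists a constant $c_0>0$, depending only on $d,p,A,\gamma,\bar{\mathcal N}$ and $\chi$, such that for every real-valued function $\mathcal N_0$ on $\mathbb R^d$ with $\mathcal N_0-\bar{\mathcal N}\in\dot{\mathbb B}^{d/p}_{p,1}$ and $$\|\mathcal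 N_0-\bar{\mathcal N}\|_{\dot{\mathbb B}^{d/p}_{p,1}}\le c_0,$$ the porous media equation $$\partial_t\mathcal N-\Delta P(\mathcal N)=0\ \text{ on }(0,\infty)\times\mathbb R^d,\qquad \mathcal N|_{t=0}=\mathcal N_0,$$ has one and only one global solution $\mathcal N$ such that $$\mathcal N-\bar{\mathcal N}\in \mathcal C_b(\mathbb R^+;\dot{\mathbb B}^{d/p}_{p,1})\cap L^1(\mathbb R^+;\dot{\mathbb B}^{d/p+2}_{p,1}).$$ Here a global solution is a real-valued function $\mathcal N$ with $\mathcal N(t,\cdot)\ge 0$ a.e. for every $t\ge 0$ (so that $P(\mathcal N)$ is defined), with $\mathcal N(0,\cdot)=\mathcal N_0$ a.e., which satisfies the equation in the sense of tempered distributions: for all $t\ge0$ and all Schwartz functions $\phi$ on $\mathbb R^d$, $$\int_{\mathbb R^d}\mathcal N(t)\,\phi\,dx=\int_{\mathbb R^d}\mathcal N(0)\,\phi\,dx+\int_0^t\!\!\int_{\mathbb R^d}P(\mathcal N(\tau))\,\Delta\phi\,dx\,d\tau,$$ all integrals being well defined. Uniqueness means that two such solutions coincide a.e. in $\mathbb R^d$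 at every time $t\ge0$. -/

import Mathlib

open MeasureTheory Filter Topology Set
open scoped SchwartzMap ENNReal

noncomputable section

namespace PorousMedia

/-- The space `ℝ^d` with its Euclidean norm. -/
abbrev Space (d : ℕ) := EuclideanSpace ℝ (Fin d)

/-! ### Littlewood-Paley decomposition and homogeneous Besov spaces -/

/-- A low-frequency cut-off: a smooth function with range in `[0, 1]`, supported in the open ball
`B(0, 4/3)` and equal to `1` on the closed ball of radius `3/4`. -/
structure Cutoff (d : ℕ) where
  toFun : Space d → ℝ
  smooth : ContDiff ℝ (⊤ : ℕ∞) toFun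
  range_mem : ∀ ξ, toFun ξ ∈ Icc (0 : ℝ) 1
  support_subset : tsupport toFun ⊆ Metric.ball 0 (4 / 3)
  eq_one : ∀ ξ ∈ Metric.closedBall (0 : Space d) (3 / 4), toFun ξ = 1

instance (d : ℕ) : Nonempty (Cutoff d) := by
  let b : ContDiffBump (0 : Space d) := ⟨3 / 4, 5 / 4, by norm_num, by norm_num⟩
  refine ⟨⟨b, b.contDiff, fun ξ => ⟨b.nonneg, b.le_one⟩, ?_, fun ξ h => b.one_of_mem_closedBall h⟩⟩
  rw [b.tsupport_eq]
  exact Metric.closedBall_subset_ball (by norm_num)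

variable {d : ℕ}

/-- The dilated symbol `ξ ↦ χ(2^{-j} ξ)`, written in the variable `η` of Mathlib's Fourier
transform `∫ e^{-2πi x·η} u(x) dx`, so that `ξ = 2π η` is the frequency for which `D = -i∇` has
symbol `ξ`. -/
def lowSymbol (χ : Cutoff d) (j : ℤ) (η : Space d) : ℂ :=
  (χ.toFun (((2 : ℝ) ^ (-j) * (2 * Real.pi)) • η) : ℂ)

/-- The symbol of `φ(2^{-j} D)`, where `φ(ξ) = χ(ξ/2) - χ(ξ)`, so that
`φ(2^{-j} ξ) = χ(2^{-(j+1)} ξ) - χ(2^{-j} ξ)`. -/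
def blockSymbol (χ : Cutoff d) (j : ℤ) (η : Space d) : ℂ :=
  lowSymbol χ (j + 1) η - lowSymbol χ j η

theorem lowSymbol_hasTemperateGrowth (χ : Cutoff d) (j : ℤ) :
    (lowSymbol χ j).HasTemperateGrowth := by
  set a : ℝ := (2 : ℝ) ^ (-j) * (2 * Real.pi) with ha
  have ha0 : a ≠ 0 := by positivity
  have hc : HasCompactSupport χ.toFun :=
    HasCompactSupport.intro (isCompact_closedBall (0 : Space d) (4 / 3)) fun x hx => by
      by_contra h
      exact hx (Metric.ball_subset_closedBall (χ.support_subset (subset_tsupport _ h)))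
  have hc1 : HasCompactSupport fun η : Space d => χ.toFun (a • η) := hc.comp_smul ha0
  have hc2 : HasCompactSupport (lowSymbol χ j) :=
    hc1.comp_left (g := fun r : ℝ => (r : ℂ)) Complex.ofReal_zero
  refine hc2.hasTemperateGrowth ?_
  have h1 : ContDiff ℝ (⊤ : ℕ∞) fun η : Space d => χ.toFun (a • η) :=
    χ.smooth.comp (contDiff_const_smul a)
  exact Complex.ofRealCLM.contDiff.comp h1

theorem blockSymbol_hasTemperateGrowth (χ : Cutoff d) (j : ℤ) :
    (blockSymbol χ j).HasTemperateGrowth :=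
  (lowSymbol_hasTemperateGrowth χ (j + 1)).sub (lowSymbol_hasTemperateGrowth χ j)

/-- The low-frequency operator `χ(2^{-j} D)`. -/
def lowFreq (χ : Cutoff d) (j : ℤ) : 𝓢'(Space d, ℂ) →L[ℂ] 𝓢'(Space d, ℂ) :=
  TemperedDistribution.fourierMultiplierCLM ℂ (lowSymbol χ j)

/-- The homogeneous dyadic block `φ(2^{-j} D)`. -/
def dyadicBlock (χ : Cutoff d) (j : ℤ) : 𝓢'(Space d, ℂ) →L[ℂ] 𝓢'(Space d, ℂ) :=
  TemperedDistribution.fourierMultiplierCLM ℂ (blockSymbol χ j)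

/-- The `L^p` norm of a tempered distribution; it is `∞` if the distribution is not given by an
`L^p` function. -/
def lpNorm (p : ℝ≥0∞) [Fact (1 ≤ p)] (T : 𝓢'(Space d, ℂ)) : ℝ≥0∞ :=
  ⨅ (f : Lp ℂ p (volume : Measure (Space d))) (_ : T = Lp.toTemperedDistribution f), ‖f‖ₑ

/-- The homogeneous Besov semi-norm with regularity `s`, integrability `p` and third index `1`:
the sum over `j ∈ ℤ` of `2^{js} ‖φ(2^{-j} D) T‖_{L^p}`. -/
def besovNorm (χ : Cutoff d) (s : ℝ) (p : ℝ≥0∞) [Fact (1 ≤ p)] (T : 𝓢'(Space d, ℂ)) : ℝ≥0∞ :=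
  ∑' j : ℤ, ENNReal.ofReal ((2 : ℝ) ^ ((j : ℝ) * s)) * lpNorm p (dyadicBlock χ j T)

/-- The class `𝓢'_h`: the tempered distributions `T` for which the `L^∞` norm of `χ(2^{-j} D) T`
tends to `0` as `j → -∞`. -/
def MemSh (χ : Cutoff d) (T : 𝓢'(Space d, ℂ)) : Prop :=
  Tendsto (fun j : ℤ => lpNorm ∞ (lowFreq χ j T)) atBot (𝓝 0)

/-- Membership in the homogeneous Besov space with regularity `s`, integrability `p` and third
index `1`. -/
def MemBesov (χ : Cutoff d) (s : ℝ) (p : ℝ≥0∞) [Fact (1 ≤ p)] (T : 𝓢'(Space d, ℂ)) : Prop :=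
  MemSh χ T ∧ besovNorm χ s p T < ∞

/-- The tempered distribution `T` is given by integration against the real function `f`. -/
def Represents (f : Space d → ℝ) (T : 𝓢'(Space d, ℂ)) : Prop :=
  ∀ φ : 𝓢(Space d, ℂ), Integrable (fun x => φ x * (f x : ℂ)) ∧ T φ = ∫ x, φ x * (f x : ℂ)

/-! ### Spaces of functions of time with values in Besov spaces -/

/-- `u ∈ C_b([0, ∞); B)`, with `B` the homogeneous Besov space with indices `s, p, 1`. -/
structure MemCb (χ : Cutoff d) (s : ℝ) (p : ℝ≥0∞) [Fact (1 ≤ p)]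
    (u : ℝ → 𝓢'(Space d, ℂ)) : Prop where
  mem : ∀ t, 0 ≤ t → MemBesov χ s p (u t)
  cont : ∀ t, 0 ≤ t → Tendsto (fun τ => besovNorm χ s p (u τ - u t)) (𝓝[Ici 0] t) (𝓝 0)
  bounded : ∃ C : ℝ≥0∞, C < ∞ ∧ ∀ t, 0 ≤ t → besovNorm χ s p (u t) ≤ C

/-- `u ∈ L^1(0, ∞; B)`, with `B` the homogeneous Besov space with indices `s, p, 1`. -/
structure MemL1 (χ : Cutoff d) (s : ℝ) (p : ℝ≥0∞) [Fact (1 ≤ p)]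
    (u : ℝ → 𝓢'(Space d, ℂ)) : Prop where
  mem : ∀ᵐ t ∂(volume.restrict (Ioi (0 : ℝ))), MemBesov χ s p (u t)
  meas : AEMeasurable (fun t => besovNorm χ s p (u t)) (volume.restrict (Ioi (0 : ℝ)))
  finite : ∫⁻ t in Ioi (0 : ℝ), besovNorm χ s p (u t) < ∞

/-! ### The porous media equation -/

/-- The pressure law `P(ρ) = A ρ^γ`. -/
def pressure (A γ ρ : ℝ) : ℝ := A * ρ ^ γ

/-- `N` is a global distributional solution of `∂_t N - Δ P(N) = 0` with `N(0) = N₀`. It is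
nonnegative, since `P` is defined on `[0, ∞)`. The equation is integrated in time and tested
against Schwartz functions of the space variable. -/
structure IsSolution (A γ : ℝ) (N₀ : Space d → ℝ) (N : ℝ → Space d → ℝ) : Prop where
  nonneg : ∀ t, 0 ≤ t → ∀ᵐ x, 0 ≤ N t x
  initial : N 0 =ᵐ[volume] N₀
  integrable : ∀ t, 0 ≤ t → ∀ φ : 𝓢(Space d, ℂ), Integrable fun x => φ x * (N t x : ℂ)
  pressure_integrable : ∀ t, 0 ≤ t → ∀ φ : 𝓢(Space d, ℂ),
    Integrable fun x => φ x * (pressure A γ (N t x) : ℂ)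
  time_integrable : ∀ t, 0 ≤ t → ∀ φ : 𝓢(Space d, ℂ),
    IntervalIntegrable (fun τ => ∫ x, φ x * (pressure A γ (N τ x) : ℂ)) volume 0 t
  equation : ∀ t, 0 ≤ t → ∀ φ : 𝓢(Space d, ℂ),
    ∫ x, φ x * (N t x : ℂ) = (∫ x, φ x * (N 0 x : ℂ)) +
      ∫ τ in (0 : ℝ)..t, ∫ x, (Laplacian.laplacian φ) x * (pressure A γ (N τ x) : ℂ)

/-- `N - Nbar` belongs to `C_b([0, ∞); B^{d/p}) ∩ L^1(0, ∞; B^{d/p+2})`, where `B^s` is the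
homogeneous Besov space with indices `s, p, 1`. -/
def InSolutionSpace (χ : Cutoff d) (p : ℝ≥0∞) [Fact (1 ≤ p)] (Nbar : ℝ)
    (N : ℝ → Space d → ℝ) : Prop :=
  ∃ u : ℝ → 𝓢'(Space d, ℂ),
    (∀ t, 0 ≤ t → Represents (fun x => N t x - Nbar) (u t)) ∧
    MemCb χ (d / p.toReal) p u ∧ MemL1 χ (d / p.toReal + 2) p u

end PorousMedia

end

open MeasureTheory Filter Topology Set
open scoped SchwartzMap ENNReal

noncomputable section

namespace PorousMedia

variable {d : ℕ}

/-! ### Integral inequalities for extended nonnegative functions. -/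

section Lintegral

variable {α β : Type*} [MeasurableSpace α] [MeasurableSpace β]

/-! Write `N = Nbar + u`. Expanding `P` at `Nbar` turns the equation into `∂_t u - κ Δ u = Δ F(u)`,
where `κ = P'(Nbar) = A γ Nbar^(γ-1)` is positive and `F` is a power series starting at degree two
(`hasSum_pressure`). The constant `P(Nbar)` disappears because a Laplacian has zero integral.

The perturbation is small in the supremum norm and in `L¹` in time with values in `B^{d/p+2}`. The
source has two derivatives in front, but two derivatives are exactly what the heat flow gains in
`L¹` of time, with no loss because the third Besov index is 1 (`exists_bes_apriori`). The product
law, valid for positive regularity (`bes_mul_le`), bounds `F(u) - F(v)` in `B^{d/p+2}` by the size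
of `u`, `v` times their distance (`exists_ser_bounds`). The embedding of `B^{d/p}` into bounded
functions closes the loop (`exists_enorm_le_bes`). Hence the map sending `U` to the solution with
source `Δ F(U)` contracts by a fixed factor on a small ball (`exists_contraction`), and Picard
iteration gives existence (`Contraction.exists_fixedPoint`).

A competing solution is not assumed small. It starts from the same data, however, so by continuity
it remains in the ball for a short time, and over a short interval its `L¹` norm is small as well.
The contraction estimate makes the two solutions agree there, and a continuation argument propagates
the equality (`Contraction.eq_of_localHeat`).

Everything takes place among bounded continuous functions, since every element of the critical space
is one (`exists_Cb_of_memBesov`). Block operators, localized Laplacians and heat operators are all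
convolutions with rescaled Schwartz kernels: estimates come from the `L¹` norm of the kernel, which
does not depend on the scale, and algebraic identities are checked on symbols (`IsMult.eq`). On one
dyadic block the Laplacian is bounded, so the heat equation becomes an ordinary differential
equation with an explicit Duhamel formula. -/

theorem lintegral_mul_rpow_le (ν : Measure β) {w F : β → ℝ≥0∞} (hw : AEMeasurable w ν)
    (hF : AEMeasurable F ν) {p : ℝ} (hp : 1 ≤ p) :
    (∫⁻ y, w y * F y ∂ν) ^ p ≤ (∫⁻ y, w y ∂ν) ^ (p - 1) * ∫⁻ y, w y * F y ^ p ∂ν := by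
  have hp0 : 0 < p := by linarith
  have hinv : p⁻¹ ≤ 1 := inv_le_one_of_one_le₀ hp
  have h := ENNReal.lintegral_mul_norm_pow_le (μ := ν) (f := fun y => w y * F y ^ p) (g := w)
    (hw.mul (hF.pow_const p)) hw (p := p⁻¹) (q := 1 - p⁻¹) (by positivity) (by linarith) (by ring)
  have h2 : ∀ y, (w y * F y ^ p) ^ p⁻¹ * w y ^ (1 - p⁻¹) = w y * F y := by
    intro y
    rw [ENNReal.mul_rpow_of_nonneg _ _ (by positivity), ← ENNReal.rpow_mul, mul_inv_cancel₀ hp0.ne',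
      ENNReal.rpow_one, mul_right_comm, ← ENNReal.rpow_add_of_nonneg _ _ (by positivity)
      (by linarith), add_sub_cancel, ENNReal.rpow_one]
  simp only [h2] at h
  calc _ ≤ ((∫⁻ y, w y * F y ^ p ∂ν) ^ p⁻¹ * (∫⁻ y, w y ∂ν) ^ (1 - p⁻¹)) ^ p :=
        ENNReal.rpow_le_rpow h hp0.le
    _ = _ := by
        rw [ENNReal.mul_rpow_of_nonneg _ _ hp0.le, ← ENNReal.rpow_mul, ← ENNReal.rpow_mul,
          inv_mul_cancel₀ hp0.ne', ENNReal.rpow_one, mul_comm, sub_mul, one_mul,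
          inv_mul_cancel₀ hp0.ne']

/-- Minkowski's integral inequality. -/
theorem lintegral_rpow_lintegral_le (μ : Measure α) [SFinite μ] (ν : Measure β) [SFinite ν]
    {F : α → β → ℝ≥0∞} (hF : Measurable (Function.uncurry F)) {p : ℝ} (hp : 1 ≤ p) :
    (∫⁻ x, (∫⁻ y, F x y ∂ν) ^ p ∂μ) ^ p⁻¹ ≤ ∫⁻ y, (∫⁻ x, F x y ^ p ∂μ) ^ p⁻¹ ∂ν := by
  have hp0 : 0 < p := by linarith
  -- The weight is the `L^p` norm of `F(·, y)`. With `F = w · (F / w)`, Jensen's inequality for the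
  -- weight `w` reduces the claim to the fact that `F(·, y) / w y` has `L^p` norm at most one.
  set w : β → ℝ≥0∞ := fun y => (∫⁻ x, F x y ^ p ∂μ) ^ p⁻¹ with hwdef
  have hFs : Measurable (Function.uncurry fun y x => F x y) := hF.comp measurable_swap
  have hw : Measurable w := ((hFs.pow_const p).lintegral_prod_right').pow_const _
  by_cases hI : ∫⁻ y, w y ∂ν = ∞
  · rw [hI]; exact le_top
  have hwfin : ∀ᵐ y ∂ν, w y < ∞ := ae_lt_top hw hI
  have hwp : ∀ y, w y ^ p = ∫⁻ x, F x y ^ p ∂μ := fun y => by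
    simp only [hwdef]; rw [← ENNReal.rpow_mul, inv_mul_cancel₀ hp0.ne', ENNReal.rpow_one]
  have hFy : ∀ y, Measurable fun x => F x y := fun y => hF.comp (measurable_id.prodMk measurable_const)
  have hFx : ∀ x, Measurable fun y => F x y := fun x => hF.comp (measurable_const.prodMk measurable_id)
  -- The factorization only holds almost everywhere: where `w y = 0` the function `F(·, y)` vanishes
  -- up to a null set. The order of the two quantifiers is exchanged below by Fubini for null sets.
  have h1 : ∀ᵐ y ∂ν, ∀ᵐ x ∂μ, F x y = w y * (F x y / w y) := by
    filter_upwards [hwfin] with y hy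
    by_cases h0 : w y = 0
    · have h3 : ∫⁻ x, F x y ^ p ∂μ = 0 := by rw [← hwp, h0, ENNReal.zero_rpow_of_pos hp0]
      rw [lintegral_eq_zero_iff ((hFy y).pow_const p)] at h3
      filter_upwards [h3] with x hx
      have : F x y = 0 := by
        simpa [ENNReal.rpow_eq_zero_iff, hp0, hp0.not_gt] using hx
      simp [this]
    · exact Eventually.of_forall fun x => (ENNReal.mul_div_cancel h0 hy.ne).symm
  have hmeas : MeasurableSet {z : β × α | F z.2 z.1 = w z.1 * (F z.2 z.1 / w z.1)} :=
    measurableSet_eq_fun hFs ((hw.comp measurable_fst).mul (hFs.div (hw.comp measurable_fst)))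
  have h2 : ∀ᵐ x ∂μ, ∀ᵐ y ∂ν, F x y = w y * (F x y / w y) :=
    (Measure.ae_ae_comm (p := fun y x => F x y = w y * (F x y / w y)) hmeas).1 h1
  have h3 : ∫⁻ x, (∫⁻ y, F x y ∂ν) ^ p ∂μ ≤ (∫⁻ y, w y ∂ν) ^ p := by
    calc ∫⁻ x, (∫⁻ y, F x y ∂ν) ^ p ∂μ
        ≤ ∫⁻ x, (∫⁻ y, w y ∂ν) ^ (p - 1) * ∫⁻ y, w y * (F x y / w y) ^ p ∂ν ∂μ := by
          refine lintegral_mono_ae ?_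
          filter_upwards [h2] with x hx
          rw [lintegral_congr_ae hx]
          exact lintegral_mul_rpow_le ν hw.aemeasurable ((hFx x).div hw).aemeasurable hp
      _ = (∫⁻ y, w y ∂ν) ^ (p - 1) * ∫⁻ y, ∫⁻ x, w y * (F x y / w y) ^ p ∂μ ∂ν := by
          rw [lintegral_const_mul' _ _ (ENNReal.rpow_ne_top_of_nonneg (by linarith) hI),
            lintegral_lintegral_swap]
          exact ((hw.comp measurable_snd).mul
            ((hF.div (hw.comp measurable_snd)).pow_const p)).aemeasurable
      _ ≤ (∫⁻ y, w y ∂ν) ^ (p - 1) * ∫⁻ y, w y ∂ν := by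
          gcongr with y
          rw [lintegral_const_mul _ (((hFy y).div_const _).pow_const p)]
          simp only [ENNReal.div_rpow_of_nonneg _ _ hp0.le]
          simp only [div_eq_mul_inv]
          rw [lintegral_mul_const _ ((hFy y).pow_const p), ← hwp]
          calc w y * (w y ^ p * (w y ^ p)⁻¹) ≤ w y * 1 := by
                gcongr; exact ENNReal.mul_inv_le_one _
            _ = w y := mul_one _
      _ = _ := by
          conv_lhs => rw [← ENNReal.rpow_one (∫⁻ y, w y ∂ν), ← ENNReal.rpow_mul, one_mul]
          rw [← ENNReal.rpow_add_of_nonneg _ _ (by linarith) zero_le_one, sub_add_cancel]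
  calc _ ≤ ((∫⁻ y, w y ∂ν) ^ p) ^ p⁻¹ := ENNReal.rpow_le_rpow h3 (by positivity)
    _ = _ := by rw [← ENNReal.rpow_mul, mul_inv_cancel₀ hp0.ne', ENNReal.rpow_one]

theorem eLpNorm_eq_lintegral_rpow {f : α → ℂ} {μ : Measure α} {p : ℝ≥0∞} (hp1 : 1 ≤ p)
    (hp : p ≠ ∞) : eLpNorm f p μ = (∫⁻ x, ‖f x‖ₑ ^ p.toReal ∂μ) ^ p.toReal⁻¹ := by
  rw [eLpNorm_eq_lintegral_rpow_enorm_toReal (by positivity) hp, one_div]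

theorem one_le_toReal {p : ℝ≥0∞} (hp1 : 1 ≤ p) (hp : p ≠ ∞) : 1 ≤ p.toReal := by
  simpa using ENNReal.toReal_mono hp hp1

/-- The form of Minkowski's inequality used both for convolutions, with `y` the space shift, and for
time integrals of curves, with `y` the time. -/
theorem eLpNorm_le_lintegral_eLpNorm {μ : Measure α} [SFinite μ] {ν : Measure β} [SFinite ν]
    {p : ℝ≥0∞} (hp1 : 1 ≤ p) (hp : p ≠ ∞) {F : α → β → ℂ} (hF : Measurable (Function.uncurry F))
    {G : α → ℂ} (hG : ∀ x, ‖G x‖ₑ ≤ ∫⁻ y, ‖F x y‖ₑ ∂ν) :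
    eLpNorm G p μ ≤ ∫⁻ y, eLpNorm (fun x => F x y) p μ ∂ν := by
  simp only [eLpNorm_eq_lintegral_rpow hp1 hp]
  refine le_trans ?_ (lintegral_rpow_lintegral_le μ ν (F := fun x y => ‖F x y‖ₑ) hF.enorm
    (one_le_toReal hp1 hp))
  gcongr with x
  exact hG x

/-- Fatou's lemma and the triangle inequality. Pointwise convergence suffices, which matters because
Littlewood-Paley sums of a bounded function need not converge uniformly. -/
theorem eLpNorm_le_tsum_of_tendsto {μ : Measure α} {p : ℝ≥0∞} (hp1 : 1 ≤ p) {ι : Type*} [Countable ι]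
    {g : ι → α → ℂ} (hg : ∀ i, AEStronglyMeasurable (g i) μ) {f : α → ℂ} {s : ℕ → Finset ι}
    (h : ∀ x, Tendsto (fun n => ∑ i ∈ s n, g i x) atTop (𝓝 (f x))) :
    eLpNorm f p μ ≤ ∑' i, eLpNorm (g i) p μ := by
  refine (Lp.eLpNorm_lim_le_liminf_eLpNorm (f := fun n => ∑ i ∈ s n, g i)
    (fun n => Finset.aestronglyMeasurable_sum _ fun i _ => hg i) f
    (Eventually.of_forall fun x => by simpa using h x)).trans ?_
  refine (liminf_le_liminf (v := fun _ => ∑' i, eLpNorm (g i) p μ)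
    (Eventually.of_forall fun n => ?_)).trans (by simp)
  exact (eLpNorm_sum_le (fun i _ => hg i) hp1).trans (ENNReal.sum_le_tsum _)

end Lintegral

/-! ### Curves of bounded continuous functions and their `L^p` norms. -/

/-- Bounded continuous complex functions on `ℝ^d`. -/
abbrev Cb (d : ℕ) := BoundedContinuousFunction (Space d) ℂ

theorem aestronglyMeasurable_Cb (f : Cb d) : AEStronglyMeasurable f (volume : Measure (Space d)) :=
  f.continuous.aestronglyMeasurable

theorem continuous_uncurry_Cb {X : Type*} [TopologicalSpace X] {u : X → Cb d} (hu : Continuous u) :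
    Continuous fun z : X × Space d => u z.1 z.2 := by
  have : Continuous fun z : X × Space d => (u z.1, z.2) :=
    (hu.comp continuous_fst).prodMk continuous_snd
  exact continuous_eval.comp this

/-- The `L^p` norm is not continuous for the supremum norm; measurability comes from Tonelli and the
joint continuity of `(t, x) ↦ u t x`. -/
theorem measurable_eLpNorm_Cb {p : ℝ≥0∞} (hp1 : 1 ≤ p) (hp : p ≠ ∞) {u : ℝ → Cb d}
    (hu : Continuous u) : Measurable fun t => eLpNorm (u t) p volume := by
  simp only [eLpNorm_eq_lintegral_rpow hp1 hp]
  exact ((((continuous_uncurry_Cb hu).measurable.enorm).pow_const _).lintegral_prod_right').pow_const _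

theorem eLpNorm_hasSum_le {p : ℝ≥0∞} (hp1 : 1 ≤ p) {ι : Type*} [Countable ι] {g : ι → Cb d} {f : Cb d}
    (h : HasSum g f) : eLpNorm f p volume ≤ ∑' i, eLpNorm (g i) p volume := by
  classical
  obtain ⟨s, hs⟩ := exists_seq_tendsto (atTop : Filter (Finset ι))
  refine eLpNorm_le_tsum_of_tendsto hp1 (s := s) (fun i => aestronglyMeasurable_Cb _) fun x => ?_
  have h1 := h.comp hs
  have h2 : Continuous fun g : Cb d => g x := continuous_eval_const x
  simpa [Function.comp_def] using (h2.tendsto f).comp h1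

theorem enorm_setIntegral_apply_le {ν : Measure ℝ} {u : ℝ → Cb d} (hu : Integrable u ν) (x : Space d) :
    ‖(∫ τ, u τ ∂ν) x‖ₑ ≤ ∫⁻ τ, ‖u τ x‖ₑ ∂ν := by
  have : (∫ τ, u τ ∂ν) x = ∫ τ, u τ x ∂ν :=
    ((BoundedContinuousFunction.evalCLM ℂ x).integral_comp_comm hu).symm
  rw [this]
  exact enorm_integral_le_lintegral_enorm _

theorem eLpNorm_integral_Cb_le {p : ℝ≥0∞} (hp1 : 1 ≤ p) (hp : p ≠ ∞) {ν : Measure ℝ} [SFinite ν]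
    {u : ℝ → Cb d} (hc : Continuous u) (hu : Integrable u ν) :
    eLpNorm (∫ τ, u τ ∂ν : Cb d) p volume ≤ ∫⁻ τ, eLpNorm (u τ) p volume ∂ν :=
  eLpNorm_le_lintegral_eLpNorm hp1 hp (F := fun x τ => u τ x)
    ((continuous_uncurry_Cb hc).measurable.comp measurable_swap)
    (enorm_setIntegral_apply_le hu)

open FourierTransform

/-! ### Convolution operators with rescaled Schwartz kernels -/

/-- The `L¹` norm of the kernel with symbol `m`. -/
def kerNorm (m : 𝓢(Space d, ℂ)) : ℝ := ∫ y, ‖(𝓕⁻ m) y‖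

theorem kerNorm_nonneg (m : 𝓢(Space d, ℂ)) : 0 ≤ kerNorm m := integral_nonneg fun _ => norm_nonneg _

theorem ofReal_kerNorm (m : 𝓢(Space d, ℂ)) :
    ENNReal.ofReal (kerNorm m) = ∫⁻ y, ‖(𝓕⁻ m) y‖ₑ := by
  rw [kerNorm, ofReal_integral_norm_eq_lintegral_enorm (𝓕⁻ m).integrable]

theorem continuous_shift (c : ℝ) : Continuous fun z : Space d × Space d => z.1 - c • z.2 := by fun_prop

theorem integrable_kernel_mul (c : ℝ) (m : 𝓢(Space d, ℂ)) (f : Cb d) (x : Space d) :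
    Integrable fun y => (𝓕⁻ m) y * f (x - c • y) :=
  (𝓕⁻ m).integrable.mul_bdd (c := ‖f‖)
    (f.continuous.comp (by fun_prop)).aestronglyMeasurable
    (Eventually.of_forall fun y => f.norm_coe_le_norm _)

theorem norm_kernel_integral_le (c : ℝ) (m : 𝓢(Space d, ℂ)) (f : Cb d) (x : Space d) :
    ‖∫ y, (𝓕⁻ m) y * f (x - c • y)‖ ≤ kerNorm m * ‖f‖ := by
  rw [kerNorm, ← integral_mul_const]
  refine (norm_integral_le_integral_norm _).trans (integral_mono_of_nonneg
    (Eventually.of_forall fun y => norm_nonneg _) ((𝓕⁻ m).integrable.norm.mul_const _)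
    (Eventually.of_forall fun y => ?_))
  simp only [norm_mul]
  gcongr
  exact f.norm_coe_le_norm _

theorem continuous_kernel_integral (c : ℝ) (m : 𝓢(Space d, ℂ)) (f : Cb d) :
    Continuous fun x => ∫ y, (𝓕⁻ m) y * f (x - c • y) := by
  refine continuous_of_dominated (bound := fun y => ‖(𝓕⁻ m) y‖ * ‖f‖)
    (fun x => (integrable_kernel_mul c m f x).aestronglyMeasurable)
    (fun x => Eventually.of_forall fun y => ?_) ((𝓕⁻ m).integrable.norm.mul_const _)
    (Eventually.of_forall fun y => ?_)
  · rw [norm_mul]; gcongr; exact f.norm_coe_le_norm _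
  · have h : Continuous fun x : Space d => x - c • y := continuous_id.sub continuous_const
    exact continuous_const.mul (f.continuous.comp h)

/-- Convolution of a bounded continuous function with the kernel whose symbol is `η ↦ m (c • η)`. -/
def opFun (c : ℝ) (m : 𝓢(Space d, ℂ)) (f : Cb d) : Cb d :=
  BoundedContinuousFunction.ofNormedAddCommGroup (fun x => ∫ y, (𝓕⁻ m) y * f (x - c • y))
    (continuous_kernel_integral c m f) (kerNorm m * ‖f‖) (norm_kernel_integral_le c m f)

theorem opFun_apply (c : ℝ) (m : 𝓢(Space d, ℂ)) (f : Cb d) (x : Space d) :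
    opFun c m f x = ∫ y, (𝓕⁻ m) y * f (x - c • y) := rfl

theorem norm_opFun_le (c : ℝ) (m : 𝓢(Space d, ℂ)) (f : Cb d) : ‖opFun c m f‖ ≤ kerNorm m * ‖f‖ :=
  BoundedContinuousFunction.norm_ofNormedAddCommGroup_le _
    (mul_nonneg (kerNorm_nonneg m) (norm_nonneg f)) (norm_kernel_integral_le c m f)

theorem opFun_add (c : ℝ) (m : 𝓢(Space d, ℂ)) (f g : Cb d) :
    opFun c m (f + g) = opFun c m f + opFun c m g := by
  ext x
  rw [BoundedContinuousFunction.add_apply, opFun_apply, opFun_apply, opFun_apply,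
    ← integral_add (integrable_kernel_mul c m f x) (integrable_kernel_mul c m g x)]
  simp only [BoundedContinuousFunction.add_apply, mul_add]

theorem opFun_smul (c : ℝ) (m : 𝓢(Space d, ℂ)) (a : ℂ) (f : Cb d) :
    opFun c m (a • f) = a • opFun c m f := by
  ext x
  rw [BoundedContinuousFunction.smul_apply, opFun_apply, opFun_apply, smul_eq_mul,
    ← integral_const_mul]
  simp only [BoundedContinuousFunction.smul_apply, smul_eq_mul, mul_left_comm _ a]

/-- The operator of convolution with the kernel whose symbol is `η ↦ m (c • η)`. -/
def op (c : ℝ) (m : 𝓢(Space d, ℂ)) : Cb d →L[ℂ] Cb d :=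
  LinearMap.mkContinuous
    { toFun := opFun c m
      map_add' := opFun_add c m
      map_smul' := opFun_smul c m } (kerNorm m) (norm_opFun_le c m)

theorem op_apply (c : ℝ) (m : 𝓢(Space d, ℂ)) (f : Cb d) (x : Space d) :
    op c m f x = ∫ y, (𝓕⁻ m) y * f (x - c • y) := rfl

/-- The bound does not see the scale `c`. This makes the later estimates uniform in the dyadic index
and in the heat time. -/
theorem norm_op_le (c : ℝ) (m : 𝓢(Space d, ℂ)) : ‖op c m‖ ≤ kerNorm m :=
  LinearMap.mkContinuous_norm_le _ (kerNorm_nonneg m) _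

theorem norm_op_apply_le (c : ℝ) (m : 𝓢(Space d, ℂ)) (f : Cb d) : ‖op c m f‖ ≤ kerNorm m * ‖f‖ :=
  (op c m).le_of_opNorm_le (norm_op_le c m) f

theorem enorm_op_apply_le (c : ℝ) (m : 𝓢(Space d, ℂ)) (f : Cb d) (x : Space d) :
    ‖op c m f x‖ₑ ≤ ∫⁻ y, ‖(𝓕⁻ m) y‖ₑ * ‖f (x - c • y)‖ₑ := by
  rw [op_apply]
  refine (enorm_integral_le_lintegral_enorm _).trans (le_of_eq ?_)
  simp only [enorm_mul]

/-- Young's inequality: by Minkowski, the norm of the average of translates of `f` is at most the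
average of their norms, all equal to that of `f`. -/
theorem eLpNorm_op_le {p : ℝ≥0∞} (hp1 : 1 ≤ p) (hp : p ≠ ∞) (c : ℝ) (m : 𝓢(Space d, ℂ)) (f : Cb d) :
    eLpNorm (op c m f) p volume ≤ ENNReal.ofReal (kerNorm m) * eLpNorm f p volume := by
  have hm : Measurable (Function.uncurry fun x y => (𝓕⁻ m) y * f (x - c • y)) := by
    refine Continuous.measurable ?_
    exact ((𝓕⁻ m).continuous.comp continuous_snd).mul (f.continuous.comp (continuous_shift c))
  refine (eLpNorm_le_lintegral_eLpNorm hp1 hp hm (G := op c m f) (ν := volume) fun x => ?_).trans ?_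
  · rw [op_apply]; exact enorm_integral_le_lintegral_enorm _
  · rw [ofReal_kerNorm, ← lintegral_mul_const _ (𝓕⁻ m).continuous.measurable.enorm]
    refine lintegral_mono fun y => le_of_eq ?_
    have h1 : eLpNorm (fun x => f (x - c • y)) p volume = eLpNorm f p volume :=
      eLpNorm_comp_measurePreserving (aestronglyMeasurable_Cb f)
        (measurePreserving_sub_right volume (c • y))
    have h2 : (fun x => (𝓕⁻ m) y * f (x - c • y)) = (𝓕⁻ m) y • fun x => f (x - c • y) := rfl
    rw [h2, eLpNorm_const_smul, h1]

/-! ### Bounded functions as tempered distributions -/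

theorem memLp_top_Cb (f : Cb d) : MemLp f ∞ (volume : Measure (Space d)) :=
  memLp_top_of_bound (aestronglyMeasurable_Cb f) ‖f‖ (Eventually.of_forall f.norm_coe_le_norm)

/-- The tempered distribution given by a bounded continuous function. -/
def toDist (f : Cb d) : 𝓢'(Space d, ℂ) := Lp.toTemperedDistribution (memLp_top_Cb f).toLp

theorem toDist_apply (f : Cb d) (φ : 𝓢(Space d, ℂ)) : toDist f φ = ∫ x, φ x * f x := by
  rw [toDist, Lp.toTemperedDistribution_apply]
  refine integral_congr_ae ?_
  filter_upwards [(memLp_top_Cb f).coeFn_toLp] with x hx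
  rw [hx, smul_eq_mul]

theorem integrable_schwartz_mul (φ : 𝓢(Space d, ℂ)) (f : Cb d) : Integrable fun x => φ x * f x :=
  φ.integrable.mul_bdd (c := ‖f‖) (aestronglyMeasurable_Cb f)
    (Eventually.of_forall f.norm_coe_le_norm)

theorem toDist_add (f g : Cb d) : toDist (f + g) = toDist f + toDist g := by
  ext φ
  have := integral_add (integrable_schwartz_mul φ f) (integrable_schwartz_mul φ g)
  simpa [toDist_apply, mul_add] using this

theorem toDist_sub (f g : Cb d) : toDist (f - g) = toDist f - toDist g := by
  ext φ
  have := integral_sub (integrable_schwartz_mul φ f) (integrable_schwartz_mul φ g)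
  simpa [toDist_apply, mul_sub] using this

theorem toDist_smul (a : ℂ) (f : Cb d) : toDist (a • f) = a • toDist f := by
  ext φ
  simp [toDist_apply, mul_left_comm _ a, integral_const_mul]

/-- Equality almost everywhere is equality for continuous functions. Identities between operators
are proved for distributions and pulled back through this injectivity. -/
theorem toDist_injective : Function.Injective (toDist (d := d)) := by
  intro f g h
  have h0 : (fun x => (f - g) x) =ᵐ[volume] 0 := by
    refine ae_eq_zero_of_integral_contDiff_smul_eq_zero
      (f - g).continuous.locallyIntegrable fun φ hφ hφc => ?_
    have h1 : HasCompactSupport (Complex.ofRealCLM ∘ φ) := hφc.comp_left rfl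
    have h2 : ContDiff ℝ (⊤ : ℕ∞) (Complex.ofRealCLM ∘ φ) := by fun_prop
    have h3 : toDist (f - g) (h1.toSchwartzMap h2) = 0 := by rw [toDist_sub, h, sub_self]; rfl
    rw [toDist_apply] at h3
    simpa using h3
  have h1 := (Continuous.ae_eq_iff_eq volume (f - g).continuous continuous_zero).1 h0
  ext x
  have := congrFun h1 x
  simpa [sub_eq_zero] using this

theorem norm_toDist_apply_le (f : Cb d) (φ : 𝓢(Space d, ℂ)) :
    ‖toDist f φ‖ ≤ (∫ x, ‖φ x‖) * ‖f‖ := by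
  rw [toDist_apply, ← integral_mul_const]
  refine (norm_integral_le_integral_norm _).trans (integral_mono_of_nonneg
    (Eventually.of_forall fun y => norm_nonneg _) (φ.integrable.norm.mul_const _)
    (Eventually.of_forall fun y => ?_))
  simp only [norm_mul]
  gcongr
  exact f.norm_coe_le_norm _

/-- Pairing with a Schwartz function, as a continuous linear form. -/
def pairCLM (φ : 𝓢(Space d, ℂ)) : Cb d →L[ℂ] ℂ :=
  LinearMap.mkContinuous
    { toFun := fun f => toDist f φ
      map_add' := fun f g => by rw [toDist_add]; rfl
      map_smul' := fun a f => by rw [toDist_smul]; rfl } (∫ x, ‖φ x‖)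
    fun f => norm_toDist_apply_le f φ

theorem pairCLM_apply (φ : 𝓢(Space d, ℂ)) (f : Cb d) : pairCLM φ f = toDist f φ := rfl

/-! ### Fourier multipliers -/

theorem hasTemperateGrowth_dilation (c : ℝ) (m : 𝓢(Space d, ℂ)) :
    (fun η => m (c • η)).HasTemperateGrowth :=
  m.hasTemperateGrowth.comp (c • ContinuousLinearMap.id ℝ (Space d)).hasTemperateGrowth

theorem fourierInv_comp_affine {c : ℝ} (hc : c ≠ 0) (φ : 𝓢(Space d, ℂ)) (z ξ : Space d) :
    𝓕⁻ (fun y => φ (z + c • y)) ξ =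
      |(c ^ Module.finrank ℝ (Space d))⁻¹| • (Real.fourierChar (-(inner ℝ z (c⁻¹ • ξ))) •
        (𝓕⁻ φ) (c⁻¹ • ξ)) := by
  rw [Real.fourierInv_eq]
  have h1 : (fun y => Real.fourierChar (inner ℝ y ξ) • φ (z + c • y)) =
      fun y => (fun w => Real.fourierChar (inner ℝ (c⁻¹ • w) ξ) • φ (z + w)) (c • y) := by
    ext y; simp only [smul_smul, inv_mul_cancel₀ hc, one_smul]
  rw [h1]
  refine (Measure.integral_comp_smul volume
    (fun w => Real.fourierChar (inner ℝ (c⁻¹ • w) ξ) • φ (z + w)) c).trans ?_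
  congr 1
  rw [← integral_sub_right_eq_self _ z, SchwartzMap.fourierInv_coe, Real.fourierInv_eq]
  simp only [Circle.smul_def]
  rw [← integral_smul]
  refine integral_congr_ae (Eventually.of_forall fun w => ?_)
  simp only [add_sub_cancel, smul_smul, ← Circle.coe_mul, ← AddChar.map_add_eq_mul]
  have key : inner ℝ (c⁻¹ • (w - z)) ξ = -(inner ℝ z (c⁻¹ • ξ)) + inner ℝ w (c⁻¹ • ξ) := by
    simp only [smul_sub, inner_sub_left, real_inner_smul_left, real_inner_smul_right]
    ring
  rw [key]

theorem integral_fourierInv_mul (m : 𝓢(Space d, ℂ)) {h : Space d → ℂ} (hh : Integrable h) :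
    ∫ y, (𝓕⁻ m) y * h y = ∫ ξ, m ξ * 𝓕⁻ h ξ := by
  have h2 := VectorFourier.integral_fourierIntegral_smul_eq_flip (μ := volume) (ν := volume)
    (L := -innerₗ (Space d)) (f := m) (g := h) (e := Real.fourierChar)
    Real.continuous_fourierChar
    (continuous_inner.neg : Continuous fun q : Space d × Space d => -(inner ℝ q.1 q.2 : ℝ))
    m.integrable hh
  have h3 : ∀ ξ, VectorFourier.fourierIntegral Real.fourierChar volume (-innerₗ (Space d)).flip
      h ξ = 𝓕⁻ h ξ := by
    intro ξ
    rw [Real.fourierInv_eq]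
    simp [VectorFourier.fourierIntegral, real_inner_comm]
  have h4 : ∀ ξ, VectorFourier.fourierIntegral Real.fourierChar volume (-innerₗ (Space d))
      m ξ = (𝓕⁻ m) ξ := fun ξ => by rw [SchwartzMap.fourierInv_coe]; rfl
  simpa only [h3, h4, smul_eq_mul] using h2

/-- Computes the transpose of `op c m`: on a test function the multiplier is again a convolution,
with `z + c y` in place of `x - c y`. Moving the inverse Fourier transform off `m` and substituting
`ξ = c v` matches the two Fourier integrals. -/
theorem fourier_smulLeft_fourierInv {c : ℝ} (hc : c ≠ 0) (m φ : 𝓢(Space d, ℂ)) (z : Space d) :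
    𝓕 (SchwartzMap.smulLeftCLM ℂ (fun η => m (c • η)) (𝓕⁻ φ)) z =
      ∫ y, (𝓕⁻ m) y * φ (z + c • y) := by
  have hint : Integrable fun y => φ (z + c • y) := by
    have h := (φ.integrable (μ := volume)).comp_add_left z
    exact (integrable_comp_smul_iff volume (fun y => φ (z + y)) hc).2 h
  have h2 := integral_fourierInv_mul m hint
  rw [h2, SchwartzMap.fourier_coe, Real.fourier_eq]
  have h5 : (fun v => Real.fourierChar (-(inner ℝ v z)) •
      (SchwartzMap.smulLeftCLM ℂ (fun η => m (c • η)) (𝓕⁻ φ)) v) =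
      fun v => (fun ξ => Real.fourierChar (-(inner ℝ (c⁻¹ • ξ) z)) • (m ξ * (𝓕⁻ φ) (c⁻¹ • ξ)))
        (c • v) := by
    ext v
    simp only [smul_smul, inv_mul_cancel₀ hc, one_smul,
      SchwartzMap.smulLeftCLM_apply_apply (hasTemperateGrowth_dilation c m), smul_eq_mul]
  rw [h5]
  refine (Measure.integral_comp_smul volume (fun ξ => Real.fourierChar
    (-(inner ℝ (c⁻¹ • ξ) z)) • (m ξ * (𝓕⁻ φ) (c⁻¹ • ξ))) c).trans ?_
  rw [← integral_smul]
  refine integral_congr_ae (Eventually.of_forall fun ξ => ?_)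
  simp only [fourierInv_comp_affine hc]
  rw [real_inner_comm]
  simp only [Circle.smul_def, smul_eq_mul, Complex.real_smul]
  ring

theorem integrable_shift_mul (c : ℝ) {φ k : Space d → ℂ} (hφ : Continuous φ) (hk : Continuous k)
    (hφi : Integrable φ) (hki : Integrable k) :
    Integrable (fun q : Space d × Space d => φ (q.1 + c • q.2) * k q.2) (volume.prod volume) := by
  have hcont : Continuous fun q : Space d × Space d => φ (q.1 + c • q.2) * k q.2 := by fun_prop
  rw [integrable_prod_iff' hcont.aestronglyMeasurable]
  refine ⟨Eventually.of_forall fun y => (hφi.comp_add_right (c • y)).mul_const (k y), ?_⟩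
  have h : ∀ y : Space d, ∫ x, ‖φ (x + c • y) * k y‖ = (∫ x, ‖φ x‖) * ‖k y‖ := fun y => by
    simp only [norm_mul, integral_mul_const]
    rw [integral_add_right_eq_self (fun x => ‖φ x‖) (c • y)]
  simp only [h]
  exact hki.norm.const_mul _

/-- Fubini and translation invariance transfer the kernel from `f` to the test function. -/
theorem integral_mul_kernel_integral (c : ℝ) {φ k : Space d → ℂ} (hφ : Continuous φ)
    (hk : Continuous k) (hφi : Integrable φ) (hki : Integrable k) (f : Cb d) :
    ∫ x, φ x * ∫ y, k y * f (x - c • y) = ∫ x, (∫ y, k y * φ (x + c • y)) * f x := by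
  have hI := integrable_shift_mul c hφ hk hφi hki
  have hI1 : Integrable (fun q : Space d × Space d => (φ (q.1 + c • q.2) * k q.2) * f q.1)
      (volume.prod volume) :=
    hI.mul_bdd (c := ‖f‖) (f.continuous.comp continuous_fst).aestronglyMeasurable
      (Eventually.of_forall fun q => f.norm_coe_le_norm _)
  have hI2 : Integrable (fun q : Space d × Space d => (φ q.1 * k q.2) * f (q.1 - c • q.2))
      (volume.prod volume) :=
    (hφi.mul_prod hki).mul_bdd (c := ‖f‖)
      (f.continuous.comp (continuous_shift c)).aestronglyMeasurable
      (Eventually.of_forall fun q => f.norm_coe_le_norm _)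
  calc ∫ x, φ x * ∫ y, k y * f (x - c • y)
      = ∫ x, ∫ y, (φ x * k y) * f (x - c • y) := by
        simp only [mul_assoc, integral_const_mul]
    _ = ∫ y, ∫ x, (φ x * k y) * f (x - c • y) := integral_integral_swap hI2
    _ = ∫ y, ∫ x, (φ (x + c • y) * k y) * f x := by
        refine integral_congr_ae (Eventually.of_forall fun y => ?_)
        have := integral_add_right_eq_self (μ := volume)
          (fun x => (φ x * k y) * f (x - c • y)) (c • y)
        simp only [add_sub_cancel_right] at this
        exact this.symm
    _ = ∫ x, ∫ y, (φ (x + c • y) * k y) * f x := (integral_integral_swap hI1).symm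
    _ = _ := by simp only [integral_mul_const, mul_comm]

theorem toDist_op {c : ℝ} (hc : c ≠ 0) (m : 𝓢(Space d, ℂ)) (f : Cb d) :
    toDist (op c m f) =
      TemperedDistribution.fourierMultiplierCLM ℂ (fun η => m (c • η)) (toDist f) := by
  ext φ
  rw [TemperedDistribution.fourierMultiplierCLM_apply_apply, toDist_apply, toDist_apply]
  simp only [fourier_smulLeft_fourierInv hc, op_apply]
  exact integral_mul_kernel_integral c φ.continuous (𝓕⁻ m).continuous φ.integrable
    (𝓕⁻ m).integrable f

/-! ### Symbol calculus. -/

/-- The operator `T` is the Fourier multiplier with symbol `g`. -/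
def IsMult (T : Cb d →L[ℂ] Cb d) (g : Space d → ℂ) : Prop :=
  g.HasTemperateGrowth ∧
    ∀ f, toDist (T f) = TemperedDistribution.fourierMultiplierCLM ℂ g (toDist f)

theorem isMult_op {c : ℝ} (hc : c ≠ 0) (m : 𝓢(Space d, ℂ)) : IsMult (op c m) fun η => m (c • η) :=
  ⟨hasTemperateGrowth_dilation c m, toDist_op hc m⟩

/-- An operator is determined by its symbol. Compositions, telescoping identities, commutations and
semigroup laws thereby become pointwise identities between functions of `η`. -/
theorem IsMult.eq {T T' : Cb d →L[ℂ] Cb d} {g g' : Space d → ℂ} (h : IsMult T g) (h' : IsMult T' g')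
    (hg : ∀ η, g η = g' η) : T = T' := by
  obtain rfl : g = g' := funext hg
  ext1 f
  exact toDist_injective ((h.2 f).trans (h'.2 f).symm)

theorem IsMult.mul {T T' : Cb d →L[ℂ] Cb d} {g g' : Space d → ℂ} (h : IsMult T g)
    (h' : IsMult T' g') : IsMult (T * T') (fun η => g' η * g η) := by
  refine ⟨h'.1.mul h.1, fun f => ?_⟩
  rw [show (T * T') f = T (T' f) from rfl, h.2, h'.2,
    TemperedDistribution.fourierMultiplierCLM_fourierMultiplierCLM_apply h'.1 h.1]
  rfl

theorem IsMult.add {T T' : Cb d →L[ℂ] Cb d} {g g' : Space d → ℂ} (h : IsMult T g)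
    (h' : IsMult T' g') : IsMult (T + T') (fun η => g η + g' η) := by
  refine ⟨h.1.add h'.1, fun f => ?_⟩
  rw [show (T + T') f = T f + T' f from rfl, toDist_add, h.2, h'.2]
  ext φ
  simp only [TemperedDistribution.fourierMultiplierCLM_apply_apply, add_apply]
  rw [show (fun η => g η + g' η) = g + g' from rfl, SchwartzMap.smulLeftCLM_add h.1 h'.1]
  simp [FourierTransform.fourier_add]

theorem IsMult.smul {T : Cb d →L[ℂ] Cb d} {g : Space d → ℂ} (h : IsMult T g) (a : ℂ) :
    IsMult (a • T) (fun η => a * g η) := by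
  refine ⟨(Function.HasTemperateGrowth.const a).mul h.1, fun f => ?_⟩
  rw [show (a • T) f = a • T f from rfl, toDist_smul, h.2]
  have := TemperedDistribution.fourierMultiplierCLM_smul (F := ℂ) h.1 a
  rw [show (fun η => a * g η) = a • g from rfl, this]
  rfl

theorem IsMult.sub {T T' : Cb d →L[ℂ] Cb d} {g g' : Space d → ℂ} (h : IsMult T g)
    (h' : IsMult T' g') : IsMult (T - T') (fun η => g η - g' η) := by
  have := h.add (h'.smul (-1))
  convert this using 1
  · ext1 f; simp [sub_eq_add_neg]
  · ext η; ring

theorem IsMult.zero : IsMult (0 : Cb d →L[ℂ] Cb d) (fun _ => 0) := by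
  refine ⟨Function.HasTemperateGrowth.zero, fun f => ?_⟩
  rw [TemperedDistribution.fourierMultiplierCLM_const]
  ext φ
  simp [toDist_apply]

theorem IsMult.one : IsMult (1 : Cb d →L[ℂ] Cb d) (fun _ => 1) := by
  refine ⟨Function.HasTemperateGrowth.const 1, fun f => ?_⟩
  rw [TemperedDistribution.fourierMultiplierCLM_const]
  simp

theorem IsMult.commute {T T' : Cb d →L[ℂ] Cb d} {g g' : Space d → ℂ} (h : IsMult T g)
    (h' : IsMult T' g') : Commute T T' :=
  (h.mul h').eq (h'.mul h) fun _ => mul_comm _ _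

/-! ### Bernstein's inequality, approximation of the identity, and spectra of products. -/

theorem lintegral_comp_sub_smul {c : ℝ} (hc : 0 < c) {g : Space d → ℝ≥0∞} (hg : Measurable g)
    (x : Space d) : ∫⁻ y, g (x - c • y) = ENNReal.ofReal ((c ^ d)⁻¹) * ∫⁻ y, g y := by
  have h1 : ∫⁻ y, g (x - c • y) = ∫⁻ y, g (x - y) ∂(Measure.map (fun y => c • y) volume) := by
    rw [lintegral_map (by fun_prop) (by fun_prop)]
  have h2 : Measure.map (fun y : Space d => c • y) volume = ENNReal.ofReal ((c ^ d)⁻¹) • volume := by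
    have := Measure.map_addHaar_smul (volume : Measure (Space d)) hc.ne'
    rw [finrank_euclideanSpace_fin, abs_of_nonneg (by positivity)] at this
    exact this
  rw [h1, h2, lintegral_smul_measure, lintegral_sub_left_eq_self, smul_eq_mul]

/-- Bernstein's inequality for convolution operators. -/
theorem exists_enorm_op_le {p : ℝ≥0∞} (hp1 : 1 ≤ p) (hp : p ≠ ∞) (m : 𝓢(Space d, ℂ)) :
    ∃ C : ℝ≥0∞, C ≠ ∞ ∧ ∀ c : ℝ, 0 < c → ∀ (f : Cb d) (x : Space d),
      ‖op c m f x‖ₑ ≤ C * ENNReal.ofReal (c ^ (-(d / p.toReal))) * eLpNorm f p volume := by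
  set P := p.toReal with hP
  have hP1 : 1 ≤ P := one_le_toReal hp1 hp
  have hP0 : 0 < P := by linarith
  -- Jensen's inequality with the kernel as weight leaves one factor `|kernel|`, bounded here by
  -- `M`. The change of variables `y ↦ x - c y` yields `c^(-d)`, hence `c^(-d/p)` after the `p`-th
  -- root.
  obtain ⟨M, hM⟩ : ∃ M : ℝ, ∀ y, ‖(𝓕⁻ m) y‖ ≤ M :=
    ⟨_, fun y => SchwartzMap.norm_le_seminorm ℝ (𝓕⁻ m) y⟩
  have hMe : ∀ y, ‖(𝓕⁻ m) y‖ₑ ≤ ENNReal.ofReal M := fun y => by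
    rw [← ofReal_norm]; exact ENNReal.ofReal_le_ofReal (hM y)
  refine ⟨(ENNReal.ofReal (kerNorm m) ^ (P - 1) * ENNReal.ofReal M) ^ P⁻¹,
    ENNReal.rpow_ne_top_of_nonneg (by positivity) (ENNReal.mul_ne_top
      (ENNReal.rpow_ne_top_of_nonneg (by linarith) ENNReal.ofReal_ne_top) ENNReal.ofReal_ne_top),
    fun c hc f x => ?_⟩
  have hf0 : Measurable fun y => ‖f y‖ₑ := f.continuous.measurable.enorm
  have hf : Measurable fun y => ‖f y‖ₑ ^ P := hf0.pow_const P
  have hshift : Measurable fun y => x - c • y := by fun_prop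
  have h1 : ‖op c m f x‖ₑ ^ P ≤ ENNReal.ofReal (kerNorm m) ^ (P - 1) *
      (ENNReal.ofReal M * (ENNReal.ofReal ((c ^ d)⁻¹) * ∫⁻ y, ‖f y‖ₑ ^ P)) := by
    calc ‖op c m f x‖ₑ ^ P ≤ (∫⁻ y, ‖(𝓕⁻ m) y‖ₑ * ‖f (x - c • y)‖ₑ) ^ P :=
          ENNReal.rpow_le_rpow (enorm_op_apply_le c m f x) hP0.le
      _ ≤ (∫⁻ y, ‖(𝓕⁻ m) y‖ₑ) ^ (P - 1) * ∫⁻ y, ‖(𝓕⁻ m) y‖ₑ * ‖f (x - c • y)‖ₑ ^ P :=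
          lintegral_mul_rpow_le volume (𝓕⁻ m).continuous.measurable.enorm.aemeasurable
          (hf0.comp hshift).aemeasurable hP1
      _ ≤ ENNReal.ofReal (kerNorm m) ^ (P - 1) *
          ∫⁻ y, ENNReal.ofReal M * ‖f (x - c • y)‖ₑ ^ P := by
          rw [ofReal_kerNorm]
          gcongr with y
          exact hMe y
      _ = _ := by
          rw [lintegral_const_mul' _ _ ENNReal.ofReal_ne_top, lintegral_comp_sub_smul hc hf]
  have h2 : ‖op c m f x‖ₑ = (‖op c m f x‖ₑ ^ P) ^ P⁻¹ := by
    rw [← ENNReal.rpow_mul, mul_inv_cancel₀ hP0.ne', ENNReal.rpow_one]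
  have h3 : ENNReal.ofReal (c ^ (-(d / P))) = ENNReal.ofReal ((c ^ d)⁻¹) ^ P⁻¹ := by
    rw [ENNReal.ofReal_rpow_of_nonneg (by positivity) (by positivity)]
    congr 1
    rw [← Real.rpow_natCast, ← Real.rpow_neg hc.le, ← Real.rpow_mul hc.le]
    congr 1; ring
  rw [h2, h3, eLpNorm_eq_lintegral_rpow hp1 hp, ← hP, ← ENNReal.mul_rpow_of_nonneg _ _ (by positivity),
    ← ENNReal.mul_rpow_of_nonneg _ _ (by positivity)]
  refine ENNReal.rpow_le_rpow (h1.trans (le_of_eq ?_)) (by positivity)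
  ring

/-- As `c → 0` the rescaled kernel concentrates at the origin with total mass `m 0`. The convergence
is only pointwise, since `f` need not be uniformly continuous. -/
theorem tendsto_op_apply (m : 𝓢(Space d, ℂ)) (f : Cb d) (x : Space d) :
    Tendsto (fun c : ℝ => op c m f x) (𝓝 0) (𝓝 (m 0 * f x)) := by
  have h0 : ∫ y, (𝓕⁻ m) y = m 0 := by
    have : 𝓕 (𝓕⁻ m) (0 : Space d) = m 0 := by rw [FourierTransform.fourier_fourierInv_eq]
    rw [← this, SchwartzMap.fourier_coe, Real.fourier_eq]
    simp
  rw [← h0, ← integral_mul_const]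
  simp only [op_apply]
  refine tendsto_integral_filter_of_dominated_convergence (fun y => ‖(𝓕⁻ m) y‖ * ‖f‖)
    (Eventually.of_forall fun c => (integrable_kernel_mul c m f x).aestronglyMeasurable)
    (Eventually.of_forall fun c => Eventually.of_forall fun y => ?_)
    ((𝓕⁻ m).integrable.norm.mul_const _) (Eventually.of_forall fun y => ?_)
  · rw [norm_mul]; gcongr; exact f.norm_coe_le_norm _
  · have hc : Continuous fun c : ℝ => (𝓕⁻ m) y * f (x - c • y) := by fun_prop
    simpa using hc.tendsto 0

/-- The symbol of the modulated product kernel used to localize spectra of products. -/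
theorem fourier_mul_kernel_eq_zero {m₀ m₁ m₂ : 𝓢(Space d, ℂ)}
    (h : ∀ α β, m₀ (α + β) * m₁ α * m₂ β = 0) (w ξ : Space d) :
    (∫ y, Real.fourierChar (-inner ℝ y ξ) • ((𝓕⁻ m₂) (w - y) * (𝓕⁻ m₀) y)) * m₁ ξ = 0 := by
  by_cases h1 : m₁ ξ = 0
  · rw [h1, mul_zero]
  have hint : Integrable fun y => Real.fourierChar (-inner ℝ y ξ) • (𝓕⁻ m₂) (w - y) := by
    have := (𝓕⁻ m₂).integrable (μ := volume) |>.comp_sub_left w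
    refine this.norm.mono' ?_ (Eventually.of_forall fun y => ?_)
    · refine (Continuous.aestronglyMeasurable ?_)
      exact (Real.continuous_fourierChar.comp (by fun_prop)).smul ((𝓕⁻ m₂).continuous.comp (by fun_prop))
    · rw [Circle.norm_smul]
  have h2 : ∫ y, Real.fourierChar (-inner ℝ y ξ) • ((𝓕⁻ m₂) (w - y) * (𝓕⁻ m₀) y) =
      ∫ y, (𝓕⁻ m₀) y * (Real.fourierChar (-inner ℝ y ξ) • (𝓕⁻ m₂) (w - y)) := by
    congr 1; ext y; simp only [Circle.smul_def, smul_eq_mul]; ring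
  rw [h2, integral_fourierInv_mul m₀ hint]
  -- The inverse transform of the modulated, reflected kernel is a translate of `m₂` up to a phase.
  -- The integral thus contains `m₀ α * m₂ (α - ξ)`, and multiplying by `m₁ ξ` gives zero by the
  -- hypothesis with `β = α - ξ`.
  have h3 : ∀ α, 𝓕⁻ (fun y : Space d => (Real.fourierChar (-inner ℝ y ξ) • (𝓕⁻ m₂) (w - y) : ℂ)) α =
      Real.fourierChar (inner ℝ w (α - ξ)) • m₂ (α - ξ) := by
    intro α
    rw [Real.fourierInv_eq]
    refine (integral_sub_left_eq_self (fun y : Space d => (Real.fourierChar (inner ℝ y α) •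
      (Real.fourierChar (-inner ℝ y ξ) • (𝓕⁻ m₂) (w - y)) : ℂ)) volume w).symm.trans ?_
    have h4 : m₂ (α - ξ) = ∫ y, Real.fourierChar (-inner ℝ y (α - ξ)) • (𝓕⁻ m₂) y := by
      have : 𝓕 (𝓕⁻ m₂) (α - ξ) = m₂ (α - ξ) := by rw [FourierTransform.fourier_fourierInv_eq]
      rw [← this, SchwartzMap.fourier_coe, Real.fourier_eq]
    rw [h4]
    simp only [Circle.smul_def]
    rw [← integral_smul]
    refine integral_congr_ae (Eventually.of_forall fun y => ?_)
    simp only [sub_sub_cancel, smul_smul, ← Circle.coe_mul, ← AddChar.map_add_eq_mul]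
    have key : inner ℝ (w - y) α + -inner ℝ (w - y) ξ = inner ℝ w (α - ξ) + -inner ℝ y (α - ξ) := by
      simp only [inner_sub_left, inner_sub_right]; ring
    rw [key]
  simp only [h3]
  rw [integral_eq_zero_of_ae, zero_mul]
  refine Eventually.of_forall fun α => ?_
  have h5 := h ξ (α - ξ)
  rw [add_sub_cancel, mul_right_comm] at h5
  have h6 : m₀ α * m₂ (α - ξ) = 0 := (mul_eq_zero.1 h5).resolve_right h1
  simp only [Circle.smul_def, smul_eq_mul, Pi.zero_apply]
  rw [mul_left_comm, h6, mul_zero]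

/-- The spectrum of a product lies in the sum of the spectra. -/
theorem op_mul_eq_zero {c : ℝ} (hc : c ≠ 0) {m₀ m₁ m₂ : 𝓢(Space d, ℂ)}
    (h : ∀ α β, m₀ (α + β) * m₁ α * m₂ β = 0) (f g : Cb d) :
    op c m₀ (op c m₁ f * op c m₂ g) = 0 := by
  ext x
  set F := op c m₁ f with hF
  have hk2 : ∀ w, (fun y => (𝓕⁻ m₂) (w - y)).HasTemperateGrowth := fun w =>
    (𝓕⁻ m₂).hasTemperateGrowth.comp
      ((Function.HasTemperateGrowth.const w).sub Function.HasTemperateGrowth.id)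
  -- Only the convolution defining the second factor is expanded. For fixed `w`, the remaining
  -- integral is a multiplier with Schwartz symbol applied to `F`, and its symbol times that of `op
  -- c m₁` vanishes. No Fourier transform of the product is ever taken.
  have hzero : ∀ w, ∫ y, ((𝓕⁻ m₂) (w - y) * (𝓕⁻ m₀) y) * F (x - c • y) = 0 := by
    intro w
    set K : 𝓢(Space d, ℂ) := SchwartzMap.smulLeftCLM ℂ (fun y => (𝓕⁻ m₂) (w - y)) (𝓕⁻ m₀) with hK
    have hKy : ∀ y, K y = (𝓕⁻ m₂) (w - y) * (𝓕⁻ m₀) y := fun y => by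
      rw [hK, SchwartzMap.smulLeftCLM_apply_apply (hk2 w), smul_eq_mul]
    have h1 : op c (𝓕 K) * op c m₁ = 0 := by
      refine ((isMult_op hc (𝓕 K)).mul (isMult_op hc m₁)).eq IsMult.zero fun η => ?_
      rw [mul_comm, SchwartzMap.fourier_coe, Real.fourier_eq]
      simp only [hKy]
      exact fourier_mul_kernel_eq_zero h w (c • η)
    have h2 : op c (𝓕 K) F x = 0 := by
      rw [hF, show op c (𝓕 K) (op c m₁ f) = (op c (𝓕 K) * op c m₁) f from rfl, h1]; rfl
    rw [op_apply, FourierTransform.fourierInv_fourier_eq] at h2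
    simpa only [hKy] using h2
  have hI : Integrable (fun q : Space d × Space d =>
      ((𝓕⁻ m₀) q.1 * (𝓕⁻ m₂) (q.2 - q.1)) * (F (x - c • q.1) * g (x - c • q.2)))
      (volume.prod volume) := by
    have h0 := (integrable_shift_mul (-1) (𝓕⁻ m₂).continuous (𝓕⁻ m₀).continuous
      (𝓕⁻ m₂).integrable (𝓕⁻ m₀).integrable).swap
    refine Integrable.mul_bdd (c := ‖F‖ * ‖g‖) ?_ (Continuous.aestronglyMeasurable (by fun_prop))
      (Eventually.of_forall fun q => ?_)
    · refine h0.congr (Eventually.of_forall fun q => ?_)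
      simp [mul_comm, sub_eq_add_neg]
    · rw [norm_mul]
      exact mul_le_mul (F.norm_coe_le_norm _) (g.norm_coe_le_norm _) (norm_nonneg _) (norm_nonneg _)
  rw [op_apply]
  calc ∫ y, (𝓕⁻ m₀) y * (F * op c m₂ g) (x - c • y)
      = ∫ y, ∫ w, ((𝓕⁻ m₀) y * (𝓕⁻ m₂) (w - y)) * (F (x - c • y) * g (x - c • w)) := by
        refine integral_congr_ae (Eventually.of_forall fun y => ?_)
        simp only [BoundedContinuousFunction.mul_apply, op_apply]
        rw [← integral_sub_right_eq_self _ y, ← integral_const_mul, ← integral_const_mul]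
        refine integral_congr_ae (Eventually.of_forall fun w => ?_)
        have hxy : x - c • y - c • (w - y) = x - c • w := by rw [smul_sub]; abel
        simp only [hxy]
        ring
    _ = ∫ w, ∫ y, ((𝓕⁻ m₀) y * (𝓕⁻ m₂) (w - y)) * (F (x - c • y) * g (x - c • w)) :=
        integral_integral_swap hI
    _ = ∫ w, (∫ y, ((𝓕⁻ m₂) (w - y) * (𝓕⁻ m₀) y) * F (x - c • y)) * g (x - c • w) := by
        refine integral_congr_ae (Eventually.of_forall fun w => ?_)
        simp only []
        rw [← integral_mul_const]
        refine integral_congr_ae (Eventually.of_forall fun y => ?_)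
        simp only []
        ring
    _ = 0 := by simp [hzero]

/-! ### Dyadic blocks -/

/-- The scale `2^{-j} 2π` of the `j`-th dyadic block. -/
def freq (j : ℤ) : ℝ := (2 : ℝ) ^ (-j) * (2 * Real.pi)

theorem freq_pos (j : ℤ) : 0 < freq j := by unfold freq; positivity

theorem freq_ne (j : ℤ) : freq j ≠ 0 := (freq_pos j).ne'

theorem freq_add (i j : ℤ) : (2 : ℝ) ^ (-i) * freq j = freq (j + i) := by
  unfold freq
  rw [← mul_assoc, ← zpow_add₀ (by norm_num)]
  congr 2; ring

theorem tendsto_freq_atTop : Tendsto freq atTop (𝓝 0) := by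
  have h : Tendsto (fun n : ℕ => ((1 / 2 : ℝ)) ^ n * (2 * Real.pi)) atTop (𝓝 (0 * (2 * Real.pi))) :=
    (tendsto_pow_atTop_nhds_zero_of_lt_one (by norm_num) (by norm_num)).mul_const _
  rw [zero_mul] at h
  have h2 : Tendsto (fun j : ℤ => ((1 / 2 : ℝ)) ^ j.toNat * (2 * Real.pi)) atTop (𝓝 0) := by
    refine h.comp (tendsto_atTop_atTop.2 fun b => ⟨b, fun a ha => by omega⟩)
  refine h2.congr' ?_
  filter_upwards [eventually_ge_atTop 0] with j hj
  unfold freq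
  obtain ⟨n, rfl⟩ := Int.eq_ofNat_of_zero_le hj
  simp

theorem Cutoff.hasCompactSupport (χ : Cutoff d) : HasCompactSupport χ.toFun :=
  HasCompactSupport.intro (isCompact_closedBall (0 : Space d) (4 / 3)) fun x hx => by
    by_contra h
    exact hx (Metric.ball_subset_closedBall (χ.support_subset (subset_tsupport _ h)))

/-- The dilated cut-off `ξ ↦ χ(2^{-i} ξ)`. -/
def chiD (χ : Cutoff d) (i : ℤ) : 𝓢(Space d, ℂ) :=
  HasCompactSupport.toSchwartzMap (f := fun ξ => (χ.toFun ((2 : ℝ) ^ (-i) • ξ) : ℂ))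
    ((χ.hasCompactSupport.comp_smul (by positivity)).comp_left
      (g := fun r : ℝ => (r : ℂ)) Complex.ofReal_zero)
    (Complex.ofRealCLM.contDiff.comp (χ.smooth.comp (contDiff_const_smul _)))

theorem chiD_apply (χ : Cutoff d) (i : ℤ) (ξ : Space d) :
    chiD χ i ξ = (χ.toFun ((2 : ℝ) ^ (-i) • ξ) : ℂ) := rfl

theorem norm_zpow_smul (i : ℤ) (ξ : Space d) : ‖(2 : ℝ) ^ (-i) • ξ‖ = (2 : ℝ) ^ (-i) * ‖ξ‖ := by
  rw [norm_smul, Real.norm_of_nonneg (by positivity)]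

theorem chiD_eq_one (χ : Cutoff d) {i : ℤ} {ξ : Space d} (h : ‖ξ‖ ≤ 3 / 4 * (2 : ℝ) ^ i) :
    chiD χ i ξ = 1 := by
  rw [chiD_apply, χ.eq_one, Complex.ofReal_one]
  rw [mem_closedBall_zero_iff, norm_zpow_smul, zpow_neg, inv_mul_le_iff₀ (by positivity)]
  linarith

theorem chiD_eq_zero (χ : Cutoff d) {i : ℤ} {ξ : Space d} (h : 4 / 3 * (2 : ℝ) ^ i ≤ ‖ξ‖) :
    chiD χ i ξ = 0 := by
  rw [chiD_apply, Complex.ofReal_eq_zero]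
  by_contra h0
  have := χ.support_subset (subset_tsupport _ h0)
  rw [mem_ball_zero_iff, norm_zpow_smul, zpow_neg, inv_mul_lt_iff₀ (by positivity)] at this
  linarith

theorem norm_lt_of_chiD_ne_zero (χ : Cutoff d) {i : ℤ} {ξ : Space d} (h : chiD χ i ξ ≠ 0) :
    ‖ξ‖ < 4 / 3 * (2 : ℝ) ^ i := by
  by_contra h0
  exact h (chiD_eq_zero χ (not_lt.1 h0))

/-- The symbol of a dyadic block. -/
def phi (χ : Cutoff d) : 𝓢(Space d, ℂ) := chiD χ 1 - chiD χ 0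

theorem phi_apply (χ : Cutoff d) (ξ : Space d) : phi χ ξ = chiD χ 1 ξ - chiD χ 0 ξ := rfl

theorem phi_eq_zero (χ : Cutoff d) {ξ : Space d} (h : ‖ξ‖ ≤ 3 / 4 ∨ 8 / 3 ≤ ‖ξ‖) : phi χ ξ = 0 := by
  rw [phi_apply]
  rcases h with h | h
  · rw [chiD_eq_one χ (by norm_num; linarith), chiD_eq_one χ (by norm_num; linarith), sub_self]
  · rw [chiD_eq_zero χ (by norm_num; linarith), chiD_eq_zero χ (by norm_num; linarith), sub_self]

/-- A symbol supported in an annulus and equal to one on the support of `phi`. -/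
def phiT (χ : Cutoff d) : 𝓢(Space d, ℂ) := chiD χ 2 - chiD χ (-1)

theorem phiT_apply (χ : Cutoff d) (ξ : Space d) : phiT χ ξ = chiD χ 2 ξ - chiD χ (-1) ξ := rfl

theorem phiT_eq_zero (χ : Cutoff d) {ξ : Space d} (h : ‖ξ‖ ≤ 3 / 8 ∨ 16 / 3 ≤ ‖ξ‖) :
    phiT χ ξ = 0 := by
  rw [phiT_apply]
  rcases h with h | h
  · rw [chiD_eq_one χ (by norm_num; linarith), chiD_eq_one χ (by norm_num; linarith), sub_self]
  · rw [chiD_eq_zero χ (by norm_num; linarith), chiD_eq_zero χ (by norm_num; linarith), sub_self]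

theorem phiT_mul_phi (χ : Cutoff d) (ξ : Space d) : phiT χ ξ * phi χ ξ = phi χ ξ := by
  by_cases h : ‖ξ‖ ≤ 3 / 4 ∨ 8 / 3 ≤ ‖ξ‖
  · rw [phi_eq_zero χ h, mul_zero]
  · push Not at h
    rw [phiT_apply, chiD_eq_one χ (by norm_num; linarith), chiD_eq_zero χ (by norm_num; linarith),
      sub_zero, one_mul]

/-- The low-frequency cut-off operator on bounded functions. -/
def S (χ : Cutoff d) (j : ℤ) : Cb d →L[ℂ] Cb d := op (freq j) (chiD χ 0)

/-- The dyadic block operator on bounded functions. -/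
def Dl (χ : Cutoff d) (j : ℤ) : Cb d →L[ℂ] Cb d := op (freq j) (phi χ)

/-- A dilation of the symbol is a shift of the dyadic index, so that neighbouring cut-offs can all
be written at the single scale `freq j`. -/
theorem op_freq_chiD (χ : Cutoff d) (i j : ℤ) : op (freq j) (chiD χ i) = S χ (j + i) := by
  refine (isMult_op (freq_ne j) _).eq (isMult_op (freq_ne (j + i)) _) fun η => ?_
  rw [chiD_apply, chiD_apply, smul_smul, freq_add]
  simp

theorem op_sub {c : ℝ} (hc : c ≠ 0) (m m' : 𝓢(Space d, ℂ)) : op c (m - m') = op c m - op c m' :=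
  (isMult_op hc _).eq ((isMult_op hc m).sub (isMult_op hc m')) fun _ => rfl

theorem op_comp {c : ℝ} (hc : c ≠ 0) {m m₁ m₂ : 𝓢(Space d, ℂ)} (h : ∀ ξ, m ξ = m₁ ξ * m₂ ξ) :
    op c m = op c m₁ * op c m₂ :=
  (isMult_op hc _).eq ((isMult_op hc m₁).mul (isMult_op hc m₂)) fun η => by rw [h, mul_comm]

theorem Dl_eq (χ : Cutoff d) (j : ℤ) : Dl χ j = S χ (j + 1) - S χ j := by
  rw [Dl, phi, op_sub (freq_ne j), op_freq_chiD, op_freq_chiD, add_zero]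

theorem S_eq_add_sum (χ : Cutoff d) (a : ℤ) (n : ℕ) :
    S χ (a + n) = S χ a + ∑ i ∈ Finset.range n, Dl χ (a + i) := by
  induction n with
  | zero => simp
  | succ n ih =>
    rw [Finset.sum_range_succ, ← add_assoc, ← ih, Dl_eq]
    push_cast
    rw [← add_assoc]; abel

/-- The enlarged annular symbol reproduces a block; Bernstein's inequality for the corresponding
kernel then applies to the block itself. -/
theorem opT_Dl (χ : Cutoff d) (j : ℤ) (f : Cb d) : op (freq j) (phiT χ) (Dl χ j f) = Dl χ j f := by
  have h := op_comp (freq_ne j) (m := phi χ) (m₁ := phiT χ) (m₂ := phi χ)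
    fun ξ => (phiT_mul_phi χ ξ).symm
  exact (congrArg (fun T => T f) h).symm

theorem norm_S_apply_le (χ : Cutoff d) (j : ℤ) (f : Cb d) : ‖S χ j f‖ ≤ kerNorm (chiD χ 0) * ‖f‖ :=
  norm_op_apply_le _ _ f

theorem tendsto_S_apply (χ : Cutoff d) (f : Cb d) (x : Space d) :
    Tendsto (fun j => S χ j f x) atTop (𝓝 (f x)) := by
  have h := (tendsto_op_apply (chiD χ 0) f x).comp tendsto_freq_atTop
  rw [chiD_eq_one χ (by norm_num), one_mul] at h
  exact h

/-- Bounded pointwise convergence is the mode in which `S χ j f` tends to `f`, and convolution with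
an integrable kernel preserves it. -/
theorem tendsto_op_of_bounded (c : ℝ) (m : 𝓢(Space d, ℂ)) {u : ℕ → Cb d} {f : Cb d} {M : ℝ}
    (hM : ∀ n, ‖u n‖ ≤ M) (h : ∀ x, Tendsto (fun n => u n x) atTop (𝓝 (f x))) (x : Space d) :
    Tendsto (fun n => op c m (u n) x) atTop (𝓝 (op c m f x)) := by
  simp only [op_apply]
  refine tendsto_integral_of_dominated_convergence (fun y => ‖(𝓕⁻ m) y‖ * M)
    (fun n => (integrable_kernel_mul c m (u n) x).aestronglyMeasurable)
    ((𝓕⁻ m).integrable.norm.mul_const _) (fun n => Eventually.of_forall fun y => ?_)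
    (Eventually.of_forall fun y => (h _).const_mul _)
  rw [norm_mul]
  gcongr
  exact ((u n).norm_coe_le_norm _).trans (hM n)

/-! ### Besov semi-norms of bounded functions -/

/-- The `L^p` norm of the `j`-th block. -/
def blk (χ : Cutoff d) (p : ℝ≥0∞) (j : ℤ) (f : Cb d) : ℝ≥0∞ := eLpNorm (Dl χ j f) p volume

/-- The dyadic weight `2^{jσ}`. -/
def wt (σ : ℝ) (j : ℤ) : ℝ≥0∞ := ENNReal.ofReal ((2 : ℝ) ^ ((j : ℝ) * σ))

/-- The homogeneous Besov semi-norm of a bounded function. -/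
def bes (χ : Cutoff d) (σ : ℝ) (p : ℝ≥0∞) (f : Cb d) : ℝ≥0∞ := ∑' j : ℤ, wt σ j * blk χ p j f

theorem wt_ne_top (σ : ℝ) (j : ℤ) : wt σ j ≠ ∞ := ENNReal.ofReal_ne_top

theorem wt_ne_zero (σ : ℝ) (j : ℤ) : wt σ j ≠ 0 := by
  unfold wt; simp only [ne_eq, ENNReal.ofReal_eq_zero, not_le]; positivity

theorem wt_add (σ : ℝ) (i j : ℤ) : wt σ (i + j) = wt σ i * wt σ j := by
  unfold wt
  rw [← ENNReal.ofReal_mul (by positivity), ← Real.rpow_add (by norm_num)]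
  congr 2; push_cast; ring

theorem wt_add_exp (σ τ : ℝ) (j : ℤ) : wt (σ + τ) j = wt σ j * wt τ j := by
  unfold wt
  rw [← ENNReal.ofReal_mul (by positivity), ← Real.rpow_add (by norm_num)]
  congr 2; ring

theorem eLpNorm_mul_Cb_le (p : ℝ≥0∞) (f g : Cb d) :
    eLpNorm (f * g : Cb d) p volume ≤ ‖g‖ₑ * eLpNorm f p volume := by
  have h : ‖g‖ₑ = ‖(‖g‖ : ℂ)‖ₑ := by
    rw [← ofReal_norm, ← ofReal_norm, Complex.norm_real, norm_norm]
  rw [h, ← eLpNorm_const_smul]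
  refine eLpNorm_mono fun x => ?_
  simp only [BoundedContinuousFunction.coe_mul, Pi.mul_apply, Pi.smul_apply, smul_eq_mul, norm_mul,
    Complex.norm_real, norm_norm]
  rw [mul_comm]
  gcongr
  exact g.norm_coe_le_norm x

theorem blk_add_le {p : ℝ≥0∞} (hp1 : 1 ≤ p) (χ : Cutoff d) (j : ℤ) (f g : Cb d) :
    blk χ p j (f + g) ≤ blk χ p j f + blk χ p j g := by
  unfold blk
  rw [map_add]
  exact eLpNorm_add_le (aestronglyMeasurable_Cb _) (aestronglyMeasurable_Cb _) hp1

theorem blk_sub_le {p : ℝ≥0∞} (hp1 : 1 ≤ p) (χ : Cutoff d) (j : ℤ) (f g : Cb d) :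
    blk χ p j (f - g) ≤ blk χ p j f + blk χ p j g := by
  unfold blk
  rw [map_sub]
  exact eLpNorm_sub_le (aestronglyMeasurable_Cb _) (aestronglyMeasurable_Cb _) hp1

theorem bes_add_le {p : ℝ≥0∞} (hp1 : 1 ≤ p) (χ : Cutoff d) (σ : ℝ) (f g : Cb d) :
    bes χ σ p (f + g) ≤ bes χ σ p f + bes χ σ p g := by
  unfold bes
  rw [← ENNReal.tsum_add]
  refine ENNReal.tsum_le_tsum fun j => ?_
  rw [← mul_add]
  gcongr
  exact blk_add_le hp1 χ j f g

theorem bes_sub_le {p : ℝ≥0∞} (hp1 : 1 ≤ p) (χ : Cutoff d) (σ : ℝ) (f g : Cb d) :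
    bes χ σ p (f - g) ≤ bes χ σ p f + bes χ σ p g := by
  unfold bes
  rw [← ENNReal.tsum_add]
  refine ENNReal.tsum_le_tsum fun j => ?_
  rw [← mul_add]
  gcongr
  exact blk_sub_le hp1 χ j f g

theorem blk_hasSum_le {p : ℝ≥0∞} (hp1 : 1 ≤ p) (χ : Cutoff d) (j : ℤ) {ι : Type*} [Countable ι]
    {g : ι → Cb d} {f : Cb d} (h : HasSum g f) : blk χ p j f ≤ ∑' i, blk χ p j (g i) :=
  eLpNorm_hasSum_le hp1 ((Dl χ j).hasSum h)

theorem bes_hasSum_le {p : ℝ≥0∞} (hp1 : 1 ≤ p) (χ : Cutoff d) (σ : ℝ) {ι : Type*} [Countable ι]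
    {g : ι → Cb d} {f : Cb d} (h : HasSum g f) : bes χ σ p f ≤ ∑' i, bes χ σ p (g i) := by
  unfold bes
  rw [ENNReal.tsum_comm]
  refine ENNReal.tsum_le_tsum fun j => ?_
  rw [ENNReal.tsum_mul_left]
  gcongr
  exact blk_hasSum_le hp1 χ j h

theorem bes_smul (χ : Cutoff d) (σ : ℝ) (p : ℝ≥0∞) (a : ℂ) (f : Cb d) :
    bes χ σ p (a • f) = ‖a‖ₑ * bes χ σ p f := by
  unfold bes
  rw [← ENNReal.tsum_mul_left]
  congr 1; ext j
  unfold blk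
  rw [map_smul, BoundedContinuousFunction.coe_smul,
    show (fun x => a • Dl χ j f x) = a • (Dl χ j f : Space d → ℂ) from rfl, eLpNorm_const_smul]
  ring

/-! ### The product law -/

/-- In units of `2^k` both factors have spectrum in the ball of radius `1/3`, so their product has
spectrum in the ball of radius `2/3`, inside the hole of radius `3/4` of the annulus. -/
theorem Dl_mul_eq_zero (χ : Cutoff d) (k : ℤ) (f g : Cb d) :
    Dl χ k (S χ (k - 2) f * S χ (k - 2) g) = 0 := by
  have h : S χ (k - 2) = op (freq k) (chiD χ (-2)) := by rw [op_freq_chiD]; rfl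
  rw [h]
  refine op_mul_eq_zero (freq_ne k) (fun α β => ?_) f g
  by_cases hα : chiD χ (-2) α = 0
  · rw [hα, mul_zero, zero_mul]
  by_cases hβ : chiD χ (-2) β = 0
  · rw [hβ, mul_zero]
  have h1 := norm_lt_of_chiD_ne_zero χ hα
  have h2 := norm_lt_of_chiD_ne_zero χ hβ
  have h3 := norm_add_le α β
  rw [phi_eq_zero χ (Or.inl _), zero_mul, zero_mul]
  norm_num at h1 h2 ⊢
  linarith

/-- Telescope the products `S_j f · S_j g` from `j = k - 2`, where the `k`-th block vanishes, to
infinity. Each increment pairs a block of one function with low frequencies of the other, bounded by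
its supremum norm. This one-sided sum replaces the full paraproduct decomposition. -/
theorem blk_mul_le {p : ℝ≥0∞} (hp1 : 1 ≤ p) (hp : p ≠ ∞) (χ : Cutoff d) :
    ∃ C : ℝ≥0∞, C ≠ ∞ ∧ ∀ (f g : Cb d) (k : ℤ), blk χ p k (f * g) ≤
      C * ∑' i : ℕ, (‖g‖ₑ * blk χ p (k - 2 + i) f + ‖f‖ₑ * blk χ p (k - 2 + i) g) := by
  set K0 := ENNReal.ofReal (kerNorm (phi χ))
  set K1 := ENNReal.ofReal (kerNorm (chiD χ 0)) with hK1
  have hS : ∀ (j : ℤ) (f : Cb d), ‖S χ j f‖ₑ ≤ K1 * ‖f‖ₑ := fun j f => by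
    rw [← ofReal_norm, ← ofReal_norm, hK1, ← ENNReal.ofReal_mul (kerNorm_nonneg _)]
    exact ENNReal.ofReal_le_ofReal (norm_S_apply_le χ j f)
  refine ⟨K0 * K1, ENNReal.mul_ne_top ENNReal.ofReal_ne_top ENNReal.ofReal_ne_top, fun f g k => ?_⟩
  set a : ℕ → Cb d := fun i => Dl χ k (Dl χ (k - 2 + i) f * S χ (k - 2 + i + 1) g +
    Dl χ (k - 2 + i) g * S χ (k - 2 + i) f) with ha
  have htel : ∀ n : ℕ, ∑ i ∈ Finset.range n, a i = Dl χ k (S χ (k - 2 + n) f * S χ (k - 2 + n) g) := by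
    intro n
    induction n with
    | zero => simpa using (Dl_mul_eq_zero χ k f g).symm
    | succ n ih =>
      rw [Finset.sum_range_succ, ih, ha]
      simp only []
      rw [← map_add]
      have e : ∀ f, Dl χ (k - 2 + n) f = S χ (k - 2 + n + 1) f - S χ (k - 2 + n) f := fun f => by
        rw [Dl_eq]; rfl
      refine congrArg (Dl χ k) ?_
      rw [e, e]
      push_cast
      rw [← add_assoc]
      ring_nf
  have hlim : ∀ x, Tendsto (fun n => ∑ i ∈ Finset.range n, a i x) atTop (𝓝 (Dl χ k (f * g) x)) := by
    intro x
    have h1 : ∀ n : ℕ, ∑ i ∈ Finset.range n, a i x =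
        Dl χ k (S χ (k - 2 + n) f * S χ (k - 2 + n) g) x := fun n => by
      rw [← htel n, BoundedContinuousFunction.coe_sum, Finset.sum_apply]
    simp only [h1]
    have h2 : Tendsto (fun n : ℕ => k - 2 + (n : ℤ)) atTop atTop :=
      tendsto_atTop_add_const_left _ _ tendsto_natCast_atTop_atTop
    refine tendsto_op_of_bounded (M := (kerNorm (chiD χ 0) * ‖f‖) * (kerNorm (chiD χ 0) * ‖g‖)) _ _
      (fun n => ?_) (fun y => ?_) x
    · refine (norm_mul_le _ _).trans ?_
      have := norm_S_apply_le χ (k - 2 + n) f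
      have := norm_S_apply_le χ (k - 2 + n) g
      gcongr
      exact mul_nonneg (kerNorm_nonneg _) (norm_nonneg _)
    · exact ((tendsto_S_apply χ f y).comp h2).mul ((tendsto_S_apply χ g y).comp h2)
  refine (eLpNorm_le_tsum_of_tendsto hp1 (s := Finset.range)
    (fun i => aestronglyMeasurable_Cb (a i)) hlim).trans ?_
  rw [← ENNReal.tsum_mul_left]
  refine ENNReal.tsum_le_tsum fun i => ?_
  refine (eLpNorm_op_le hp1 hp _ _ _).trans ?_
  rw [mul_assoc]
  gcongr
  refine (eLpNorm_add_le (aestronglyMeasurable_Cb _) (aestronglyMeasurable_Cb _) hp1).trans ?_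
  rw [mul_add, ← mul_assoc, ← mul_assoc]
  gcongr
  · exact (eLpNorm_mul_Cb_le p _ _).trans (mul_le_mul_left (hS _ _) _)
  · exact (eLpNorm_mul_Cb_le p _ _).trans (mul_le_mul_left (hS _ _) _)

/-- Moving the weight `2^{kσ}` onto the block of index `k - 2 + i` costs `2^{(2-i)σ}`. The sum over
`i` is geometric, and converges because `σ > 0`. -/
theorem bes_mul_le {p : ℝ≥0∞} (hp1 : 1 ≤ p) (hp : p ≠ ∞) (χ : Cutoff d) {σ : ℝ} (hσ : 0 < σ) :
    ∃ C : ℝ≥0∞, C ≠ ∞ ∧ ∀ f g : Cb d,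
      bes χ σ p (f * g) ≤ C * (‖g‖ₑ * bes χ σ p f + ‖f‖ₑ * bes χ σ p g) := by
  obtain ⟨C, hC, h⟩ := blk_mul_le hp1 hp χ
  set r : ℝ≥0∞ := ENNReal.ofReal ((2 : ℝ) ^ (-σ)) with hr
  have hr1 : r < 1 := by
    rw [hr, ENNReal.ofReal_lt_one]
    exact Real.rpow_lt_one_of_one_lt_of_neg (by norm_num) (by linarith)
  have hG : ∑' i : ℕ, r ^ i ≠ ∞ := by
    rw [ENNReal.tsum_geometric]
    exact ENNReal.inv_ne_top.2 (tsub_pos_of_lt hr1).ne'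
  refine ⟨C * (wt σ 2 * ∑' i : ℕ, r ^ i), ENNReal.mul_ne_top hC
    (ENNReal.mul_ne_top (wt_ne_top _ _) hG), fun f g => ?_⟩
  set b : ℤ → ℝ≥0∞ := fun k => ‖g‖ₑ * blk χ p k f + ‖f‖ₑ * blk χ p k g with hb
  have hwt : ∀ i : ℕ, wt σ (-(i : ℤ)) = r ^ i := fun i => by
    rw [hr, wt, ← ENNReal.ofReal_pow (by positivity), ← Real.rpow_natCast, ← Real.rpow_mul (by norm_num)]
    congr 2; push_cast; ring
  have hsum : ‖g‖ₑ * bes χ σ p f + ‖f‖ₑ * bes χ σ p g = ∑' k, wt σ k * b k := by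
    unfold bes
    rw [← ENNReal.tsum_mul_left, ← ENNReal.tsum_mul_left, ← ENNReal.tsum_add]
    congr 1; ext k; rw [hb]; ring
  rw [hsum]
  calc bes χ σ p (f * g) ≤ ∑' k, wt σ k * (C * ∑' i : ℕ, b (k - 2 + i)) := by
        unfold bes
        refine ENNReal.tsum_le_tsum fun k => ?_
        gcongr
        exact h f g k
    _ = C * ∑' (i : ℕ) (k : ℤ), wt σ k * b (k - 2 + i) := by
        rw [ENNReal.tsum_comm, ← ENNReal.tsum_mul_left]
        congr 1; ext k
        rw [ENNReal.tsum_mul_left]; ring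
    _ = C * ∑' i : ℕ, wt σ 2 * r ^ i * ∑' k, wt σ k * b k := by
        congr 2; ext i
        rw [← (Equiv.addRight (2 - (i : ℤ))).tsum_eq, ← ENNReal.tsum_mul_left]
        congr 1; ext k
        simp only [Equiv.coe_addRight]
        rw [show k + (2 - (i : ℤ)) - 2 + i = k by ring, show k + (2 - (i : ℤ)) = 2 + (-(i : ℤ) + k) by ring,
          wt_add, wt_add, hwt]
        ring
    _ = _ := by
        rw [ENNReal.tsum_mul_right, ENNReal.tsum_mul_left]; ring

/-! ### The embedding into bounded functions -/

/-- The low frequencies of `f` vanish. -/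
def LowVanish (χ : Cutoff d) (f : Cb d) : Prop := Tendsto (fun j : ℤ => ‖S χ j f‖) atBot (𝓝 0)

theorem LowVanish.sub {χ : Cutoff d} {f g : Cb d} (hf : LowVanish χ f) (hg : LowVanish χ g) :
    LowVanish χ (f - g) := by
  have := hf.add hg
  rw [add_zero] at this
  refine squeeze_zero (fun j => norm_nonneg _) (fun j => ?_) this
  rw [map_sub]; exact norm_sub_le _ _

theorem exists_enorm_op_freq_le {p : ℝ≥0∞} (hp1 : 1 ≤ p) (hp : p ≠ ∞) (m : 𝓢(Space d, ℂ)) :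
    ∃ C : ℝ≥0∞, C ≠ ∞ ∧ ∀ (j : ℤ) (f : Cb d),
      ‖op (freq j) m f‖ₑ ≤ C * wt (d / p.toReal) j * eLpNorm f p volume := by
  obtain ⟨C, hC, h⟩ := exists_enorm_op_le hp1 hp m
  have hp0 : 0 ≤ d / p.toReal := by positivity
  refine ⟨C, hC, fun j f => ?_⟩
  have hx : ∀ x, ‖op (freq j) m f x‖ₑ ≤ C * wt (d / p.toReal) j * eLpNorm f p volume := by
    intro x
    refine (h (freq j) (freq_pos j) f x).trans ?_
    gcongr
    unfold wt
    refine ENNReal.ofReal_le_ofReal ?_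
    unfold freq
    rw [Real.mul_rpow (by positivity) (by positivity), ← Real.rpow_intCast, ← Real.rpow_mul (by norm_num)]
    -- The scale is `2^{-j}` times `2π`; the factor `2π`, raised to a nonpositive power, is at most
    -- one and is dropped.
    have h1 : (2 * Real.pi) ^ (-(d / p.toReal)) ≤ 1 :=
      Real.rpow_le_one_of_one_le_of_nonpos (by nlinarith [Real.pi_gt_three]) (by linarith)
    calc _ ≤ (2 : ℝ) ^ (((-j : ℤ) : ℝ) * (-(d / p.toReal))) * 1 := by gcongr
      _ = _ := by rw [mul_one]; congr 1; push_cast; ring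
  by_cases htop : C * wt (d / p.toReal) j * eLpNorm f p volume = ∞
  · rw [htop]; exact le_top
  rw [← ofReal_norm, ← ENNReal.ofReal_toReal htop]
  refine ENNReal.ofReal_le_ofReal ((BoundedContinuousFunction.norm_le ENNReal.toReal_nonneg).2 fun x => ?_)
  have := ENNReal.toReal_mono htop (hx x)
  simpa using this

theorem exists_enorm_Dl_le {p : ℝ≥0∞} (hp1 : 1 ≤ p) (hp : p ≠ ∞) (χ : Cutoff d) :
    ∃ C : ℝ≥0∞, C ≠ ∞ ∧ ∀ (j : ℤ) (f : Cb d),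
      ‖Dl χ j f‖ₑ ≤ C * (wt (d / p.toReal) j * blk χ p j f) := by
  obtain ⟨C, hC, h⟩ := exists_enorm_op_freq_le hp1 hp (phiT χ)
  refine ⟨C, hC, fun j f => ?_⟩
  rw [← opT_Dl, ← mul_assoc]
  exact h j _

/-- The function is the pointwise limit of `S_n f`, which is `S_{-n} f` plus blocks that Bernstein's
inequality sums. The hypothesis on low frequencies removes `S_{-n} f`, and with it the constants
that the semi-norm cannot see. -/
theorem exists_enorm_le_bes {p : ℝ≥0∞} (hp1 : 1 ≤ p) (hp : p ≠ ∞) (χ : Cutoff d) :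
    ∃ C : ℝ≥0∞, C ≠ ∞ ∧ ∀ f : Cb d, LowVanish χ f → ‖f‖ₑ ≤ C * bes χ (d / p.toReal) p f := by
  obtain ⟨C, hC, h⟩ := exists_enorm_Dl_le hp1 hp χ
  refine ⟨C, hC, fun f hf => ?_⟩
  set B := C * bes χ (d / p.toReal) p f with hB
  have hx : ∀ x, ‖f x‖ₑ ≤ B := by
    intro x
    have h1 : ∀ n : ℕ, ‖S χ n f x‖ₑ ≤ ‖S χ (-(n : ℤ)) f‖ₑ + B := by
      intro n
      have h2 := S_eq_add_sum χ (-(n : ℤ)) (2 * n)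
      rw [show (-(n : ℤ) + ((2 * n : ℕ) : ℤ)) = n by push_cast; ring] at h2
      have h3 : ‖S χ n f x‖ₑ ≤ ‖S χ n f‖ₑ := by
        rw [← ofReal_norm, ← ofReal_norm]
        exact ENNReal.ofReal_le_ofReal (BoundedContinuousFunction.norm_coe_le_norm _ x)
      refine h3.trans ?_
      rw [h2, add_apply, sum_apply]
      refine (enorm_add_le _ _).trans ?_
      gcongr
      refine (enorm_sum_le _ _).trans ?_
      calc ∑ i ∈ Finset.range (2 * n), ‖Dl χ (-(n : ℤ) + i) f‖ₑ
          ≤ ∑' i : ℕ, ‖Dl χ (-(n : ℤ) + i) f‖ₑ := ENNReal.sum_le_tsum _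
        _ ≤ ∑' j : ℤ, ‖Dl χ j f‖ₑ :=
            ENNReal.tsum_comp_le_tsum_of_injective (f := fun i : ℕ => -(n : ℤ) + i)
              (fun a b hab => by simpa using hab) (fun j => ‖Dl χ j f‖ₑ)
        _ ≤ B := by
            rw [hB, bes, ← ENNReal.tsum_mul_left]
            exact ENNReal.tsum_le_tsum fun j => h j f
    have h4 : Tendsto (fun n : ℕ => ‖S χ n f x‖ₑ) atTop (𝓝 ‖f x‖ₑ) :=
      (continuous_enorm.tendsto _).comp ((tendsto_S_apply χ f x).comp tendsto_natCast_atTop_atTop)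
    have h5 : Tendsto (fun n : ℕ => ‖S χ (-(n : ℤ)) f‖ₑ + B) atTop (𝓝 (0 + B)) := by
      refine Tendsto.add ?_ tendsto_const_nhds
      have h6 : Tendsto (fun n : ℕ => ‖S χ (-(n : ℤ)) f‖) atTop (𝓝 0) :=
        hf.comp (tendsto_neg_atTop_atBot.comp tendsto_natCast_atTop_atTop)
      have h7 := (ENNReal.continuous_ofReal.tendsto 0).comp h6
      simpa [Function.comp_def] using h7
    rw [zero_add] at h5
    exact le_of_tendsto_of_tendsto' h4 h5 h1
  by_cases htop : B = ∞
  · rw [htop]; exact le_top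
  rw [← ofReal_norm, ← ENNReal.ofReal_toReal htop]
  refine ENNReal.ofReal_le_ofReal ((BoundedContinuousFunction.norm_le ENNReal.toReal_nonneg).2 fun x => ?_)
  have := ENNReal.toReal_mono htop (hx x)
  simpa using this

/-! ### Power series of bounded functions -/

section PowerSeries

variable {p : ℝ≥0∞} {χ : Cutoff d} {σ : ℝ} {L M : ℝ≥0∞}

theorem enorm_mul_Cb_le (f g : Cb d) : ‖f * g‖ₑ ≤ ‖f‖ₑ * ‖g‖ₑ := by
  simp only [← ofReal_norm]
  rw [← ENNReal.ofReal_mul (norm_nonneg _)]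
  exact ENNReal.ofReal_le_ofReal (norm_mul_le _ _)

theorem enorm_pow_succ_le {u : Cb d} (hu : ‖u‖ₑ ≤ M) (k : ℕ) : ‖u ^ (k + 1)‖ₑ ≤ M ^ (k + 1) := by
  induction k with
  | zero => simpa using hu
  | succ k ih =>
    rw [pow_succ, pow_succ M]
    exact (enorm_mul_Cb_le _ _).trans (by gcongr)

/-- The true factor `k + 1` is replaced by `L ^ k`, which survives the induction uniformly and is
harmless once `M` is small. -/
theorem enorm_pow_sub_pow_le (hL : 2 ≤ L) {u v : Cb d} (hu : ‖u‖ₑ ≤ M) (hv : ‖v‖ₑ ≤ M) (k : ℕ) :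
    ‖u ^ (k + 1) - v ^ (k + 1)‖ₑ ≤ L ^ k * M ^ k * ‖u - v‖ₑ := by
  induction k with
  | zero => simp
  | succ k ih =>
    have h : u ^ (k + 1 + 1) - v ^ (k + 1 + 1) =
        (u ^ (k + 1) - v ^ (k + 1)) * u + (u - v) * v ^ (k + 1) := by ring
    have h1 : 1 ≤ L := le_trans (by norm_num) hL
    rw [h]
    calc _ ≤ L ^ k * M ^ k * ‖u - v‖ₑ * M + ‖u - v‖ₑ * M ^ (k + 1) := by
          refine (enorm_add_le _ _).trans (add_le_add ?_ ?_)
          · exact (enorm_mul_Cb_le _ _).trans (by gcongr)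
          · refine (enorm_mul_Cb_le _ _).trans ?_
            gcongr
            exact enorm_pow_succ_le hv k
      _ ≤ L ^ k * M ^ k * ‖u - v‖ₑ * M + L ^ k * (‖u - v‖ₑ * M ^ (k + 1)) := by
          exact add_le_add le_rfl (le_mul_of_one_le_left (by simp) (one_le_pow₀ h1))
      _ = 2 * (L ^ k * M ^ (k + 1) * ‖u - v‖ₑ) := by ring
      _ ≤ L * (L ^ k * M ^ (k + 1) * ‖u - v‖ₑ) := by gcongr
      _ = _ := by ring

theorem bes_pow_succ_le {C : ℝ≥0∞} (hC : ∀ f g : Cb d,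
      bes χ σ p (f * g) ≤ C * (‖g‖ₑ * bes χ σ p f + ‖f‖ₑ * bes χ σ p g)) (hL1 : 1 ≤ L)
    (hL : 2 * C ≤ L) {u : Cb d} (hu : ‖u‖ₑ ≤ M) (k : ℕ) :
    bes χ σ p (u ^ (k + 1)) ≤ L ^ k * M ^ k * bes χ σ p u := by
  induction k with
  | zero => simp
  | succ k ih =>
    rw [pow_succ]
    calc _ ≤ C * (M * (L ^ k * M ^ k * bes χ σ p u) + M ^ (k + 1) * bes χ σ p u) := by
          refine (hC _ _).trans ?_
          gcongr
          exact enorm_pow_succ_le hu k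
      _ ≤ C * (M * (L ^ k * M ^ k * bes χ σ p u) + L ^ k * (M ^ (k + 1) * bes χ σ p u)) := by
          refine mul_le_mul_right (add_le_add le_rfl ?_) _
          exact le_mul_of_one_le_left (by simp) (one_le_pow₀ hL1)
      _ = 2 * C * (L ^ k * M ^ (k + 1) * bes χ σ p u) := by ring
      _ ≤ L * (L ^ k * M ^ (k + 1) * bes χ σ p u) := by gcongr
      _ = _ := by ring

theorem bes_pow_sub_pow_le (hp1 : 1 ≤ p) {C : ℝ≥0∞} (hC : ∀ f g : Cb d,
      bes χ σ p (f * g) ≤ C * (‖g‖ₑ * bes χ σ p f + ‖f‖ₑ * bes χ σ p g)) (hL1 : 2 ≤ L)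
    (hL : 2 * C ≤ L) {u v : Cb d} (hu : ‖u‖ₑ ≤ M) (hv : ‖v‖ₑ ≤ M) (k : ℕ) :
    bes χ σ p (u ^ (k + 2) - v ^ (k + 2)) ≤
      L ^ (k + 1) * M ^ k * (M * bes χ σ p (u - v) + ‖u - v‖ₑ * (bes χ σ p u + bes χ σ p v)) := by
  have h1 : 1 ≤ L := le_trans (by norm_num) hL1
  -- The inductive step, with the previous bound multiplied by `M`. In this form the exponent one
  -- can serve as a start, although its bound lacks the gain, and nothing is ever divided by `M`.
  have key : ∀ n, bes χ σ p (u ^ (n + 1) - v ^ (n + 1)) * M ≤ L ^ n * M ^ n *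
        (M * bes χ σ p (u - v) + ‖u - v‖ₑ * (bes χ σ p u + bes χ σ p v)) →
      bes χ σ p (u ^ (n + 2) - v ^ (n + 2)) ≤ L ^ (n + 1) * M ^ n *
        (M * bes χ σ p (u - v) + ‖u - v‖ₑ * (bes χ σ p u + bes χ σ p v)) := by
    intro n ih
    have h : u ^ (n + 2) - v ^ (n + 2) =
        (u ^ (n + 1) - v ^ (n + 1)) * u + (u - v) * v ^ (n + 1) := by ring
    rw [h]
    calc _ ≤ C * (M * bes χ σ p (u ^ (n + 1) - v ^ (n + 1)) +
            L ^ n * M ^ n * ‖u - v‖ₑ * bes χ σ p u) +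
          C * (M ^ (n + 1) * bes χ σ p (u - v) + ‖u - v‖ₑ * (L ^ n * M ^ n * bes χ σ p v)) := by
          refine (bes_add_le hp1 _ _ _ _).trans (add_le_add ((hC _ _).trans ?_) ((hC _ _).trans ?_))
          · gcongr
            exact enorm_pow_sub_pow_le hL1 hu hv n
          · gcongr
            · exact enorm_pow_succ_le hv n
            · exact bes_pow_succ_le hC h1 hL hv n
      _ ≤ C * (L ^ n * M ^ n *
        (M * bes χ σ p (u - v) + ‖u - v‖ₑ * (bes χ σ p u + bes χ σ p v)) +
            L ^ n * M ^ n * ‖u - v‖ₑ * bes χ σ p u) +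
          C * (L ^ n * (M ^ (n + 1) * bes χ σ p (u - v)) +
            ‖u - v‖ₑ * (L ^ n * M ^ n * bes χ σ p v)) := by
          refine add_le_add (mul_le_mul_right (add_le_add ?_ le_rfl) _)
            (mul_le_mul_right (add_le_add ?_ le_rfl) _)
          · rw [mul_comm]; exact ih
          · exact le_mul_of_one_le_left (by simp) (one_le_pow₀ h1)
      _ = 2 * C * (L ^ n * M ^ n *
        (M * bes χ σ p (u - v) + ‖u - v‖ₑ * (bes χ σ p u + bes χ σ p v))) := by ring
      _ ≤ L * (L ^ n * M ^ n *
        (M * bes χ σ p (u - v) + ‖u - v‖ₑ * (bes χ σ p u + bes χ σ p v))) := by gcongr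
      _ = _ := by ring
  induction k with
  | zero =>
    refine key 0 ?_
    simp only [zero_add, pow_one, pow_zero, one_mul]
    rw [mul_comm]
    exact le_self_add
  | succ k ih =>
    refine key (k + 1) ?_
    calc _ ≤ (L ^ (k + 1) * M ^ k *
        (M * bes χ σ p (u - v) + ‖u - v‖ₑ * (bes χ σ p u + bes χ σ p v))) * M := by gcongr
      _ = _ := by ring

/-- The power series `∑ c_k u^{k+2}`. -/
def ser (c : ℕ → ℝ) (u : Cb d) : Cb d := ∑' k, (c k : ℂ) • u ^ (k + 2)

theorem ser_zero (c : ℕ → ℝ) : ser c (0 : Cb d) = 0 := by simp [ser]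

theorem hasSum_ser {c : ℕ → ℝ} {K R : ℝ} (hR : 0 < R) (hc : ∀ k, |c k| ≤ K * R ^ k) {u : Cb d}
    (hu : ‖u‖ < R⁻¹) : HasSum (fun k => (c k : ℂ) • u ^ (k + 2)) (ser c u) := by
  refine Summable.hasSum ?_
  have hr : R * ‖u‖ < 1 := by
    have := mul_lt_mul_of_pos_left hu hR
    rwa [mul_inv_cancel₀ hR.ne'] at this
  have hs : Summable fun k : ℕ => (K * ‖u‖ ^ 2) * (R * ‖u‖) ^ k :=
    (summable_geometric_of_lt_one (by positivity) hr).mul_left _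
  refine Summable.of_norm_bounded hs fun k => ?_
  rw [norm_smul, Complex.norm_real, Real.norm_eq_abs]
  calc _ ≤ (K * R ^ k) * ‖u‖ ^ (k + 2) := by
        have h1 : ‖u ^ (k + 2)‖ ≤ ‖u‖ ^ (k + 2) := norm_pow_le' _ (by omega)
        have h2 := hc k
        exact mul_le_mul h2 h1 (norm_nonneg _) ((abs_nonneg _).trans h2)
    _ = _ := by ring

/-- Because the series starts at degree two, a factor `M` (or the Besov size of `u` and `v`)
multiplies every difference. The constant does not depend on the radius `M`, so shrinking the ball
later produces a contraction. -/
theorem exists_ser_bounds (hp1 : 1 ≤ p) (hp : p ≠ ∞) (χ : Cutoff d) (hσ : 0 < σ)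
    {c : ℕ → ℝ} {K R : ℝ} (hR : 0 < R) (hc : ∀ k, |c k| ≤ K * R ^ k) :
    ∃ (M₀ : ℝ) (C : ℝ≥0∞), 0 < M₀ ∧ M₀ < R⁻¹ ∧ C ≠ ∞ ∧
      ∀ M ≤ ENNReal.ofReal M₀, ∀ u v : Cb d, ‖u‖ₑ ≤ M → ‖v‖ₑ ≤ M →
        ‖ser c u - ser c v‖ₑ ≤ C * (M * ‖u - v‖ₑ) ∧
        bes χ σ p (ser c u - ser c v) ≤
          C * (M * bes χ σ p (u - v) + ‖u - v‖ₑ * (bes χ σ p u + bes χ σ p v)) := by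
  obtain ⟨C, hCt, hC⟩ := bes_mul_le (d := d) hp1 hp χ hσ
  have hK : 0 ≤ K := by simpa using (abs_nonneg _).trans (hc 0)
  set L : ℝ≥0∞ := 2 * C + 2 with hLdef
  have hLt : L ≠ ∞ := by simp [hLdef, ENNReal.mul_eq_top, hCt]
  have hL2 : 2 ≤ L := le_add_self
  have hLC : 2 * C ≤ L := le_self_add
  set l := L.toReal with hl
  have hLl : L = ENNReal.ofReal l := (ENNReal.ofReal_toReal hLt).symm
  have hl2 : 2 ≤ l := by simpa using ENNReal.toReal_mono hLt hL2
  have hM0 : 0 < (2 * R * l)⁻¹ := by positivity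
  -- At this radius the series of bounds has ratio `R * L * M ≤ 1/2`, hence sum at most two, which
  -- is the factor two of the constant.
  refine ⟨(2 * R * l)⁻¹, 2 * (ENNReal.ofReal K * L), hM0, ?_, ?_, fun M hM u v hu hv => ?_⟩
  · rw [mul_inv, mul_inv]
    have : 2⁻¹ * R⁻¹ * l⁻¹ ≤ 2⁻¹ * R⁻¹ * 1 := by
      gcongr
      exact inv_le_one_of_one_le₀ (by linarith)
    have h0 : 0 < R⁻¹ := by positivity
    linarith
  · exact ENNReal.mul_ne_top (by norm_num) (ENNReal.mul_ne_top ENNReal.ofReal_ne_top hLt)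
  have hnorm : ∀ {w : Cb d}, ‖w‖ₑ ≤ M → ‖w‖ < R⁻¹ := fun {w} hw => by
    have h1 : ‖w‖ ≤ (2 * R * l)⁻¹ := by
      have := hw.trans hM
      rw [← ofReal_norm] at this
      exact (ENNReal.ofReal_le_ofReal_iff hM0.le).1 this
    refine h1.trans_lt ((inv_lt_inv₀ (by positivity) hR).2 ?_)
    nlinarith
  have hRLM : ENNReal.ofReal R * L * M ≤ 2⁻¹ := by
    calc _ ≤ ENNReal.ofReal R * ENNReal.ofReal l * ENNReal.ofReal (2 * R * l)⁻¹ := by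
          rw [← hLl]; gcongr
      _ = ENNReal.ofReal (2⁻¹) := by
          rw [← ENNReal.ofReal_mul hR.le, ← ENNReal.ofReal_mul (by positivity)]
          congr 1; field_simp
      _ = _ := by rw [ENNReal.ofReal_inv_of_pos (by norm_num)]; simp
  have hgeo : ∑' k : ℕ, (ENNReal.ofReal R * L * M) ^ k ≤ 2 := by
    rw [ENNReal.tsum_geometric]
    rw [ENNReal.inv_le_iff_inv_le]
    have h3 : (1 : ℝ≥0∞) - 2⁻¹ = 2⁻¹ := ENNReal.one_sub_inv_two
    rw [← h3]
    exact tsub_le_tsub_left hRLM 1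
  have hcoef : ∀ k, ‖(c k : ℂ)‖ₑ ≤ ENNReal.ofReal K * ENNReal.ofReal R ^ k := fun k => by
    rw [← ofReal_norm, Complex.norm_real, Real.norm_eq_abs, ← ENNReal.ofReal_pow hR.le,
      ← ENNReal.ofReal_mul hK]
    exact ENNReal.ofReal_le_ofReal (hc k)
  have hsum : HasSum (fun k => (c k : ℂ) • (u ^ (k + 2) - v ^ (k + 2))) (ser c u - ser c v) := by
    simp only [smul_sub]
    exact (hasSum_ser hR hc (hnorm hu)).sub (hasSum_ser hR hc (hnorm hv))
  constructor
  · calc ‖ser c u - ser c v‖ₑ ≤ ∑' k, ‖(c k : ℂ) • (u ^ (k + 2) - v ^ (k + 2))‖ₑ := by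
          rw [← hsum.tsum_eq]; exact enorm_tsum_le_tsum_enorm
      _ ≤ ∑' k, (ENNReal.ofReal R * L * M) ^ k * (ENNReal.ofReal K * L * (M * ‖u - v‖ₑ)) := by
          refine ENNReal.tsum_le_tsum fun k => ?_
          rw [enorm_smul]
          calc _ ≤ (ENNReal.ofReal K * ENNReal.ofReal R ^ k) *
                (L ^ (k + 1) * M ^ (k + 1) * ‖u - v‖ₑ) := by
                gcongr
                · exact hcoef k
                · exact enorm_pow_sub_pow_le hL2 hu hv (k + 1)
            _ = _ := by ring_nf
      _ ≤ 2 * (ENNReal.ofReal K * L * (M * ‖u - v‖ₑ)) := by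
          rw [ENNReal.tsum_mul_right]; gcongr
      _ = _ := by ring
  · set B := M * bes χ σ p (u - v) + ‖u - v‖ₑ * (bes χ σ p u + bes χ σ p v) with hB
    calc bes χ σ p (ser c u - ser c v)
        ≤ ∑' k, bes χ σ p ((c k : ℂ) • (u ^ (k + 2) - v ^ (k + 2))) := bes_hasSum_le hp1 χ σ hsum
      _ ≤ ∑' k, (ENNReal.ofReal R * L * M) ^ k * (ENNReal.ofReal K * L * B) := by
          refine ENNReal.tsum_le_tsum fun k => ?_
          rw [bes_smul]
          calc _ ≤ (ENNReal.ofReal K * ENNReal.ofReal R ^ k) * (L ^ (k + 1) * M ^ k * B) := by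
                gcongr
                · exact hcoef k
                · exact bes_pow_sub_pow_le hp1 hC hL2 hLC hu hv k
            _ = _ := by ring_nf
      _ ≤ 2 * (ENNReal.ofReal K * L * B) := by
          rw [ENNReal.tsum_mul_right]; gcongr
      _ = _ := by ring

end PowerSeries

/-! ### The pressure law near a positive constant -/

/-- Taylor coefficients, from the second one on, of the pressure law at `Nbar`. -/
def presCoeff (A γ Nbar : ℝ) (k : ℕ) : ℝ :=
  A * Nbar ^ γ * (Ring.choose γ (k + 2) / Nbar ^ (k + 2))

/-- Newton's binomial series in `x / Nbar`, with the terms of degree zero and one removed. The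
linear coefficient becomes the diffusivity. -/
theorem hasSum_pressure {A γ Nbar : ℝ} (hN : 0 < Nbar) {x : ℝ} (hx : |x| < Nbar) :
    HasSum (fun k => presCoeff A γ Nbar k * x ^ (k + 2))
      (pressure A γ (Nbar + x) - pressure A γ Nbar - A * γ * Nbar ^ (γ - 1) * x) := by
  have h := (Real.one_add_rpow_hasFPowerSeriesOnBall_zero (a := γ)).hasSum (y := x / Nbar) (by
    rw [← ENNReal.ofReal_one, Metric.eball_ofReal, mem_ball_zero_iff, Real.norm_eq_abs, abs_div,
      abs_of_pos hN, div_lt_one hN]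
    exact hx)
  simp only [binomialSeries_apply, List.ofFn_const, List.prod_replicate, zero_add, smul_eq_mul] at h
  have h2 := (hasSum_nat_add_iff' 2).2 h
  have h3 := h2.mul_left (A * Nbar ^ γ)
  convert! h3 using 1
  · ext k
    rw [presCoeff, div_pow]; ring
  · have h4 : 0 ≤ 1 + x / Nbar := by
      rw [abs_lt] at hx
      have := (div_lt_one hN).2 (by linarith : -x < Nbar)
      rw [neg_div] at this; linarith
    have h5 : (Nbar + x) ^ γ = Nbar ^ γ * (1 + x / Nbar) ^ γ := by
      rw [← Real.mul_rpow hN.le h4]; congr 1; field_simp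
    rw [pressure, pressure, h5, Real.rpow_sub_one hN.ne']
    simp [Finset.sum_range_succ]
    field_simp
    ring

/-- The binomial series has radius at least one; Cauchy's bound at radius `1/2` gives the growth
`2^k`. -/
theorem exists_presCoeff_bound {A γ Nbar : ℝ} (hN : 0 < Nbar) :
    ∃ K : ℝ, ∀ k, |presCoeff A γ Nbar k| ≤ K * (2 / Nbar) ^ k := by
  have hr : ((1 / 2 : NNReal) : ℝ≥0∞) < (binomialSeries ℝ γ).radius := by
    refine lt_of_lt_of_le ?_ (binomialSeries_radius_ge_one (𝔸 := ℝ))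
    exact_mod_cast NNReal.half_lt_self one_ne_zero
  obtain ⟨C, hC0, hC⟩ := (binomialSeries ℝ γ).norm_mul_pow_le_of_lt_radius hr
  refine ⟨|A * Nbar ^ γ| * (4 * C / Nbar ^ 2), fun k => ?_⟩
  have h1 := hC (k + 2)
  rw [binomialSeries, FormalMultilinearSeries.ofScalars_norm] at h1
  rw [presCoeff, abs_mul, mul_assoc]
  gcongr
  rw [abs_div, abs_of_pos (pow_pos hN _), div_pow, div_mul_div_comm, ← pow_add, add_comm 2 k]
  gcongr
  have h2 : ((1 / 2 : NNReal) : ℝ) ^ (k + 2) = (2 ^ (k + 2))⁻¹ := by push_cast; rw [div_pow]; simp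
  rw [h2, ← div_eq_mul_inv, div_le_iff₀ (by positivity), Real.norm_eq_abs] at h1
  calc _ ≤ _ := h1
    _ = _ := by ring

/-! ### The Gaussian as a Schwartz function -/

theorem hasTemperateGrowth_fderiv {E G : Type*} [NormedAddCommGroup E] [NormedSpace ℝ E]
    [NormedAddCommGroup G] [NormedSpace ℝ G] {q : E → G} (hq : q.HasTemperateGrowth) :
    (fderiv ℝ q).HasTemperateGrowth := by
  refine ⟨hq.1.fderiv_right (m := (⊤ : ℕ∞)) (by simp), fun n => ?_⟩
  obtain ⟨k, C, h⟩ := hq.2 (n + 1)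
  exact ⟨k, C, fun x => by rw [norm_iteratedFDeriv_fderiv]; exact h x⟩

theorem one_add_pow_mul_exp_le (N : ℕ) {r : ℝ} (hr : 0 ≤ r) :
    (1 + r) ^ N * Real.exp (-r ^ 2) ≤ N.factorial * Real.exp 2 := by
  have h1 : (1 + r) ^ N ≤ N.factorial * Real.exp (1 + r) := by
    have := Real.pow_div_factorial_le_exp (1 + r) (by linarith) N
    rwa [div_le_iff₀ (by positivity), mul_comm] at this
  calc _ ≤ N.factorial * Real.exp (1 + r) * Real.exp (-r ^ 2) := by gcongr
    _ = N.factorial * Real.exp (1 + r + -r ^ 2) := by rw [mul_assoc, ← Real.exp_add]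
    _ ≤ _ := by
      gcongr
      nlinarith [sq_nonneg (r - 1 / 2)]

/-- The derivative of `exp(-‖x‖²) q` is `exp(-‖x‖²)` times another function of temperate growth,
with values in linear maps. The induction therefore runs over all target spaces and all such `q` at
once. -/
theorem gauss_smul_decay (n : ℕ) : ∀ (G : Type) [NormedAddCommGroup G] [NormedSpace ℝ G]
    (q : Space d → G), q.HasTemperateGrowth → ∀ k : ℕ, ∃ C : ℝ, ∀ x,
      ‖x‖ ^ k * ‖iteratedFDeriv ℝ n (fun x => Real.exp (-‖x‖ ^ 2) • q x) x‖ ≤ C := by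
  induction n with
  | zero =>
    intro G _ _ q hq k
    obtain ⟨m, C, hC⟩ := hq.2 0
    have hC0 : 0 ≤ C := by simpa using (norm_nonneg _).trans (hC 0)
    refine ⟨C * ((k + m).factorial * Real.exp 2), fun x => ?_⟩
    have h1 := hC x
    rw [norm_iteratedFDeriv_zero] at h1 ⊢
    rw [norm_smul, Real.norm_of_nonneg (Real.exp_pos _).le]
    calc ‖x‖ ^ k * (Real.exp (-‖x‖ ^ 2) * ‖q x‖)
        ≤ (1 + ‖x‖) ^ k * (Real.exp (-‖x‖ ^ 2) * (C * (1 + ‖x‖) ^ m)) := by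
          gcongr
          linarith
      _ = C * ((1 + ‖x‖) ^ (k + m) * Real.exp (-‖x‖ ^ 2)) := by ring
      _ ≤ _ := mul_le_mul_of_nonneg_left (one_add_pow_mul_exp_le _ (norm_nonneg x)) hC0
  | succ n ih =>
    intro G _ _ q hq k
    have hN : (fun x : Space d => ‖x‖ ^ 2).HasTemperateGrowth := (Function.hasTemperateGrowth_norm_sq _)
    have hN' := hasTemperateGrowth_fderiv hN
    have hq' := hasTemperateGrowth_fderiv hq
    have hprod : (fun x : Space d =>
        (fderiv ℝ (fun x : Space d => ‖x‖ ^ 2) x).smulRight (q x)).HasTemperateGrowth :=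
      ContinuousLinearMap.bilinear_hasTemperateGrowth
        (ContinuousLinearMap.smulRightL ℝ (Space d) G) hN' hq
    obtain ⟨C, hC⟩ := ih _ _ (hq'.sub hprod) k
    refine ⟨C, fun x => ?_⟩
    rw [← norm_iteratedFDeriv_fderiv]
    have hd : fderiv ℝ (fun x => Real.exp (-‖x‖ ^ 2) • q x) = fun x => Real.exp (-‖x‖ ^ 2) •
        (fderiv ℝ q - fun x : Space d =>
          (fderiv ℝ (fun x : Space d => ‖x‖ ^ 2) x).smulRight (q x)) x := by
      ext1 x
      have h1 : HasFDerivAt (fun x : Space d => ‖x‖ ^ 2) (fderiv ℝ (fun x : Space d => ‖x‖ ^ 2) x) x :=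
        (hN.1.differentiable (by simp)).differentiableAt.hasFDerivAt
      have h2 : HasFDerivAt q (fderiv ℝ q x) x :=
        (hq.1.differentiable (by simp)).differentiableAt.hasFDerivAt
      have h3 := (h1.neg.exp).smul h2
      refine h3.fderiv.trans ?_
      ext v
      simp [mul_smul, sub_eq_add_neg]
    rw [hd]
    exact hC x

/-- The Gaussian `e^{-‖ξ‖²}`. -/
def gauss : 𝓢(Space d, ℂ) where
  toFun ξ := Real.exp (-‖ξ‖ ^ 2) • (1 : ℂ)
  smooth' := by
    have : ContDiff ℝ (⊤ : ℕ∞) fun ξ : Space d => -‖ξ‖ ^ 2 := (contDiff_norm_sq ℝ).neg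
    exact this.exp.smul contDiff_const
  decay' k n := gauss_smul_decay n ℂ _ (Function.HasTemperateGrowth.const 1) k

theorem gauss_apply (ξ : Space d) : gauss ξ = Complex.exp (-((‖ξ‖ ^ 2 : ℝ) : ℂ)) := by
  change Real.exp (-‖ξ‖ ^ 2) • (1 : ℂ) = _
  simp

theorem hasTemperateGrowth_sq : (fun ξ : Space d => ((‖ξ‖ ^ 2 : ℝ) : ℂ)).HasTemperateGrowth :=
  Function.Complex.hasTemperateGrowth_ofReal.comp (Function.hasTemperateGrowth_norm_sq _)

/-- The symbol `-‖ξ‖² m(ξ)`. -/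
def lap (m : 𝓢(Space d, ℂ)) : 𝓢(Space d, ℂ) :=
  SchwartzMap.smulLeftCLM ℂ (-fun ξ : Space d => ((‖ξ‖ ^ 2 : ℝ) : ℂ)) m

theorem lap_apply (m : 𝓢(Space d, ℂ)) (ξ : Space d) : lap m ξ = -((‖ξ‖ ^ 2 : ℝ) : ℂ) * m ξ := by
  rw [lap, SchwartzMap.smulLeftCLM_apply_apply hasTemperateGrowth_sq.neg]
  rfl

/-- The second Taylor remainder of the exponential divided by `z²`. -/
def expRem : ℂ → ℂ := dslope (dslope Complex.exp 0) 0

theorem differentiable_dslope {f : ℂ → ℂ} (hf : Differentiable ℂ f) :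
    Differentiable ℂ (dslope f 0) := by
  rw [← differentiableOn_univ] at hf ⊢
  exact (Complex.differentiableOn_dslope univ_mem).2 hf

theorem contDiff_expRem : ContDiff ℝ (⊤ : ℕ∞) expRem :=
  ((differentiable_dslope (differentiable_dslope Complex.differentiable_exp)).contDiff).restrict_scalars ℝ

theorem exp_eq_expRem (z : ℂ) : Complex.exp z = 1 + z + z ^ 2 * expRem z := by
  have h1 : Complex.exp z = 1 + z * dslope Complex.exp 0 z := by
    have := sub_smul_dslope Complex.exp 0 z
    simp only [sub_zero, smul_eq_mul, Complex.exp_zero] at this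
    rw [this]; ring
  have h2 : dslope Complex.exp 0 z = 1 + z * expRem z := by
    have := sub_smul_dslope (dslope Complex.exp 0) 0 z
    simp only [sub_zero, smul_eq_mul, dslope_same, Complex.deriv_exp, Complex.exp_zero] at this
    rw [expRem, this]; ring
  rw [h1, h2]; ring

/-- The localized remainder symbol. -/
def remSymbol (χ : Cutoff d) : 𝓢(Space d, ℂ) :=
  HasCompactSupport.toSchwartzMap
    (f := fun ξ => chiD χ 2 ξ * expRem (-((‖ξ‖ ^ 2 : ℝ) : ℂ)))
    (((χ.hasCompactSupport.comp_smul (by positivity)).comp_left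
      (g := fun r : ℝ => (r : ℂ)) Complex.ofReal_zero).mul_right)
    ((chiD χ 2).smooth _ |>.mul (contDiff_expRem.comp hasTemperateGrowth_sq.1.neg))

theorem remSymbol_apply (χ : Cutoff d) (ξ : Space d) :
    remSymbol χ ξ = chiD χ 2 ξ * expRem (-((‖ξ‖ ^ 2 : ℝ) : ℂ)) := rfl

/-- The symbol of the block cut-off divided by `‖ξ‖⁴`. -/
def invSymbol (χ : Cutoff d) : 𝓢(Space d, ℂ) :=
  HasCompactSupport.toSchwartzMap (f := fun ξ => phiT χ ξ * (((‖ξ‖ ^ 2 : ℝ) : ℂ) ^ 2)⁻¹)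
    (by
      refine HasCompactSupport.mul_right (HasCompactSupport.intro
        (isCompact_closedBall (0 : Space d) (16 / 3)) fun x hx => phiT_eq_zero χ (Or.inr ?_))
      simp only [mem_closedBall_zero_iff, not_le] at hx
      exact hx.le)
    (by
      rw [contDiff_iff_contDiffAt]
      intro ξ
      by_cases h : ‖ξ‖ < 3 / 8
      · refine (contDiffAt_const (c := (0 : ℂ))).congr_of_eventuallyEq ?_
        filter_upwards [(isOpen_lt continuous_norm continuous_const).mem_nhds h] with y hy
        rw [phiT_eq_zero χ (Or.inl (le_of_lt hy)), zero_mul]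
      · refine ((phiT χ).smooth (⊤ : ℕ∞)).contDiffAt.mul
          (ContDiffAt.inv (hasTemperateGrowth_sq.1.pow 2).contDiffAt ?_)
        have h0 : ‖ξ‖ ≠ 0 := by intro h0; rw [h0] at h; norm_num at h
        exact pow_ne_zero _ (Complex.ofReal_ne_zero.2 (pow_ne_zero _ h0)))

theorem invSymbol_apply (χ : Cutoff d) (ξ : Space d) :
    invSymbol χ ξ = phiT χ ξ * (((‖ξ‖ ^ 2 : ℝ) : ℂ) ^ 2)⁻¹ := rfl

theorem invSymbol_mul (χ : Cutoff d) (ξ : Space d) :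
    ((‖ξ‖ ^ 2 : ℝ) : ℂ) ^ 2 * invSymbol χ ξ = phiT χ ξ := by
  rw [invSymbol_apply]
  by_cases h : ξ = 0
  · rw [h, phiT_eq_zero χ (Or.inl (by norm_num))]; simp
  · have h0 : ((‖ξ‖ ^ 2 : ℝ) : ℂ) ≠ 0 :=
      Complex.ofReal_ne_zero.2 (pow_ne_zero _ (norm_ne_zero_iff.2 h))
    field_simp

/-! ### The heat semigroup -/

/-- The heat semigroup at scale `c`. -/
def heat (c s : ℝ) : Cb d →L[ℂ] Cb d := op (c * √s) gauss

/-- The heat operator at time zero is a convolution at scale zero, where the multiplier calculus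
does not apply; this computes it directly. -/
theorem op_zero_apply (m : 𝓢(Space d, ℂ)) (f : Cb d) : op 0 m f = m 0 • f := by
  ext x
  have h := tendsto_op_apply m f x
  have h2 : Tendsto (fun c : ℝ => op c m f x) (𝓝 0) (𝓝 (op 0 m f x)) := by
    have hcont : ContinuousAt (fun c : ℝ => op c m f x) 0 := by
      simp only [op_apply]
      refine continuousAt_of_dominated (bound := fun y => ‖(𝓕⁻ m) y‖ * ‖f‖)
        (Eventually.of_forall fun c => (integrable_kernel_mul c m f x).aestronglyMeasurable)
        (Eventually.of_forall fun c => Eventually.of_forall fun y => ?_)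
        ((𝓕⁻ m).integrable.norm.mul_const _) (Eventually.of_forall fun y => ?_)
      · rw [norm_mul]; gcongr; exact f.norm_coe_le_norm _
      · have hc : Continuous fun c : ℝ => (𝓕⁻ m) y * f (x - c • y) := by fun_prop
        exact hc.continuousAt
    exact hcont
  exact tendsto_nhds_unique h2 h

theorem isMult_heat {c : ℝ} (hc : c ≠ 0) {s : ℝ} (hs : 0 ≤ s) :
    IsMult (heat (d := d) c s) fun η => Complex.exp (-((s * ‖c • η‖ ^ 2 : ℝ) : ℂ)) := by
  rcases hs.eq_or_lt with rfl | hs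
  · have h : heat (d := d) c 0 = 1 := by
      ext1 f
      rw [heat, Real.sqrt_zero, mul_zero, op_zero_apply, gauss_apply]
      simp
    rw [h]
    simpa using IsMult.one
  · convert! isMult_op (mul_ne_zero hc (Real.sqrt_pos.2 hs).ne') gauss using 2
    rw [gauss_apply, mul_smul, norm_smul c, norm_smul c, norm_smul, mul_pow, mul_pow, mul_pow,
      Real.norm_eq_abs (√s), sq_abs, Real.sq_sqrt hs.le]
    congr 3; ring

theorem heat_add {c : ℝ} (hc : c ≠ 0) {s t : ℝ} (hs : 0 ≤ s) (ht : 0 ≤ t) :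
    heat (d := d) c (s + t) = heat c s * heat c t := by
  refine (isMult_heat hc (add_nonneg hs ht)).eq ((isMult_heat hc hs).mul (isMult_heat hc ht))
    fun η => ?_
  rw [← Complex.exp_add]
  congr 1; push_cast; ring

theorem heat_zero (c : ℝ) : heat (d := d) c 0 = 1 := by
  ext1 f
  rw [heat, Real.sqrt_zero, mul_zero, op_zero_apply, gauss_apply]
  simp

theorem norm_heat_le (c s : ℝ) (f : Cb d) : ‖heat c s f‖ ≤ kerNorm (gauss (d := d)) * ‖f‖ :=
  norm_op_apply_le _ _ f

/-- Taylor's formula of order two for the exponential, read on the symbol. The time is measured in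
units of `2^{-2k}`, so the constant is the same for all blocks. -/
theorem exists_heat_taylor (χ : Cutoff d) : ∃ K : ℝ, 0 ≤ K ∧ ∀ (k : ℤ) (s : ℝ), 0 ≤ s → s ≤ 1 →
    ∀ f : Cb d, ‖heat (freq k) s (Dl χ k f) - Dl χ k f - s • op (freq k) (lap (phi χ)) f‖ ≤
      K * s ^ 2 * ‖f‖ := by
  refine ⟨kerNorm (remSymbol χ) * kerNorm (lap (lap (phi χ))),
    mul_nonneg (kerNorm_nonneg _) (kerNorm_nonneg _), fun k s hs hs1 f => ?_⟩
  rcases hs.eq_or_lt with rfl | hs0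
  · rw [heat_zero]; simp
  have hc := freq_ne k
  have hcs : freq k * √s ≠ 0 := mul_ne_zero hc (Real.sqrt_pos.2 hs0).ne'
  have key : heat (freq k) s * Dl χ k - Dl χ k - (s : ℂ) • op (freq k) (lap (phi χ)) =
      ((s ^ 2 : ℝ) : ℂ) • (op (freq k * √s) (remSymbol χ) * op (freq k) (lap (lap (phi χ)))) := by
    refine ((((isMult_heat hc hs).mul (isMult_op hc (phi χ))).sub (isMult_op hc (phi χ))).sub
      ((isMult_op hc _).smul _)).eq
      (((isMult_op hcs _).mul (isMult_op hc _)).smul _) fun η => ?_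
    simp only [lap_apply]
    set ζ := freq k • η with hζ
    by_cases h0 : phi χ ζ = 0
    · simp [h0]
    have hb : ‖ζ‖ < 8 / 3 := by
      by_contra hb
      exact h0 (phi_eq_zero χ (Or.inr (not_lt.1 hb)))
    have hz : (freq k * √s) • η = √s • ζ := by rw [hζ, smul_smul, mul_comm]
    have hz2 : ‖√s • ζ‖ ^ 2 = s * ‖ζ‖ ^ 2 := by
      rw [norm_smul, mul_pow, Real.norm_eq_abs, sq_abs, Real.sq_sqrt hs]
    have hsq : √s ≤ 1 := Real.sqrt_le_one.2 hs1
    -- The remainder of the exponential decays too slowly to be a Schwartz symbol and was cut off at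
    -- `‖ξ‖ ≤ 3`. Since `s ≤ 1`, the point `√s ζ` lies in the ball of radius `8/3`, where the
    -- cut-off equals one.
    have h1 : chiD χ 2 (√s • ζ) = 1 := by
      refine chiD_eq_one χ ?_
      rw [norm_smul, Real.norm_of_nonneg (Real.sqrt_nonneg _)]
      have := norm_nonneg ζ
      norm_num
      nlinarith [Real.sqrt_nonneg s]
    rw [hz, remSymbol_apply, h1, hz2, exp_eq_expRem]
    push_cast
    ring
  have h2 := congrArg (fun T => T f) key
  have h3 : heat (freq k) s (Dl χ k f) - Dl χ k f - s • op (freq k) (lap (phi χ)) f =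
      ((s ^ 2 : ℝ) : ℂ) • op (freq k * √s) (remSymbol χ) (op (freq k) (lap (lap (phi χ))) f) := h2
  rw [h3, norm_smul, Complex.norm_real, Real.norm_of_nonneg (by positivity)]
  calc _ ≤ s ^ 2 * (kerNorm (remSymbol χ) * (kerNorm (lap (lap (phi χ))) * ‖f‖)) := by
        gcongr
        refine (norm_op_apply_le _ _ _).trans ?_
        gcongr
        · exact kerNorm_nonneg _
        · exact norm_op_apply_le _ _ _
    _ = _ := by ring

/-! ### Exponentials of bounded operators -/

section OpExp

variable {E : Type*} [NormedAddCommGroup E] [NormedSpace ℝ E]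

/-- The group generated by a bounded operator. -/
def opExp (B : E →L[ℝ] E) (s : ℝ) : E →L[ℝ] E := NormedSpace.exp (s • B)

theorem opExp_zero (B : E →L[ℝ] E) : opExp B 0 = 1 := by
  rw [opExp, zero_smul, NormedSpace.exp_zero]

theorem opExp_commute {B T : E →L[ℝ] E} (h : Commute B T) (s : ℝ) : Commute (opExp B s) T :=
  Commute.exp_left (h.smul_left s)

variable [CompleteSpace E]

theorem opExp_add (B : E →L[ℝ] E) (s t : ℝ) : opExp B (s + t) = opExp B s * opExp B t := by
  let _ : NormedAlgebra ℚ (E →L[ℝ] E) := NormedAlgebra.restrictScalars ℚ ℝ (E →L[ℝ] E)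
  rw [opExp, add_smul, NormedSpace.exp_add_of_commute]
  · rfl
  · exact ((Commute.refl _).smul_left s).smul_right t

theorem hasDerivAt_opExp (B : E →L[ℝ] E) (s : ℝ) : HasDerivAt (opExp B) (B * opExp B s) s :=
  hasDerivAt_exp_smul_const' B s

theorem continuous_opExp (B : E →L[ℝ] E) : Continuous (opExp B) :=
  continuous_iff_continuousAt.2 fun s => (hasDerivAt_opExp B s).continuousAt

/-- The curve `τ ↦ opExp B (s - τ) (h τ)` has vanishing right derivative, hence is constant.
One-sided derivatives suffice, and they are what the forward Taylor bound for the heat operators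
gives. -/
theorem opExp_eq_of_hasDerivWithinAt {B : E →L[ℝ] E} {h : ℝ → E} {s : ℝ} (hs : 0 ≤ s)
    (hc : ContinuousOn h (Icc 0 s))
    (hd : ∀ τ ∈ Ico 0 s, HasDerivWithinAt h (B (h τ)) (Ici τ) τ) : opExp B s (h 0) = h s := by
  set φ : ℝ → E := fun τ => opExp B (s - τ) (h τ) with hφ
  have hcE : Continuous fun τ => opExp B (s - τ) :=
    (continuous_opExp B).comp (continuous_const.sub continuous_id)
  have hc : ContinuousOn φ (Icc 0 s) := hcE.continuousOn.clm_apply hc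
  have hd : ∀ τ ∈ Ico 0 s, HasDerivWithinAt φ 0 (Ici τ) τ := by
    intro τ hτ
    have h1 : HasDerivWithinAt (fun τ => opExp B (s - τ)) (-(B * opExp B (s - τ))) (Ici τ) τ := by
      exact (hasDerivAt_opExp B (s - τ)).comp_const_sub _ _ |>.hasDerivWithinAt
    have h2 := h1.clm_apply (hd τ hτ)
    convert! h2 using 1
    have h3 := congrArg (fun S => S (h τ)) (opExp_commute (Commute.refl B) (s - τ)).eq
    exact (by rw [← h3]; exact neg_add_cancel _ :
      -((B * opExp B (s - τ)) (h τ)) + opExp B (s - τ) (B (h τ)) = 0).symm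
  have := constant_of_has_deriv_right_zero hc hd s ⟨hs, le_rfl⟩
  simp only [hφ, sub_self, sub_zero, opExp_zero] at this
  exact this.symm

/-- Duhamel's formula for a bounded generator. -/
theorem duhamel {B : E →L[ℝ] E} {w g : ℝ → E} (hw : Continuous w) (hg : Continuous g) {t : ℝ}
    (ht : 0 ≤ t) (h : ∀ τ ∈ Icc 0 t, w τ = w 0 + ∫ r in (0 : ℝ)..τ, (B (w r) + g r)) :
    w t = opExp B t (w 0) + ∫ τ in (0 : ℝ)..t, opExp B (t - τ) (g τ) := by
  have hG : Continuous fun r => B (w r) + g r := (B.continuous.comp hw).add hg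
  have hEg : Continuous fun τ => opExp B (t - τ) (g τ) :=
    ((continuous_opExp B).comp (continuous_const.sub continuous_id)).clm_apply hg
  -- The integral equation is known only on `[0, t]`, so `w` may fail to be differentiable at the
  -- ends. Its right-hand side is differentiable everywhere and agrees with `w` on the interval.
  set W : ℝ → E := fun τ => w 0 + ∫ r in (0 : ℝ)..τ, (B (w r) + g r) with hW
  have hWd : ∀ τ, HasDerivAt W (B (w τ) + g τ) τ := fun τ =>
    (intervalIntegral.integral_hasDerivAt_right (hG.intervalIntegrable _ _)
      (hG.stronglyMeasurableAtFilter _ _) hG.continuousAt).const_add _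
  have hE : ∀ τ, HasDerivAt (fun τ => opExp B (t - τ)) (-(B * opExp B (t - τ))) τ := fun τ =>
    (hasDerivAt_opExp B (t - τ)).comp_const_sub _ _
  set φ : ℝ → E := fun τ => opExp B (t - τ) (W τ) with hφ
  have hφd : ∀ τ ∈ uIcc 0 t, HasDerivAt φ (opExp B (t - τ) (g τ)) τ := by
    intro τ hτ
    rw [uIcc_of_le ht] at hτ
    have h2 := (hE τ).clm_apply (hWd τ)
    convert! h2 using 1
    have h3 := congrArg (fun S => S (w τ)) (opExp_commute (Commute.refl B) (t - τ)).eq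
    have h4 : W τ = w τ := (h τ hτ).symm
    rw [h4, map_add, ← add_assoc]
    refine (by rw [← h3]; exact (zero_add _).symm.trans (by rw [← neg_add_cancel]; rfl) :
      opExp B (t - τ) (g τ) = -((B * opExp B (t - τ)) (w τ)) + opExp B (t - τ) (B (w τ)) +
        opExp B (t - τ) (g τ))
  have h5 := intervalIntegral.integral_eq_sub_of_hasDerivAt hφd (hEg.intervalIntegrable _ _)
  have h6 : W t = w t := (h t ⟨ht, le_rfl⟩).symm
  have h7 : W 0 = w 0 := (h 0 ⟨le_rfl, ht⟩).symm
  simp only [hφ, sub_self, sub_zero, opExp_zero, h6, h7] at h5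
  rw [h5]
  exact (add_sub_cancel _ _).symm

end OpExp

/-! ### The exponential of the localized Laplacian -/

/-- The localized Laplacian at scale `freq k`. -/
def lapOp (χ : Cutoff d) (k : ℤ) : Cb d →L[ℂ] Cb d := op (freq k) (lap (phiT χ))

/-- The enlarged cut-off is one on the spectrum of the block, so on blocks the localized operator is
the true Laplacian divided by `2^{2k}`. -/
theorem lapOp_Dl (χ : Cutoff d) (k : ℤ) (f : Cb d) :
    lapOp χ k (Dl χ k f) = op (freq k) (lap (phi χ)) f := by
  have h := op_comp (freq_ne k) (m := lap (phi χ)) (m₁ := lap (phiT χ)) (m₂ := phi χ) fun ξ => by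
    rw [lap_apply, lap_apply, mul_assoc, phiT_mul_phi]
  exact (congrArg (fun T => T f) h).symm

theorem lapOp_commute_Dl (χ : Cutoff d) (k : ℤ) : Commute (lapOp χ k) (Dl χ k) :=
  (isMult_op (freq_ne k) _).commute (isMult_op (freq_ne k) _)

/-- The localized Laplacian as a real linear operator. -/
def lapOpR (χ : Cutoff d) (k : ℤ) : Cb d →L[ℝ] Cb d := (lapOp χ k).restrictScalars ℝ

/-- The group generated by the localized Laplacian. -/
def lapExp (χ : Cutoff d) (k : ℤ) (s : ℝ) : Cb d →L[ℝ] Cb d := opExp (lapOpR χ k) s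

theorem lapExp_apply_comm {χ : Cutoff d} {k : ℤ} {T : Cb d →L[ℂ] Cb d} (h : Commute (lapOp χ k) T)
    (s : ℝ) (f : Cb d) : lapExp χ k s (T f) = T (lapExp χ k s f) := by
  have h1 : Commute (lapOpR χ k) (T.restrictScalars ℝ) := by
    refine ContinuousLinearMap.ext fun f => ?_
    exact congrArg (fun S => S f) h.eq
  exact congrArg (fun S => S f) (opExp_commute h1 s).eq

theorem exists_heat_lipschitz (χ : Cutoff d) : ∃ K : ℝ, 0 ≤ K ∧ ∀ (k : ℤ) (s : ℝ), 0 ≤ s → s ≤ 1 →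
    ∀ f : Cb d, ‖heat (freq k) s (Dl χ k f) - Dl χ k f‖ ≤ K * s * ‖f‖ := by
  obtain ⟨K, hK, h⟩ := exists_heat_taylor χ
  refine ⟨K + kerNorm (lap (phi χ)), add_nonneg hK (kerNorm_nonneg _), fun k s hs hs1 f => ?_⟩
  have h1 := h k s hs hs1 f
  have h2 : ‖s • op (freq k) (lap (phi χ)) f‖ ≤ s * (kerNorm (lap (phi χ)) * ‖f‖) := by
    rw [norm_smul, Real.norm_of_nonneg hs]
    gcongr
    exact norm_op_apply_le _ _ _
  have h3 : K * s ^ 2 * ‖f‖ ≤ K * s * ‖f‖ := by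
    gcongr
    nlinarith
  have h4 := norm_add_le (heat (freq k) s (Dl χ k f) - Dl χ k f - s • op (freq k) (lap (phi χ)) f)
    (s • op (freq k) (lap (phi χ)) f)
  rw [sub_add_cancel] at h4
  linarith

theorem heat_step (χ : Cutoff d) (k : ℤ) {s t : ℝ} (hs : 0 ≤ s) (hst : s ≤ t) (f : Cb d) :
    heat (freq k) t (Dl χ k f) - heat (freq k) s (Dl χ k f) =
      heat (freq k) s (heat (freq k) (t - s) (Dl χ k f) - Dl χ k f) := by
  have h := heat_add (d := d) (freq_ne k) hs (sub_nonneg.2 hst)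
  rw [add_sub_cancel] at h
  rw [h, map_sub]; rfl

theorem continuousOn_heat (χ : Cutoff d) (k : ℤ) (f : Cb d) :
    ContinuousOn (fun s => heat (freq k) s (Dl χ k f)) (Ici 0) := by
  obtain ⟨K, hK, h⟩ := exists_heat_lipschitz χ
  set G := kerNorm (gauss (d := d)) with hG
  have hG0 : 0 ≤ G := kerNorm_nonneg _
  have h1 : ∀ s t : ℝ, 0 ≤ s → s ≤ t → t - s ≤ 1 →
      ‖heat (freq k) t (Dl χ k f) - heat (freq k) s (Dl χ k f)‖ ≤ G * (K * ‖f‖) * |t - s| := by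
    intro s t hs hst h1
    rw [heat_step χ k hs hst, abs_of_nonneg (by linarith)]
    refine (norm_heat_le _ _ _).trans ?_
    have := h k (t - s) (by linarith) h1 f
    calc _ ≤ G * (K * (t - s) * ‖f‖) := by gcongr
      _ = _ := by ring
  intro s hs
  rw [ContinuousWithinAt, tendsto_iff_norm_sub_tendsto_zero]
  refine squeeze_zero' (g := fun t => G * (K * ‖f‖) * |t - s|) (Eventually.of_forall fun _ => norm_nonneg _) ?_ ?_
  · have hnear : ∀ᶠ t in 𝓝[Ici 0] s, |t - s| < 1 := by
      refine nhdsWithin_le_nhds ?_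
      have : Metric.ball s 1 ∈ 𝓝 s := Metric.ball_mem_nhds s one_pos
      filter_upwards [this] with t ht
      rwa [Metric.mem_ball, Real.dist_eq] at ht
    filter_upwards [hnear, self_mem_nhdsWithin] with t ht ht0
    rw [abs_lt] at ht
    rcases le_total s t with hst | hst
    · exact h1 s t hs hst (by linarith)
    · rw [norm_sub_rev, abs_sub_comm]
      exact h1 t s ht0 hst (by linarith)
  · have : Continuous fun t : ℝ => G * (K * ‖f‖) * |t - s| := by fun_prop
    simpa using (this.tendsto s).mono_left nhdsWithin_le_nhds

theorem heat_commute_lapOp (χ : Cutoff d) (k : ℤ) {s : ℝ} (hs : 0 ≤ s) :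
    Commute (heat (freq k) s) (lapOp χ k) :=
  (isMult_heat (freq_ne k) hs).commute (isMult_op (freq_ne k) _)

theorem hasDerivWithinAt_heat (χ : Cutoff d) (k : ℤ) (f : Cb d) {s : ℝ} (hs : 0 ≤ s) :
    HasDerivWithinAt (fun s => heat (freq k) s (Dl χ k f))
      (lapOp χ k (heat (freq k) s (Dl χ k f))) (Ici s) s := by
  obtain ⟨K, hK, h⟩ := exists_heat_taylor χ
  set G := kerNorm (gauss (d := d)) with hG
  have hG0 : 0 ≤ G := kerNorm_nonneg _
  rw [hasDerivWithinAt_iff_isLittleO]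
  have hO : (fun t => heat (freq k) t (Dl χ k f) - heat (freq k) s (Dl χ k f) -
      (t - s) • lapOp χ k (heat (freq k) s (Dl χ k f))) =O[𝓝[Ici s] s] fun t => (t - s) ^ 2 := by
    refine Asymptotics.IsBigO.of_bound (G * (K * ‖f‖)) ?_
    have hnear : ∀ᶠ t in 𝓝[Ici s] s, t < s + 1 :=
      nhdsWithin_le_nhds (Iio_mem_nhds (by linarith))
    filter_upwards [hnear, self_mem_nhdsWithin] with t ht hst
    have hst' : s ≤ t := hst
    have e1 : lapOp χ k (heat (freq k) s (Dl χ k f)) =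
        heat (freq k) s (op (freq k) (lap (phi χ)) f) := by
      rw [← lapOp_Dl]
      exact (congrArg (fun T => T (Dl χ k f)) (heat_commute_lapOp χ k hs).eq).symm
    have e2 : (t - s) • heat (freq k) s (op (freq k) (lap (phi χ)) f) =
        heat (freq k) s ((t - s) • op (freq k) (lap (phi χ)) f) :=
      ((heat (freq k) s).map_smul_of_tower _ _).symm
    rw [e1, e2, heat_step χ k hs hst', ← map_sub, Real.norm_of_nonneg (sq_nonneg _)]
    refine (norm_heat_le _ _ _).trans ?_
    have := h k (t - s) (by linarith) (by linarith) f
    calc _ ≤ G * (K * (t - s) ^ 2 * ‖f‖) := by gcongr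
      _ = _ := by ring
  refine hO.trans_isLittleO (Asymptotics.IsLittleO.mono ?_ nhdsWithin_le_nhds)
  have := Asymptotics.isLittleO_pow_sub_sub s (m := 2) (by norm_num)
  simpa using this

/-- Both sides solve the same linear equation with the same initial value. The exponential of a
bounded operator supplies Duhamel's formula, the Gaussian convolution supplies the `L^p` decay. -/
theorem lapExp_Dl_eq (χ : Cutoff d) (k : ℤ) {s : ℝ} (hs : 0 ≤ s) (f : Cb d) :
    lapExp χ k s (Dl χ k f) = heat (freq k) s (Dl χ k f) := by
  have h := opExp_eq_of_hasDerivWithinAt (B := lapOpR χ k) hs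
    ((continuousOn_heat χ k f).mono Icc_subset_Ici_self)
    (fun τ hτ => hasDerivWithinAt_heat χ k f hτ.1)
  rwa [heat_zero] at h

/-! ### Decay of the blocks -/

/-- An integrable decay rate, vanishing for negative times. -/
def dec (s : ℝ) : ℝ≥0∞ := if 0 ≤ s then ENNReal.ofReal (((1 + s) ^ 2)⁻¹) else 0

theorem dec_le_one (s : ℝ) : dec s ≤ 1 := by
  unfold dec
  split_ifs with h
  · rw [ENNReal.ofReal_le_one]
    exact inv_le_one_of_one_le₀ (by nlinarith)
  · exact zero_le_one

theorem measurable_dec : Measurable dec := by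
  unfold dec
  refine Measurable.ite measurableSet_Ici ?_ measurable_const
  fun_prop

theorem lintegral_dec : ∫⁻ s, dec s ≤ 1 := by
  have h1 : ∀ s, dec s = (Ici (0 : ℝ)).indicator (fun s => ENNReal.ofReal (((1 + s) ^ 2)⁻¹)) s :=
    fun s => by simp [dec, indicator_apply]
  simp only [h1]
  rw [lintegral_indicator measurableSet_Ici, ← setLIntegral_congr Ioi_ae_eq_Ici]
  have hd : ∀ x ∈ Ici (0 : ℝ), HasDerivAt (fun x => -(1 + x)⁻¹) (((1 + x) ^ 2)⁻¹) x := by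
    intro x hx
    have hx' : (0 : ℝ) ≤ x := hx
    have := (((hasDerivAt_id x).const_add 1).inv (by simp; linarith)).neg
    convert! this using 1
    simp [neg_div]
  have hlim : Tendsto (fun x : ℝ => -(1 + x)⁻¹) atTop (𝓝 0) := by
    rw [← neg_zero]
    exact (tendsto_inv_atTop_zero.comp (tendsto_atTop_add_const_left _ _ tendsto_id)).neg
  have hnn : ∀ x ∈ Ioi (0 : ℝ), (0 : ℝ) ≤ ((1 + x) ^ 2)⁻¹ := fun x _ => by positivity
  rw [← ofReal_integral_eq_lintegral_ofReal
    (integrableOn_Ioi_deriv_of_nonneg' hd hnn hlim)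
    ((ae_restrict_iff' measurableSet_Ioi).2 (Eventually.of_forall hnn)),
    integral_Ioi_of_hasDerivAt_of_nonneg' hd hnn hlim]
  simp

/-- With `a = κ 2^{2k}`, the factor `a⁻¹` is the gain of two derivatives by integration in time. -/
theorem lintegral_dec_comp {a : ℝ} (ha : 0 < a) (τ : ℝ) :
    ∫⁻ t, dec (a * (t - τ)) ≤ ENNReal.ofReal a⁻¹ := by
  rw [lintegral_sub_right_eq_self (fun t => dec (a * t)) τ]
  have h2 : Measure.map (fun y : ℝ => a * y) volume = ENNReal.ofReal a⁻¹ • volume := by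
    have := Real.map_volume_mul_left ha.ne'
    rwa [abs_of_pos (inv_pos.2 ha)] at this
  have h3 : ∫⁻ t, dec (a * t) = ∫⁻ t, dec t ∂(Measure.map (fun y => a * y) volume) := by
    rw [lintegral_map measurable_dec (by fun_prop)]
  rw [h3, h2, lintegral_smul_measure, smul_eq_mul]
  exact mul_le_of_le_one_right (by simp) lintegral_dec

/-- For `s ≥ 1` write `exp(-s‖ξ‖²)` as `s^(-2)` times `(s‖ξ‖²)² exp(-s‖ξ‖²)` times `‖ξ‖^(-4)`. The
middle factor is a dilated Schwartz symbol and the last is smooth on the annulus. Quadratic decay is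
enough, as only integrability in time is used. -/
theorem exists_eLpNorm_lapExp_le {p : ℝ≥0∞} (hp1 : 1 ≤ p) (hp : p ≠ ∞) (χ : Cutoff d) :
    ∃ K : ℝ≥0∞, K ≠ ∞ ∧ ∀ (k : ℤ) (s : ℝ), 0 ≤ s → ∀ f : Cb d,
      eLpNorm (lapExp χ k s (Dl χ k f)) p volume ≤ K * dec s * blk χ p k f := by
  set g2 : 𝓢(Space d, ℂ) := lap (lap gauss) with hg2
  set K0 := kerNorm (gauss (d := d)) with hK0
  set K2 := kerNorm g2 * kerNorm (invSymbol χ) with hK2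
  have hK00 : 0 ≤ K0 := kerNorm_nonneg _
  have hK20 : 0 ≤ K2 := mul_nonneg (kerNorm_nonneg _) (kerNorm_nonneg _)
  -- The factor 4 comes from `(1 + s)² ≤ 4` for `s ≤ 1` and `(1 + s)² ≤ 4 s²` for `s ≥ 1`.
  refine ⟨ENNReal.ofReal (4 * (K0 + K2)), ENNReal.ofReal_ne_top, fun k s hs f => ?_⟩
  rw [lapExp_Dl_eq χ k hs, dec, if_pos hs, ← ENNReal.ofReal_mul (by positivity)]
  rcases le_total s 1 with h1 | h1
  · refine (eLpNorm_op_le hp1 hp _ _ _).trans ?_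
    refine mul_le_mul_left (ENNReal.ofReal_le_ofReal ?_) _
    rw [← div_eq_mul_inv, le_div_iff₀ (by positivity), ← hK0]
    have : (1 + s) ^ 2 ≤ 4 := by nlinarith
    nlinarith [mul_le_mul_of_nonneg_left this hK00]
  · have hs0 : 0 < s := by linarith
    have hc := freq_ne k
    have hcs : freq k * √s ≠ 0 := mul_ne_zero hc (Real.sqrt_pos.2 hs0).ne'
    have key : heat (freq k) s * Dl χ k = (((s ^ 2)⁻¹ : ℝ) : ℂ) •
        (op (freq k * √s) g2 * (op (freq k) (invSymbol χ) * Dl χ k)) := by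
      refine ((isMult_heat hc hs).mul (isMult_op hc _)).eq
        (((isMult_op hcs _).mul ((isMult_op hc _).mul (isMult_op hc _))).smul _) fun η => ?_
      set ζ := freq k • η with hζ
      have hz : (freq k * √s) • η = √s • ζ := by rw [hζ, smul_smul, mul_comm]
      have hz2 : ‖√s • ζ‖ ^ 2 = s * ‖ζ‖ ^ 2 := by
        rw [norm_smul, mul_pow, Real.norm_eq_abs, sq_abs, Real.sq_sqrt hs]
      have h3 := invSymbol_mul χ ζ
      have h4 := phiT_mul_phi χ ζ
      rw [hz, hg2, lap_apply, lap_apply, gauss_apply, hz2]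
      have hs' : (s : ℂ) ≠ 0 := Complex.ofReal_ne_zero.2 hs0.ne'
      have h5 : phi χ ζ = ((‖ζ‖ ^ 2 : ℝ) : ℂ) ^ 2 * invSymbol χ ζ * phi χ ζ := by rw [h3, h4]
      have h6 : (((s ^ 2)⁻¹ : ℝ) : ℂ) * (s : ℂ) ^ 2 = 1 := by
        push_cast; exact inv_mul_cancel₀ (pow_ne_zero _ hs')
      calc _ = (((s ^ 2)⁻¹ : ℝ) : ℂ) * (s : ℂ) ^ 2 * (((‖ζ‖ ^ 2 : ℝ) : ℂ) ^ 2 * invSymbol χ ζ *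
            phi χ ζ) * Complex.exp (-((s * ‖ζ‖ ^ 2 : ℝ) : ℂ)) := by rw [h6, ← h5, one_mul]
        _ = _ := by
          rw [Complex.ofReal_mul s]; ring
    have h2 : heat (freq k) s (Dl χ k f) = (((s ^ 2)⁻¹ : ℝ) : ℂ) •
        op (freq k * √s) g2 (op (freq k) (invSymbol χ) (Dl χ k f)) := congrArg (fun T => T f) key
    rw [h2, BoundedContinuousFunction.coe_smul]
    refine (eLpNorm_const_smul (((s ^ 2)⁻¹ : ℝ) : ℂ) (op (freq k * √s) g2
      (op (freq k) (invSymbol χ) (Dl χ k f)) : Space d → ℂ) p volume).trans_le ?_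
    have h3 : ‖(((s ^ 2)⁻¹ : ℝ) : ℂ)‖ₑ = ENNReal.ofReal (s ^ 2)⁻¹ := by
      rw [← ofReal_norm, Complex.norm_real, Real.norm_of_nonneg (by positivity)]
    rw [h3]
    calc _ ≤ ENNReal.ofReal (s ^ 2)⁻¹ * (ENNReal.ofReal (kerNorm g2) *
          (ENNReal.ofReal (kerNorm (invSymbol χ)) * blk χ p k f)) := by
          refine mul_le_mul_right ((eLpNorm_op_le hp1 hp _ _ _).trans ?_) _
          exact mul_le_mul_right (eLpNorm_op_le hp1 hp _ _ _) _
      _ = ENNReal.ofReal ((s ^ 2)⁻¹ * K2) * blk χ p k f := by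
          rw [hK2, ENNReal.ofReal_mul (by positivity), ENNReal.ofReal_mul (kerNorm_nonneg _)]
          ring
      _ ≤ _ := by
          refine mul_le_mul_left (ENNReal.ofReal_le_ofReal ?_) _
          rw [inv_mul_eq_div, ← div_eq_mul_inv, div_le_div_iff₀ (by positivity) (by positivity)]
          have : (1 + s) ^ 2 ≤ 4 * s ^ 2 := by nlinarith
          nlinarith [mul_le_mul_of_nonneg_left this hK20, mul_nonneg hK00 (sq_nonneg s)]

open Laplacian

/-! ### The Laplacian and convolution operators -/

theorem laplacian_eq_mult (T : 𝓢'(Space d, ℂ)) :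
    Δ T = ((-(2 * Real.pi) ^ 2 : ℝ) : ℂ) •
      TemperedDistribution.fourierMultiplierCLM ℂ (fun x => Complex.ofReal (‖x‖ ^ 2)) T := by
  rw [TemperedDistribution.laplacian_eq_fourierMultiplierCLM, Complex.coe_smul]

theorem mult_laplacian {c : ℝ} (hc : c ≠ 0) (m : 𝓢(Space d, ℂ)) (f : Cb d) :
    TemperedDistribution.fourierMultiplierCLM ℂ (fun x => Complex.ofReal (‖x‖ ^ 2))
      (toDist (op c m f)) = ((-(c ^ 2)⁻¹ : ℝ) : ℂ) • toDist (op c (lap m) f) := by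
  rw [toDist_op hc, toDist_op hc, TemperedDistribution.fourierMultiplierCLM_fourierMultiplierCLM_apply
    (hasTemperateGrowth_dilation c m) hasTemperateGrowth_sq]
  have hg : (fun x : Space d => Complex.ofReal (‖x‖ ^ 2)) * (fun η => m (c • η)) =
      ((-(c ^ 2)⁻¹ : ℝ) : ℂ) • fun η => lap m (c • η) := by
    ext η
    have hc' : (c : ℂ) ≠ 0 := Complex.ofReal_ne_zero.2 hc
    simp only [Pi.mul_apply, Pi.smul_apply, lap_apply, norm_smul, mul_pow, Real.norm_eq_abs, sq_abs,
      smul_eq_mul]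
    push_cast
    field_simp
  rw [mul_comm] at hg
  rw [mul_comm, mul_comm, hg, TemperedDistribution.fourierMultiplierCLM_smul
    (hasTemperateGrowth_dilation c _)]
  rfl

/-- The Laplacian has symbol `-(2π‖η‖)²`, whereas `lap` multiplies by `-‖cη‖²`; the quotient is
`(2π/c)²`, which is `2^{2k}` at the scale `freq k`. -/
theorem toDist_op_laplacian {c : ℝ} (hc : c ≠ 0) (m : 𝓢(Space d, ℂ)) (f : Cb d)
    (φ : 𝓢(Space d, ℂ)) :
    toDist (op c m f) (Δ φ) = toDist ((((2 * Real.pi / c) ^ 2 : ℝ) : ℂ) • op c (lap m) f) φ := by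
  rw [← TemperedDistribution.laplacian_apply_apply, laplacian_eq_mult, mult_laplacian hc, smul_smul,
    toDist_smul]
  congr 2
  rw [← Complex.ofReal_mul]
  congr 1
  field_simp

/-- The dual action of a convolution operator on Schwartz functions. -/
def dualOp (c : ℝ) (m φ : 𝓢(Space d, ℂ)) : 𝓢(Space d, ℂ) :=
  𝓕 (SchwartzMap.smulLeftCLM ℂ (fun η => m (c • η)) (𝓕⁻ φ))

theorem toDist_dualOp {c : ℝ} (hc : c ≠ 0) (m φ : 𝓢(Space d, ℂ)) (f : Cb d) :
    toDist f (dualOp c m φ) = toDist (op c m f) φ := by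
  rw [toDist_op hc, TemperedDistribution.fourierMultiplierCLM_apply_apply]
  rfl

theorem toDist_laplacian_dualOp {c : ℝ} (hc : c ≠ 0) (m φ : 𝓢(Space d, ℂ)) (f : Cb d) :
    toDist f (Δ (dualOp c m φ)) =
      toDist ((((2 * Real.pi / c) ^ 2 : ℝ) : ℂ) • op c (lap m) f) φ := by
  have hcomm := TemperedDistribution.fourierMultiplierCLM_fourierMultiplierCLM_apply (F := ℂ)
    (hasTemperateGrowth_dilation c m) hasTemperateGrowth_sq (toDist f)
  rw [mul_comm (fun η => m (c • η)),
    ← TemperedDistribution.fourierMultiplierCLM_fourierMultiplierCLM_apply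
    hasTemperateGrowth_sq (hasTemperateGrowth_dilation c m)] at hcomm
  rw [← toDist_op_laplacian hc, ← TemperedDistribution.laplacian_apply_apply,
    ← TemperedDistribution.laplacian_apply_apply, laplacian_eq_mult, laplacian_eq_mult, toDist_op hc,
    hcomm]
  simp only [smul_apply, TemperedDistribution.fourierMultiplierCLM_apply_apply]
  rfl

/-! ### The linear heat equation -/

/-- The function `v` solves `∂_t v - κ Δ v = Δ f` on the time interval `J`, in the sense of tempered
distributions. -/
def HeatOn (κ : ℝ) (J : Set ℝ) (v f : ℝ → Cb d) : Prop :=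
  ∀ t ∈ J, ∀ φ : 𝓢(Space d, ℂ), toDist (v t) φ = toDist (v 0) φ +
    ∫ τ in (0 : ℝ)..t, toDist ((κ : ℂ) • v τ + f τ) (Δ φ)

variable {κ : ℝ} {J : Set ℝ} {v f : ℝ → Cb d}

/-- Testing the equation against the transposed operator applied to `φ` puts a fixed frequency
localization on `v`. The Laplacian is then bounded, and the scalar identities lift to an integral
equation in the supremum norm. -/
theorem HeatOn.op_eq (h : HeatOn κ J v f) (hv : Continuous v) (hf : Continuous f) {t : ℝ} (ht : t ∈ J)
    {c : ℝ} (hc : c ≠ 0) (m : 𝓢(Space d, ℂ)) :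
    op c m (v t) = op c m (v 0) +
      ∫ τ in (0 : ℝ)..t, (((2 * Real.pi / c) ^ 2 : ℝ) : ℂ) • op c (lap m) ((κ : ℂ) • v τ + f τ) := by
  refine toDist_injective ?_
  ext φ
  have hcont : Continuous fun τ =>
      (((2 * Real.pi / c) ^ 2 : ℝ) : ℂ) • op c (lap m) ((κ : ℂ) • v τ + f τ) :=
    (continuous_const_smul _).comp ((op c (lap m)).continuous.comp ((hv.const_smul (κ : ℂ)).add hf))
  have h1 := h t ht (dualOp c m φ)
  rw [toDist_dualOp hc, toDist_dualOp hc] at h1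
  simp only [toDist_laplacian_dualOp hc] at h1
  rw [h1, toDist_add]
  congr 1
  exact (pairCLM φ).intervalIntegral_comp_comm (hcont.intervalIntegrable 0 t)

/-! ### Blockwise Duhamel formula and a priori estimates. -/

theorem two_pi_div_freq (k : ℤ) : (2 * Real.pi / freq k) ^ 2 = ((2 : ℝ) ^ k) ^ 2 := by
  unfold freq
  rw [zpow_neg]
  have := Real.pi_pos
  field_simp

theorem ofReal_sq_zpow (k : ℤ) : ENNReal.ofReal (((2 : ℝ) ^ k) ^ 2) = wt 2 k := by
  rw [wt, Real.rpow_mul (by norm_num), Real.rpow_intCast]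
  norm_num

theorem opExp_smul {E : Type*} [NormedAddCommGroup E] [NormedSpace ℝ E] (B : E →L[ℝ] E) (a s : ℝ) :
    opExp (a • B) s = opExp B (a * s) := by
  rw [opExp, opExp, smul_smul, mul_comm]

theorem measurable_blk {p : ℝ≥0∞} (hp1 : 1 ≤ p) (hp : p ≠ ∞) (χ : Cutoff d) (k : ℤ)
    (hf : Continuous f) : Measurable fun τ => blk χ p k (f τ) :=
  measurable_eLpNorm_Cb hp1 hp ((Dl χ k).continuous.comp hf)

theorem measurable_bes {p : ℝ≥0∞} (hp1 : 1 ≤ p) (hp : p ≠ ∞) (χ : Cutoff d) (σ : ℝ)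
    (hf : Continuous f) : Measurable fun τ => bes χ σ p (f τ) :=
  Measurable.tsum fun k => (measurable_blk hp1 hp χ k hf).const_mul _

/-- A block of the solution satisfies an ordinary differential equation with the bounded generator
`κ 2^{2k} lapOp`, so Duhamel's formula applies even though the equation is only known weakly. -/
theorem HeatOn.Dl_eq (h : HeatOn κ J v f) (χ : Cutoff d) (hv : Continuous v) (hf : Continuous f)
    (hJ : ∀ t ∈ J, 0 ≤ t ∧ Icc 0 t ⊆ J) {t : ℝ} (ht : t ∈ J) (k : ℤ) :
    Dl χ k (v t) = lapExp χ k (κ * ((2 : ℝ) ^ k) ^ 2 * t) (Dl χ k (v 0)) +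
      ∫ τ in (0 : ℝ)..t, lapExp χ k (κ * ((2 : ℝ) ^ k) ^ 2 * (t - τ))
        (((2 : ℝ) ^ k) ^ 2 • lapOp χ k (Dl χ k (f τ))) := by
  have hg : Continuous fun τ => ((2 : ℝ) ^ k) ^ 2 • lapOp χ k (Dl χ k (f τ)) :=
    (continuous_const_smul _).comp ((lapOp χ k).continuous.comp ((Dl χ k).continuous.comp hf))
  have hw : Continuous fun τ => Dl χ k (v τ) := (Dl χ k).continuous.comp hv
  have h1 := duhamel (B := (κ * ((2 : ℝ) ^ k) ^ 2) • lapOpR χ k) hw hg (hJ t ht).1 ?_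
  · simp only [opExp_smul] at h1
    exact h1
  intro τ hτ
  have h2 := h.op_eq hv hf ((hJ t ht).2 hτ) (freq_ne k) (phi χ)
  rw [two_pi_div_freq] at h2
  refine h2.trans ?_
  congr 1
  refine intervalIntegral.integral_congr fun r _ => ?_
  rw [← lapOp_Dl, map_add, map_add, smul_add, map_smul, map_smul, smul_smul, Complex.coe_smul,
    ← Complex.ofReal_mul, Complex.coe_smul, mul_comm]
  rfl

/-- The `L^p` norm of a localized solution given by Duhamel's formula. -/
theorem exists_eLpNorm_duhamel_le {p : ℝ≥0∞} (hp1 : 1 ≤ p) (hp : p ≠ ∞) (χ : Cutoff d)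
    (hκ : 0 < κ) : ∃ K : ℝ≥0∞, K ≠ ∞ ∧ ∀ (f : ℝ → Cb d), Continuous f → ∀ (t : ℝ), 0 ≤ t →
      ∀ (k : ℤ) (g₀ g : Cb d), g = lapExp χ k (κ * ((2 : ℝ) ^ k) ^ 2 * t) (Dl χ k g₀) +
        ∫ τ in (0 : ℝ)..t, lapExp χ k (κ * ((2 : ℝ) ^ k) ^ 2 * (t - τ))
          (((2 : ℝ) ^ k) ^ 2 • lapOp χ k (Dl χ k (f τ))) →
      eLpNorm g p volume ≤ K * (dec (κ * ((2 : ℝ) ^ k) ^ 2 * t) * blk χ p k g₀ +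
        wt 2 k * ∫⁻ τ in Ioc 0 t, dec (κ * ((2 : ℝ) ^ k) ^ 2 * (t - τ)) * blk χ p k (f τ)) := by
  obtain ⟨K, hK, hE⟩ := exists_eLpNorm_lapExp_le hp1 hp χ
  set L := ENNReal.ofReal (kerNorm (lap (phiT χ))) with hL
  refine ⟨K * (1 + L), ENNReal.mul_ne_top hK (by simp [hL]), fun f hf t ht0 k g₀ g hg => ?_⟩
  set a := κ * ((2 : ℝ) ^ k) ^ 2 with ha
  have ha0 : 0 ≤ a := by positivity
  set F : ℝ → Cb d := fun τ => lapExp χ k (a * (t - τ))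
        (((2 : ℝ) ^ k) ^ 2 • lapOp χ k (Dl χ k (f τ))) with hF
  have hFc : Continuous F := by
    have h1 : Continuous fun τ => lapExp χ k (a * (t - τ)) :=
      (continuous_opExp _).comp (by fun_prop)
    exact h1.clm_apply
      ((continuous_const_smul _).comp ((lapOp χ k).continuous.comp ((Dl χ k).continuous.comp hf)))
  have hFb : ∀ τ ∈ Ioc 0 t, eLpNorm (F τ) p volume ≤
      K * L * wt 2 k * (dec (a * (t - τ)) * blk χ p k (f τ)) := by
    intro τ hτ
    have e1 : F τ = (((((2 : ℝ) ^ k) ^ 2 : ℝ) : ℂ)) • lapOp χ k (lapExp χ k (a * (t - τ)) (Dl χ k (f τ))) := by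
      rw [hF]
      simp only []
      rw [map_smul, lapExp_apply_comm (Commute.refl _), Complex.coe_smul]
    rw [e1, BoundedContinuousFunction.coe_smul]
    refine (eLpNorm_const_smul (((((2 : ℝ) ^ k) ^ 2 : ℝ) : ℂ)) (lapOp χ k (lapExp χ k (a * (t - τ))
      (Dl χ k (f τ))) : Space d → ℂ) p volume).trans_le ?_
    rw [← ofReal_norm, Complex.norm_real, Real.norm_of_nonneg (by positivity), ofReal_sq_zpow]
    calc _ ≤ wt 2 k * (L * (K * dec (a * (t - τ)) * blk χ p k (f τ))) := by
          refine mul_le_mul_right ((eLpNorm_op_le hp1 hp _ _ _).trans ?_) _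
          exact mul_le_mul_right (hE k _ (mul_nonneg ha0 (by linarith [hτ.2])) _) _
      _ = _ := by ring
  have hI : ∫⁻ τ in Ioc 0 t, eLpNorm (F τ) p volume ≤
      K * L * wt 2 k * ∫⁻ τ in Ioc 0 t, dec (a * (t - τ)) * blk χ p k (f τ) := by
    rw [← lintegral_const_mul']
    · exact setLIntegral_mono' measurableSet_Ioc hFb
    · exact ENNReal.mul_ne_top (ENNReal.mul_ne_top hK ENNReal.ofReal_ne_top) (wt_ne_top _ _)
  rw [hg]
  refine (eLpNorm_add_le (aestronglyMeasurable_Cb _) (aestronglyMeasurable_Cb _) hp1).trans ?_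
  rw [intervalIntegral.integral_of_le ht0]
  calc _ ≤ K * dec (a * t) * blk χ p k g₀ +
        K * L * wt 2 k * ∫⁻ τ in Ioc 0 t, dec (a * (t - τ)) * blk χ p k (f τ) := by
        refine add_le_add (hE k _ (mul_nonneg ha0 ht0) _) (le_trans ?_ hI)
        exact eLpNorm_integral_Cb_le hp1 hp hFc
          ((hFc.integrableOn_Icc).mono_set Ioc_subset_Icc_self)
    _ ≤ K * (1 + L) * (dec (a * t) * blk χ p k g₀) + K * (1 + L) *
        (wt 2 k * ∫⁻ τ in Ioc 0 t, dec (a * (t - τ)) * blk χ p k (f τ)) := by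
        rw [mul_assoc K (dec _), mul_assoc (K * L)]
        refine add_le_add (mul_le_mul_left ?_ _) (mul_le_mul_left ?_ _)
        · exact le_mul_of_one_le_right (by simp) le_self_add
        · exact mul_le_mul_right le_add_self _
    _ = _ := by ring

theorem exists_blk_heat_le {p : ℝ≥0∞} (hp1 : 1 ≤ p) (hp : p ≠ ∞) (χ : Cutoff d) (hκ : 0 < κ) :
    ∃ K : ℝ≥0∞, K ≠ ∞ ∧ ∀ (J : Set ℝ) (v f : ℝ → Cb d), HeatOn κ J v f → Continuous v →
      Continuous f → (∀ t ∈ J, 0 ≤ t ∧ Icc 0 t ⊆ J) → ∀ t ∈ J, ∀ k : ℤ,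
      blk χ p k (v t) ≤ K * (dec (κ * ((2 : ℝ) ^ k) ^ 2 * t) * blk χ p k (v 0) +
        wt 2 k * ∫⁻ τ in J, dec (κ * ((2 : ℝ) ^ k) ^ 2 * (t - τ)) * blk χ p k (f τ)) := by
  obtain ⟨K, hK, hE⟩ := exists_eLpNorm_duhamel_le hp1 hp χ hκ
  refine ⟨K, hK, fun J v f h hv hf hJ t ht k => ?_⟩
  refine (hE f hf t (hJ t ht).1 k (v 0) _ (h.Dl_eq χ hv hf hJ ht k)).trans ?_
  gcongr
  exact Ioc_subset_Icc_self.trans (hJ t ht).2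

/-- Young's inequality in time. Bounding the decay rate by one gives the uniform estimate; its
integral `1 / (κ 2^{2k})` absorbs the weight `2^{2k}` in the other. -/
theorem exists_blk_apriori {p : ℝ≥0∞} (hp1 : 1 ≤ p) (hp : p ≠ ∞) (χ : Cutoff d) (hκ : 0 < κ) :
    ∃ K : ℝ≥0∞, K ≠ ∞ ∧ ∀ (J : Set ℝ) (v f : ℝ → Cb d), MeasurableSet J → HeatOn κ J v f →
      Continuous v → Continuous f → (∀ t ∈ J, 0 ≤ t ∧ Icc 0 t ⊆ J) → ∀ k : ℤ,
      (∀ t ∈ J, blk χ p k (v t) ≤ K * (blk χ p k (v 0) + wt 2 k * ∫⁻ τ in J, blk χ p k (f τ))) ∧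
      wt 2 k * ∫⁻ τ in J, blk χ p k (v τ) ≤
        K * (blk χ p k (v 0) + wt 2 k * ∫⁻ τ in J, blk χ p k (f τ)) := by
  obtain ⟨K, hK, hE⟩ := exists_blk_heat_le hp1 hp χ hκ
  set L := ENNReal.ofReal κ⁻¹ with hL
  refine ⟨K * (1 + L), ENNReal.mul_ne_top hK (by simp [hL]),
    fun J v f hJm h hv hf hJ k => ?_⟩
  have hE' := fun t ht => hE J v f h hv hf hJ t ht k
  set a := κ * ((2 : ℝ) ^ k) ^ 2 with ha
  have ha0 : 0 < a := by positivity
  have hmf := measurable_blk hp1 hp χ k hf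
  have haL : wt 2 k * ENNReal.ofReal a⁻¹ = L := by
    rw [← ofReal_sq_zpow, ← ENNReal.ofReal_mul (by positivity), ha, hL]
    congr 1; field_simp
  constructor
  · intro t ht
    refine (hE' t ht).trans ?_
    refine mul_le_mul' (le_mul_of_one_le_right (by simp) le_self_add) (add_le_add ?_ ?_)
    · exact mul_le_of_le_one_left (by simp) (dec_le_one _)
    · refine mul_le_mul_right (lintegral_mono fun τ => ?_) _
      exact mul_le_of_le_one_left (by simp) (dec_le_one _)
  · have hm1 : Measurable fun t => dec (a * t) := measurable_dec.comp (by fun_prop)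
    have hm2 : Measurable (Function.uncurry fun t τ => dec (a * (t - τ)) * blk χ p k (f τ)) :=
      (measurable_dec.comp (by fun_prop)).mul (hmf.comp measurable_snd)
    have h1 : ∫⁻ t in J, dec (a * t) ≤ ENNReal.ofReal a⁻¹ := by
      have := lintegral_dec_comp ha0 0
      simp only [sub_zero] at this
      exact (setLIntegral_le_lintegral _ _).trans this
    have h2 : ∫⁻ t in J, ∫⁻ τ in J, dec (a * (t - τ)) * blk χ p k (f τ) ≤
        ENNReal.ofReal a⁻¹ * ∫⁻ τ in J, blk χ p k (f τ) := by
      rw [lintegral_lintegral_swap hm2.aemeasurable, ← lintegral_const_mul _ hmf]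
      refine lintegral_mono fun τ => ?_
      have hm4 : Measurable fun t => dec (a * (t - τ)) := measurable_dec.comp (by fun_prop)
      simp only []
      rw [lintegral_mul_const _ hm4]
      refine mul_le_mul_left ((setLIntegral_le_lintegral _ _).trans ?_) _
      exact lintegral_dec_comp ha0 τ
    calc _ ≤ wt 2 k * ∫⁻ t in J, K * (dec (a * t) * blk χ p k (v 0) +
          wt 2 k * ∫⁻ τ in J, dec (a * (t - τ)) * blk χ p k (f τ)) :=
          mul_le_mul_right (setLIntegral_mono' hJm hE') _
      _ = wt 2 k * (K * ((∫⁻ t in J, dec (a * t)) * blk χ p k (v 0) +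
          wt 2 k * ∫⁻ t in J, ∫⁻ τ in J, dec (a * (t - τ)) * blk χ p k (f τ))) := by
          have hm3 : Measurable fun t => ∫⁻ τ in J, dec (a * (t - τ)) * blk χ p k (f τ) :=
            hm2.lintegral_prod_right'
          have hm5 : Measurable fun t => dec (a * t) * blk χ p k (v 0) := hm1.mul_const _
          have hm6 : Measurable fun t =>
              wt 2 k * ∫⁻ τ in J, dec (a * (t - τ)) * blk χ p k (f τ) := hm3.const_mul _
          have hm7 : Measurable fun t => dec (a * t) * blk χ p k (v 0) +
              wt 2 k * ∫⁻ τ in J, dec (a * (t - τ)) * blk χ p k (f τ) := hm5.add hm6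
          rw [lintegral_const_mul _ hm7, lintegral_add_left hm5, lintegral_mul_const _ hm1,
            lintegral_const_mul _ hm3]
      _ ≤ wt 2 k * (K * (ENNReal.ofReal a⁻¹ * blk χ p k (v 0) +
          wt 2 k * (ENNReal.ofReal a⁻¹ * ∫⁻ τ in J, blk χ p k (f τ)))) := by gcongr
      _ = K * (wt 2 k * ENNReal.ofReal a⁻¹) *
          (blk χ p k (v 0) + wt 2 k * ∫⁻ τ in J, blk χ p k (f τ)) := by ring
      _ ≤ _ := by
          rw [haL]
          gcongr
          exact le_add_self

/-- Summation over blocks. Since the third index is 1, the sum commutes with the time integral, and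
maximal regularity holds in `L¹`. -/
theorem exists_bes_apriori {p : ℝ≥0∞} (hp1 : 1 ≤ p) (hp : p ≠ ∞) (χ : Cutoff d) (hκ : 0 < κ) :
    ∃ K : ℝ≥0∞, K ≠ ∞ ∧ ∀ (σ : ℝ) (J : Set ℝ) (v f : ℝ → Cb d), MeasurableSet J → HeatOn κ J v f →
      Continuous v → Continuous f → (∀ t ∈ J, 0 ≤ t ∧ Icc 0 t ⊆ J) →
      (∀ t ∈ J, bes χ σ p (v t) ≤ K * (bes χ σ p (v 0) + ∫⁻ τ in J, bes χ (σ + 2) p (f τ))) ∧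
      ∫⁻ τ in J, bes χ (σ + 2) p (v τ) ≤
        K * (bes χ σ p (v 0) + ∫⁻ τ in J, bes χ (σ + 2) p (f τ)) := by
  obtain ⟨K, hK, hE⟩ := exists_blk_apriori hp1 hp χ hκ
  refine ⟨K, hK, fun σ J v f hJm h hv hf hJ => ?_⟩
  have hint : ∀ g : ℝ → Cb d, Continuous g → ∫⁻ τ in J, bes χ (σ + 2) p (g τ) =
      ∑' k, wt σ k * (wt 2 k * ∫⁻ τ in J, blk χ p k (g τ)) := by
    intro g hg
    unfold bes
    rw [lintegral_tsum fun k => ((measurable_blk hp1 hp χ k hg).const_mul _).aemeasurable]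
    congr 1; ext k
    rw [lintegral_const_mul _ (measurable_blk hp1 hp χ k hg), wt_add_exp, mul_assoc]
  have hR : K * (bes χ σ p (v 0) + ∫⁻ τ in J, bes χ (σ + 2) p (f τ)) =
      ∑' k, wt σ k * (K * (blk χ p k (v 0) + wt 2 k * ∫⁻ τ in J, blk χ p k (f τ))) := by
    rw [hint f hf, bes, ← ENNReal.tsum_add, ← ENNReal.tsum_mul_left]
    congr 1; ext k; ring
  rw [hR]
  refine ⟨fun t ht => ENNReal.tsum_le_tsum fun k => ?_, ?_⟩
  · exact mul_le_mul_right ((hE J v f hJm h hv hf hJ k).1 t ht) _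
  · rw [hint v hv]
    exact ENNReal.tsum_le_tsum fun k => mul_le_mul_right (hE J v f hJm h hv hf hJ k).2 _

/-! ### Propagation of vanishing low frequencies, and uniqueness for the heat equation. -/

theorem tendsto_sq_zpow_atBot : Tendsto (fun k : ℤ => ((2 : ℝ) ^ k) ^ 2) atBot (𝓝 0) := by
  have h : Tendsto (fun k : ℤ => freq k ^ 2 / (2 * Real.pi) ^ 2) atTop (𝓝 0) := by
    simpa using (tendsto_freq_atTop.pow 2).div_const ((2 * Real.pi) ^ 2)
  refine (h.comp tendsto_neg_atBot_atTop).congr fun k => ?_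
  have := Real.pi_pos
  simp only [Function.comp, freq, neg_neg]
  field_simp

/-- In the equation for `S χ k (v t)` the Laplacian contributes a factor `2^{2k}`, which tends to
zero as `k → -∞`. -/
theorem HeatOn.lowVanish (h : HeatOn κ J v f) {χ : Cutoff d} (hv : Continuous v) (hf : Continuous f)
    (h0 : LowVanish χ (v 0)) {t : ℝ} (ht : t ∈ J) : LowVanish χ (v t) := by
  have hc : Continuous fun τ => (κ : ℂ) • v τ + f τ := (hv.const_smul (κ : ℂ)).add hf
  obtain ⟨M, hM⟩ := (isCompact_uIcc (a := (0 : ℝ)) (b := t)).exists_bound_of_continuousOn hc.continuousOn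
  have hlim : Tendsto (fun k : ℤ => ‖S χ k (v 0)‖ +
      ((2 : ℝ) ^ k) ^ 2 * (kerNorm (lap (chiD χ 0)) * M * |t - 0|)) atBot (𝓝 0) := by
    simpa using h0.add (tendsto_sq_zpow_atBot.mul_const (kerNorm (lap (chiD χ 0)) * M * |t - 0|))
  refine squeeze_zero (fun k => norm_nonneg _) (fun k => ?_) hlim
  rw [S, h.op_eq hv hf ht (freq_ne k)]
  refine (norm_add_le _ _).trans (add_le_add le_rfl ?_)
  refine (intervalIntegral.norm_integral_le_of_norm_le_const
    (C := ((2 : ℝ) ^ k) ^ 2 * (kerNorm (lap (chiD χ 0)) * M)) fun τ hτ => ?_).trans (le_of_eq (by ring))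
  rw [norm_smul, Complex.norm_real, Real.norm_of_nonneg (by positivity), two_pi_div_freq]
  gcongr
  refine (norm_op_apply_le _ _ _).trans ?_
  have := hM τ (uIoc_subset_uIcc hτ)
  gcongr
  exact kerNorm_nonneg _

theorem lowVanish_zero (χ : Cutoff d) : LowVanish χ (0 : Cb d) := by
  unfold LowVanish
  simp only [map_zero, norm_zero]
  exact tendsto_const_nhds

/-- No Besov regularity is assumed. The a priori bound requires no finiteness, so zero data and zero
source force every block to vanish, and the low frequencies vanish in the limit. Any cut-off and `p
= 1` will do. -/
theorem HeatOn.eq_zero (h : HeatOn κ J v fun _ => 0) (hκ : 0 < κ) (hv : Continuous v)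
    (hJm : MeasurableSet J) (hJ : ∀ t ∈ J, 0 ≤ t ∧ Icc 0 t ⊆ J) (h0 : v 0 = 0) {t : ℝ} (ht : t ∈ J) :
    v t = 0 := by
  let χ : Cutoff d := Classical.arbitrary _
  obtain ⟨K, -, hE⟩ := exists_bes_apriori (p := 1) le_rfl (by simp) χ hκ
  obtain ⟨C, -, hC⟩ := exists_enorm_le_bes (p := 1) le_rfl (by simp) χ
  have hb0 : ∀ σ, bes χ σ 1 (0 : Cb d) = 0 := fun σ => by
    have := bes_smul χ σ 1 0 (0 : Cb d)
    simpa using this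
  have h1 := (hE (d / (1 : ℝ≥0∞).toReal) J v _ hJm h hv continuous_const hJ).1 t ht
  rw [h0, hb0] at h1
  simp only [hb0, lintegral_zero, add_zero, mul_zero, nonpos_iff_eq_zero] at h1
  have h2 := hC (v t) (h.lowVanish hv continuous_const (by rw [h0]; exact lowVanish_zero χ) ht)
  rw [h1, mul_zero] at h2
  simpa using h2

/-! ### Existence for the linear heat equation -/

theorem exists_linear_ode {E : Type*} [NormedAddCommGroup E] [NormedSpace ℝ E] [CompleteSpace E]
    (B : E →L[ℝ] E) {g : ℝ → E} (hg : Continuous g) (y₀ : E) :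
    ∃ Y : ℝ → E, Continuous Y ∧ Y 0 = y₀ ∧ ∀ t, Y t = y₀ + ∫ τ in (0 : ℝ)..t, (B (Y τ) + g τ) := by
  have hEg : Continuous fun τ => opExp B (-τ) (g τ) :=
    ((continuous_opExp B).comp continuous_neg).clm_apply hg
  set Z : ℝ → E := fun t => y₀ + ∫ τ in (0 : ℝ)..t, opExp B (-τ) (g τ) with hZ
  have hZd : ∀ t, HasDerivAt Z (opExp B (-t) (g t)) t := fun t =>
    (intervalIntegral.integral_hasDerivAt_right (hEg.intervalIntegrable _ _)
      (hEg.stronglyMeasurableAtFilter _ _) hEg.continuousAt).const_add _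
  set Y : ℝ → E := fun t => opExp B t (Z t) with hY
  have hYd : ∀ t, HasDerivAt Y (B (Y t) + g t) t := fun t => by
    have h1 := (hasDerivAt_opExp B t).clm_apply (hZd t)
    have h2 : opExp B t (opExp B (-t) (g t)) = g t := by
      have := congrArg (fun S => S (g t)) (opExp_add B t (-t))
      rw [add_neg_cancel, opExp_zero] at this
      exact this.symm
    rw [h2] at h1
    exact h1
  have hYc : Continuous Y := continuous_iff_continuousAt.2 fun t => (hYd t).continuousAt
  have hY0 : Y 0 = y₀ := by simp [hY, hZ, opExp_zero]
  refine ⟨Y, hYc, hY0, fun t => ?_⟩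
  rw [intervalIntegral.integral_eq_sub_of_hasDerivAt (fun τ _ => hYd τ)
    (((B.continuous.comp hYc).add hg).intervalIntegrable _ _), hY0]
  exact (add_sub_cancel _ _).symm

/-- The frequency window `[-n, n)`. -/
def win (n : ℕ) : Finset ℤ :=
  (Finset.range (2 * n)).map ⟨fun i : ℕ => -(n : ℤ) + i, fun a b h => by simpa using h⟩

theorem mem_win {n : ℕ} {j : ℤ} : j ∈ win n ↔ -(n : ℤ) ≤ j ∧ j < n := by
  simp only [win, Finset.mem_map, Finset.mem_range]
  constructor
  · rintro ⟨i, hi, rfl⟩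
    change -(n : ℤ) ≤ -(n : ℤ) + i ∧ -(n : ℤ) + i < n
    omega
  · rintro ⟨h1, h2⟩
    refine ⟨(j + n).toNat, by omega, ?_⟩
    change -(n : ℤ) + ((j + n).toNat : ℤ) = j
    omega

theorem tendsto_win : Tendsto win atTop atTop :=
  tendsto_atTop_finset_of_monotone
    (fun m n h j hj => by rw [mem_win] at hj ⊢; omega) fun j => ⟨j.natAbs + 1, by rw [mem_win]; omega⟩

theorem sum_win_Dl (χ : Cutoff d) (n : ℕ) (f : Cb d) :
    ∑ j ∈ win n, Dl χ j f = S χ n f - S χ (-(n : ℤ)) f := by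
  have h2 := S_eq_add_sum χ (-(n : ℤ)) (2 * n)
  rw [show (-(n : ℤ) + ((2 * n : ℕ) : ℤ)) = n by push_cast; ring] at h2
  rw [h2, add_apply, sum_apply, add_sub_cancel_left, win, Finset.sum_map]
  rfl

theorem tendsto_S_neg {χ : Cutoff d} {f : Cb d} (hf : LowVanish χ f) :
    Tendsto (fun n : ℕ => S χ (-(n : ℤ)) f) atTop (𝓝 0) :=
  tendsto_zero_iff_norm_tendsto_zero.2
    (hf.comp (tendsto_neg_atTop_atBot.comp tendsto_natCast_atTop_atTop))

/-- Summability provides a limit; evaluating windowed partial sums pointwise identifies it as `f`.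
-/
theorem hasSum_Dl {χ : Cutoff d} {f : Cb d} (hf : LowVanish χ f) (hs : Summable fun j => Dl χ j f) :
    HasSum (fun j => Dl χ j f) f := by
  obtain ⟨g, hg⟩ := hs
  have h1 : Tendsto (fun n => ∑ j ∈ win n, Dl χ j f) atTop (𝓝 g) := hg.comp tendsto_win
  have hgf : g = f := by
    ext x
    have h2 : Tendsto (fun n => (∑ j ∈ win n, Dl χ j f) x) atTop (𝓝 (g x)) :=
      ((continuous_eval_const x : Continuous fun g : Cb d => g x).tendsto g).comp h1
    have h3 : Tendsto (fun n : ℕ => S χ n f x - S χ (-(n : ℤ)) f x) atTop (𝓝 (f x - 0)) := by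
      refine ((tendsto_S_apply χ f x).comp tendsto_natCast_atTop_atTop).sub ?_
      exact ((continuous_eval_const x : Continuous fun g : Cb d => g x).tendsto 0).comp
        (tendsto_S_neg hf)
    rw [sub_zero] at h3
    refine tendsto_nhds_unique h2 (h3.congr fun n => ?_)
    rw [sum_win_Dl]; rfl
  rwa [hgf] at hg

theorem tendsto_toDist_of_bounded {u : ℕ → Cb d} {f : Cb d} {M : ℝ} (hM : ∀ n, ‖u n‖ ≤ M)
    (h : ∀ x, Tendsto (fun n => u n x) atTop (𝓝 (f x))) (φ : 𝓢(Space d, ℂ)) :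
    Tendsto (fun n => toDist (u n) φ) atTop (𝓝 (toDist f φ)) := by
  simp only [toDist_apply]
  refine tendsto_integral_of_dominated_convergence (fun y => ‖φ y‖ * M)
    (fun n => (integrable_schwartz_mul φ (u n)).aestronglyMeasurable)
    (φ.integrable.norm.mul_const _) (fun n => Eventually.of_forall fun y => ?_)
    (Eventually.of_forall fun y => (h _).const_mul _)
  rw [norm_mul]
  gcongr
  exact ((u n).norm_coe_le_norm _).trans (hM n)

theorem tendsto_toDist {u : ℕ → Cb d} {f : Cb d} (h : Tendsto u atTop (𝓝 f)) (φ : 𝓢(Space d, ℂ)) :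
    Tendsto (fun n => toDist (u n) φ) atTop (𝓝 (toDist f φ)) :=
  ((pairCLM φ).continuous.tendsto f).comp h

theorem continuous_toDist {u : ℝ → Cb d} (h : Continuous u) (φ : 𝓢(Space d, ℂ)) :
    Continuous fun t => toDist (u t) φ :=
  (pairCLM φ).continuous.comp h

/-- The low frequencies of `f` are not assumed to vanish: tested against a Laplacian, `S_{-n} f`
carries a factor `2^{-2n}`. -/
theorem tendsto_toDist_win (χ : Cutoff d) (f : Cb d) (φ : 𝓢(Space d, ℂ)) :
    Tendsto (fun n => toDist (∑ j ∈ win n, Dl χ j f) (Δ φ)) atTop (𝓝 (toDist f (Δ φ))) := by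
  have h1 : Tendsto (fun n : ℕ => toDist (S χ n f) (Δ φ)) atTop (𝓝 (toDist f (Δ φ))) :=
    tendsto_toDist_of_bounded (fun n => norm_S_apply_le χ n f)
      (fun x => (tendsto_S_apply χ f x).comp tendsto_natCast_atTop_atTop) _
  have h2 : Tendsto (fun n : ℕ => toDist (S χ (-(n : ℤ)) f) (Δ φ)) atTop (𝓝 0) := by
    refine squeeze_zero_norm (a := fun n : ℕ => ((2 : ℝ) ^ (-(n : ℤ))) ^ 2 *
      ((∫ x, ‖φ x‖) * (kerNorm (lap (chiD χ 0)) * ‖f‖))) (fun n => ?_) ?_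
    · rw [S, toDist_op_laplacian (freq_ne _), two_pi_div_freq, toDist_smul]
      change ‖_ * toDist (op (freq (-(n : ℤ))) (lap (chiD χ 0)) f) φ‖ ≤ _
      rw [norm_mul, Complex.norm_real, Real.norm_of_nonneg (by positivity)]
      gcongr
      exact (norm_toDist_apply_le _ _).trans (mul_le_mul_of_nonneg_left (norm_op_apply_le _ _ _)
        (integral_nonneg fun _ => norm_nonneg _))
    · have h3 := (tendsto_sq_zpow_atBot.comp
        (tendsto_neg_atTop_atBot.comp (tendsto_natCast_atTop_atTop (R := ℤ)))).mul_const
        ((∫ x, ‖φ x‖) * (kerNorm (lap (chiD χ 0)) * ‖f‖))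
      rw [zero_mul] at h3
      exact h3
  have h3 := h1.sub h2
  rw [sub_zero] at h3
  refine h3.congr fun n => ?_
  rw [sum_win_Dl, toDist_sub]; rfl

theorem norm_sum_win_Dl_le (χ : Cutoff d) (n : ℕ) (f : Cb d) :
    ‖∑ j ∈ win n, Dl χ j f‖ ≤ 2 * (kerNorm (chiD χ 0) * ‖f‖) := by
  rw [sum_win_Dl]
  refine (norm_sub_le _ _).trans ?_
  have := norm_S_apply_le χ n f
  have := norm_S_apply_le χ (-(n : ℤ)) f
  linarith

variable {κ : ℝ}

/-- A frequency-localized solution of the heat equation. -/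
theorem exists_block_solution (κ : ℝ) (χ : Cutoff d) (j : ℤ) (v₀ : Cb d) {f : ℝ → Cb d}
    (hf : Continuous f) : ∃ w : ℝ → Cb d, Continuous w ∧ w 0 = Dl χ j v₀ ∧
      (∀ t, op (freq j) (phiT χ) (w t) = w t) ∧
      HeatOn κ univ w (fun τ => Dl χ j (f τ)) ∧
      ∀ t, 0 ≤ t → w t = lapExp χ j (κ * ((2 : ℝ) ^ j) ^ 2 * t) (Dl χ j v₀) +
        ∫ τ in (0 : ℝ)..t, lapExp χ j (κ * ((2 : ℝ) ^ j) ^ 2 * (t - τ))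
          (((2 : ℝ) ^ j) ^ 2 • lapOp χ j (Dl χ j (f τ))) := by
  have hg : Continuous fun τ => ((2 : ℝ) ^ j) ^ 2 • lapOp χ j (f τ) :=
    (continuous_const_smul _).comp ((lapOp χ j).continuous.comp hf)
  -- The equation is solved with the localized generator but unlocalized data; applying the block
  -- operator, which commutes with the generator, gives the required curve.
  obtain ⟨Y, hYc, hY0, hY⟩ := exists_linear_ode ((κ * ((2 : ℝ) ^ j) ^ 2) • lapOpR χ j) hg v₀
  have hG : Continuous fun τ =>
      ((κ * ((2 : ℝ) ^ j) ^ 2) • lapOpR χ j) (Y τ) + ((2 : ℝ) ^ j) ^ 2 • lapOp χ j (f τ) :=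
    (((κ * ((2 : ℝ) ^ j) ^ 2) • lapOpR χ j).continuous.comp hYc).add hg
  have hcomm : ∀ g : Cb d, Dl χ j (lapOp χ j g) = lapOp χ j (Dl χ j g) := fun g =>
    (congrArg (fun T => T g) (lapOp_commute_Dl χ j).eq).symm
  have hsm : ∀ (r : ℝ) (g : Cb d), Dl χ j (r • g) = r • Dl χ j g := fun r g =>
    (Dl χ j).map_smul_of_tower r g
  have hsm' : ∀ (r : ℝ) (g : Cb d), lapOp χ j (r • g) = r • lapOp χ j g := fun r g =>
    (lapOp χ j).map_smul_of_tower r g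
  have hw : ∀ t, Dl χ j (Y t) = Dl χ j v₀ + ∫ τ in (0 : ℝ)..t,
      (((κ * ((2 : ℝ) ^ j) ^ 2) • lapOpR χ j) (Dl χ j (Y τ)) +
        ((2 : ℝ) ^ j) ^ 2 • lapOp χ j (Dl χ j (f τ))) := by
    intro t
    rw [hY t, map_add]
    congr 1
    refine ((Dl χ j).intervalIntegral_comp_comm (hG.intervalIntegrable 0 t)).symm.trans ?_
    refine intervalIntegral.integral_congr fun τ _ => ?_
    change Dl χ j ((κ * ((2 : ℝ) ^ j) ^ 2) • lapOp χ j (Y τ) + ((2 : ℝ) ^ j) ^ 2 • lapOp χ j (f τ)) =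
      (κ * ((2 : ℝ) ^ j) ^ 2) • lapOp χ j (Dl χ j (Y τ)) + ((2 : ℝ) ^ j) ^ 2 • lapOp χ j (Dl χ j (f τ))
    rw [map_add, hsm, hsm, hcomm, hcomm]
  have hwc : Continuous fun t => Dl χ j (Y t) := (Dl χ j).continuous.comp hYc
  have hg' : Continuous fun τ => ((2 : ℝ) ^ j) ^ 2 • lapOp χ j (Dl χ j (f τ)) :=
    (continuous_const_smul _).comp ((lapOp χ j).continuous.comp ((Dl χ j).continuous.comp hf))
  refine ⟨fun t => Dl χ j (Y t), hwc, by simp only [hY0], fun t => opT_Dl χ j _, ?_, ?_⟩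
  · intro t _ φ
    simp only [hY0]
    have hG' : Continuous fun τ => ((κ * ((2 : ℝ) ^ j) ^ 2) • lapOpR χ j) (Dl χ j (Y τ)) +
        ((2 : ℝ) ^ j) ^ 2 • lapOp χ j (Dl χ j (f τ)) :=
      (((κ * ((2 : ℝ) ^ j) ^ 2) • lapOpR χ j).continuous.comp hwc).add hg'
    rw [hw t, toDist_add]
    refine congrArg (toDist (Dl χ j v₀) φ + ·) ?_
    refine ((pairCLM φ).intervalIntegral_comp_comm (hG'.intervalIntegrable 0 t)).symm.trans ?_
    refine intervalIntegral.integral_congr fun τ _ => ?_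
    have e : (κ : ℂ) • Dl χ j (Y τ) + Dl χ j (f τ) = Dl χ j ((κ : ℂ) • Y τ + f τ) := by
      rw [map_add, map_smul]
    simp only [e]
    rw [Dl, toDist_op_laplacian (freq_ne j), two_pi_div_freq, ← lapOp_Dl]
    refine congrArg (fun g => toDist g φ) ?_
    change (κ * ((2 : ℝ) ^ j) ^ 2) • lapOp χ j (Dl χ j (Y τ)) +
      ((2 : ℝ) ^ j) ^ 2 • lapOp χ j (Dl χ j (f τ)) = _
    rw [Complex.coe_smul, Complex.coe_smul, map_add, map_add, hsm, hsm', smul_add, smul_smul, mul_comm]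
  · intro t ht
    have h1 := duhamel (B := (κ * ((2 : ℝ) ^ j) ^ 2) • lapOpR χ j) hwc hg' ht
      (fun τ _ => by rw [hw τ, hY0])
    simp only [opExp_smul, hY0] at h1
    exact h1

/-- Each block is solved separately. Bernstein's inequality turns the `L^p` bounds into summable
supremum bounds, uniform in time, so the solutions add up to a continuous curve. The weak equation
passes to the limit along frequency windows by dominated convergence. -/
theorem exists_heat_solution {p : ℝ≥0∞} (hp1 : 1 ≤ p) (hp : p ≠ ∞) (χ : Cutoff d) (hκ : 0 < κ)
    {v₀ : Cb d} (h0 : LowVanish χ v₀) (hb : bes χ (d / p.toReal) p v₀ ≠ ∞) {f : ℝ → Cb d}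
    (hf : Continuous f) (hbf : ∫⁻ τ in Ici 0, bes χ (d / p.toReal + 2) p (f τ) ≠ ∞) :
    ∃ v : ℝ → Cb d, Continuous v ∧ v 0 = v₀ ∧ HeatOn κ (Ici 0) v f := by
  set s := d / p.toReal with hs
  obtain ⟨K, hK, hE⟩ := exists_eLpNorm_duhamel_le hp1 hp χ hκ
  obtain ⟨C, hC, hB⟩ := exists_enorm_op_freq_le hp1 hp (phiT χ)
  choose w hwc hw0 hwT hwH hwD using fun j => exists_block_solution κ χ j v₀ hf
  set M : ℤ → ℝ≥0∞ := fun j =>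
    C * K * (wt s j * (blk χ p j v₀ + wt 2 j * ∫⁻ τ in Ici 0, blk χ p j (f τ))) with hM
  have hMsum : ∑' j, M j ≠ ∞ := by
    have h1 : ∑' j, wt s j * (wt 2 j * ∫⁻ τ in Ici 0, blk χ p j (f τ)) =
        ∫⁻ τ in Ici 0, bes χ (s + 2) p (f τ) := by
      unfold bes
      rw [lintegral_tsum fun k => ((measurable_blk hp1 hp χ k hf).const_mul _).aemeasurable]
      congr 1; ext k
      rw [lintegral_const_mul _ (measurable_blk hp1 hp χ k hf), wt_add_exp, mul_assoc]
    have h2 : ∑' j, M j = C * K * (bes χ s p v₀ + ∫⁻ τ in Ici 0, bes χ (s + 2) p (f τ)) := by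
      rw [hM, ENNReal.tsum_mul_left, ← h1, bes, ← ENNReal.tsum_add]
      simp only [mul_add]
    rw [h2]
    exact ENNReal.mul_ne_top (ENNReal.mul_ne_top hC hK) (ENNReal.add_ne_top.2 ⟨hb, hbf⟩)
  have hMt : ∀ j, M j ≠ ∞ := fun j => ne_top_of_le_ne_top hMsum (ENNReal.le_tsum j)
  have hwM : ∀ j t, 0 ≤ t → ‖w j t‖ ≤ (M j).toReal := by
    intro j t ht
    have h1 : ‖w j t‖ₑ ≤ M j := by
      rw [← hwT j t]
      refine (hB j (w j t)).trans ?_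
      calc _ ≤ C * wt s j * (K * (dec (κ * ((2 : ℝ) ^ j) ^ 2 * t) * blk χ p j v₀ + wt 2 j *
            ∫⁻ τ in Ioc 0 t, dec (κ * ((2 : ℝ) ^ j) ^ 2 * (t - τ)) * blk χ p j (f τ))) :=
            mul_le_mul_right (hE f hf t ht j v₀ _ (hwD j t ht)) _
        _ ≤ C * wt s j * (K * (blk χ p j v₀ + wt 2 j * ∫⁻ τ in Ici 0, blk χ p j (f τ))) := by
            refine mul_le_mul_right (mul_le_mul_right (add_le_add ?_ (mul_le_mul_right ?_ _)) _) _
            · exact mul_le_of_le_one_left (by simp) (dec_le_one _)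
            · refine (lintegral_mono fun τ => ?_).trans
                (lintegral_mono_set (Ioc_subset_Icc_self.trans Icc_subset_Ici_self))
              exact mul_le_of_le_one_left (by simp) (dec_le_one _)
        _ = _ := by rw [hM]; ring
    rw [← ofReal_norm] at h1
    exact (ENNReal.ofReal_le_iff_le_toReal (hMt j)).1 h1
  have hMs : Summable fun j => (M j).toReal := ENNReal.summable_toReal hMsum
  -- The bounds hold only for nonnegative times; freezing the curves before zero makes the series
  -- converge uniformly on the whole line.
  set v : ℝ → Cb d := fun t => ∑' j, w j (max t 0) with hv
  have hvc : Continuous v :=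
    continuous_tsum (fun j => (hwc j).comp (continuous_id.max continuous_const)) hMs
      fun j t => hwM j _ (le_max_right _ _)
  have hvs : ∀ t, 0 ≤ t → HasSum (fun j => w j t) (v t) := by
    intro t ht
    simp only [hv, max_eq_left ht]
    exact (hMs.of_norm_bounded fun j => hwM j t ht).hasSum
  have hv0 : v 0 = v₀ := by
    have h1 := hvs 0 le_rfl
    simp only [hw0] at h1
    exact h1.unique (hasSum_Dl h0 h1.summable)
  refine ⟨v, hvc, hv0, fun t ht φ => ?_⟩
  have ht' : 0 ≤ t := ht
  have hlim : ∀ τ, 0 ≤ τ → Tendsto (fun n => ∑ j ∈ win n, w j τ) atTop (𝓝 (v τ)) :=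
    fun τ hτ => (hvs τ hτ).comp tendsto_win
  have hsumT : ∀ (n : ℕ) (g : ℤ → Cb d) (ψ : 𝓢(Space d, ℂ)),
      toDist (∑ j ∈ win n, g j) ψ = ∑ j ∈ win n, toDist (g j) ψ := fun n g ψ =>
    map_sum (pairCLM ψ) g (win n)
  have heq : ∀ n, toDist (∑ j ∈ win n, w j t) φ = toDist (∑ j ∈ win n, w j 0) φ +
      ∫ τ in (0 : ℝ)..t, toDist ((κ : ℂ) • (∑ j ∈ win n, w j τ) + ∑ j ∈ win n, Dl χ j (f τ)) (Δ φ) := by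
    intro n
    have h1 : ∀ τ, toDist ((κ : ℂ) • (∑ j ∈ win n, w j τ) + ∑ j ∈ win n, Dl χ j (f τ)) (Δ φ) =
        ∑ j ∈ win n, toDist ((κ : ℂ) • w j τ + Dl χ j (f τ)) (Δ φ) := fun τ => by
      rw [← hsumT, Finset.sum_add_distrib, Finset.smul_sum]
    simp only [h1]
    have h2 : ∀ j ∈ win n, IntervalIntegrable
        (fun τ => toDist ((κ : ℂ) • w j τ + Dl χ j (f τ)) (Δ φ)) volume 0 t := fun j _ =>
      Continuous.intervalIntegrable
      (continuous_toDist (((hwc j).const_smul (κ : ℂ)).add ((Dl χ j).continuous.comp hf)) _) _ _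
    rw [intervalIntegral.integral_finsetSum h2]
    rw [hsumT, hsumT, ← Finset.sum_add_distrib]
    exact Finset.sum_congr rfl fun j _ => hwH j t (mem_univ _) φ
  refine tendsto_nhds_unique (tendsto_toDist (hlim t ht') φ) ?_
  simp only [heq]
  refine (tendsto_toDist (hlim 0 le_rfl) φ).add ?_
  obtain ⟨F, hF⟩ := (isCompact_uIcc (a := (0 : ℝ)) (b := t)).exists_bound_of_continuousOn hf.continuousOn
  refine intervalIntegral.tendsto_integral_filter_of_dominated_convergence
    (fun _ => (∫ x, ‖(Δ φ) x‖) * (‖(κ : ℂ)‖ * (∑' j, (M j).toReal) + 2 * (kerNorm (chiD χ 0) * F)))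
    (Eventually.of_forall fun n => ?_) (Eventually.of_forall fun n => Eventually.of_forall fun τ hτ => ?_)
    intervalIntegrable_const (Eventually.of_forall fun τ hτ => ?_)
  · refine Continuous.aestronglyMeasurable (continuous_toDist ?_ _)
    refine ((continuous_finsetSum _ fun j _ => hwc j).const_smul (κ : ℂ)).add
      (continuous_finsetSum _ fun j _ => (Dl χ j).continuous.comp hf)
  · rw [uIoc_of_le ht'] at hτ
    refine (norm_toDist_apply_le _ _).trans (mul_le_mul_of_nonneg_left ?_
      (integral_nonneg fun _ => norm_nonneg _))
    refine (norm_add_le _ _).trans (add_le_add ?_ ?_)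
    · rw [norm_smul]
      gcongr
      refine (norm_sum_le _ _).trans ((Finset.sum_le_sum fun j _ => hwM j τ hτ.1.le).trans ?_)
      exact hMs.sum_le_tsum _ fun j _ => ENNReal.toReal_nonneg
    · refine (norm_sum_win_Dl_le χ n _).trans ?_
      have := hF τ (by rw [uIcc_of_le ht']; exact Ioc_subset_Icc_self hτ)
      gcongr
      exact kerNorm_nonneg _
  · rw [uIoc_of_le ht'] at hτ
    simp only [toDist_add, toDist_smul]
    exact ((tendsto_toDist (hlim τ hτ.1.le) (Δ φ)).const_smul (κ : ℂ)).add
      (tendsto_toDist_win χ (f τ) φ)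

/-! ### Stability of the heat equation -/

section HeatOn

variable {κ : ℝ} {J : Set ℝ} {v w f g : ℝ → Cb d}

theorem HeatOn.congr (h : HeatOn κ J v f) (hJ : ∀ t ∈ J, 0 ≤ t) (hv : ∀ t, 0 ≤ t → v t = w t)
    (hf : ∀ t, 0 ≤ t → f t = g t) : HeatOn κ J w g := by
  intro t ht φ
  rw [← hv t (hJ t ht), ← hv 0 le_rfl, h t ht φ]
  congr 1
  refine intervalIntegral.integral_congr fun τ hτ => ?_
  rw [uIcc_of_le (hJ t ht)] at hτ
  simp only [hv τ hτ.1, hf τ hτ.1]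

theorem HeatOn.sub (h : HeatOn κ J v f) (h' : HeatOn κ J w g) (hv : Continuous v) (hw : Continuous w)
    (hf : Continuous f) (hg : Continuous g) : HeatOn κ J (fun t => v t - w t) fun t => f t - g t := by
  intro t ht φ
  have h1 : IntervalIntegrable (fun τ => toDist ((κ : ℂ) • v τ + f τ) (Δ φ)) volume 0 t :=
    (continuous_toDist ((hv.const_smul (κ : ℂ)).add hf) (Δ φ)).intervalIntegrable 0 t
  have h2 : IntervalIntegrable (fun τ => toDist ((κ : ℂ) • w τ + g τ) (Δ φ)) volume 0 t :=
    (continuous_toDist ((hw.const_smul (κ : ℂ)).add hg) (Δ φ)).intervalIntegrable 0 t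
  have e : ∀ τ, toDist ((κ : ℂ) • (v τ - w τ) + (f τ - g τ)) (Δ φ) =
      toDist ((κ : ℂ) • v τ + f τ) (Δ φ) - toDist ((κ : ℂ) • w τ + g τ) (Δ φ) := fun τ => by
    rw [show (κ : ℂ) • (v τ - w τ) + (f τ - g τ) = ((κ : ℂ) • v τ + f τ) - ((κ : ℂ) • w τ + g τ) by
      rw [smul_sub]; abel, toDist_sub]
    rfl
  simp only [e]
  rw [intervalIntegral.integral_sub h1 h2, toDist_sub, toDist_sub, sub_apply, sub_apply, h t ht φ,
    h' t ht φ]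
  ring

/-- The complex conjugate of a Schwartz function. -/
def conjS (φ : 𝓢(Space d, ℂ)) : 𝓢(Space d, ℂ) :=
  SchwartzMap.postcompCLM (Complex.conjCLE : ℂ →L[ℝ] ℂ) φ

theorem conjS_apply (φ : 𝓢(Space d, ℂ)) (x : Space d) : conjS φ x = starRingEnd ℂ (φ x) := rfl

theorem laplacian_conjS (φ : 𝓢(Space d, ℂ)) : Δ (conjS φ) = conjS (Δ φ) := by
  ext x
  rw [conjS_apply, SchwartzMap.laplacian_apply, SchwartzMap.laplacian_apply]
  exact (φ.smooth 2).contDiffAt.laplacian_CLM_comp_left (l := (Complex.conjCLE : ℂ →L[ℝ] ℂ))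

theorem toDist_star (f : Cb d) (φ : 𝓢(Space d, ℂ)) :
    toDist (star f) φ = starRingEnd ℂ (toDist f (conjS φ)) := by
  rw [toDist_apply, toDist_apply, ← integral_conj]
  congr 1; ext x
  simp [conjS_apply]

theorem HeatOn.star (h : HeatOn κ J v f) : HeatOn κ J (fun t => Star.star (v t)) fun t => Star.star (f t) := by
  intro t ht φ
  have e : ∀ τ, toDist ((κ : ℂ) • Star.star (v τ) + Star.star (f τ)) (Δ φ) =
      starRingEnd ℂ (toDist ((κ : ℂ) • v τ + f τ) (Δ (conjS φ))) := fun τ => by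
    rw [laplacian_conjS, ← toDist_star]
    congr 2
    rw [star_add, star_smul]
    simp
  simp only [e]
  rw [toDist_star, toDist_star, h t ht, map_add]
  congr 1
  simp only [intervalIntegral, map_sub, integral_conj]

/-- The solution and its conjugate satisfy the same equation with the same data, so uniqueness makes
the solution real. -/
theorem HeatOn.star_eq (h : HeatOn κ J v f) (hκ : 0 < κ) (hv : Continuous v) (hf : Continuous f)
    (hJm : MeasurableSet J) (hJ : ∀ t ∈ J, 0 ≤ t ∧ Icc 0 t ⊆ J) (h0 : Star.star (v 0) = v 0)
    (hfs : ∀ t, Star.star (f t) = f t) {t : ℝ} (ht : t ∈ J) : Star.star (v t) = v t := by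
  have h1 := h.sub h.star hv (continuous_star.comp hv) hf (continuous_star.comp hf)
  simp only [hfs, sub_self] at h1
  have h2 := h1.eq_zero hκ (hv.sub (continuous_star.comp hv)) hJm hJ (by simp [h0]) ht
  exact (sub_eq_zero.1 h2).symm

end HeatOn

/-! ### Auxiliary facts for the fixed point. -/

theorem star_ser (c : ℕ → ℝ) {u : Cb d} (hu : star u = u) : star (ser c u) = ser c u := by
  rw [ser, tsum_star]
  congr 1; ext1 k
  rw [star_smul, star_pow, hu]
  simp

theorem bes_zero (χ : Cutoff d) (σ : ℝ) (p : ℝ≥0∞) : bes χ σ p (0 : Cb d) = 0 := by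
  have := bes_smul χ σ p 0 (0 : Cb d)
  simpa using this

theorem exists_pos_mul_le {C η : ℝ≥0∞} (hC : C ≠ ∞) (hη : η ≠ 0) (hη' : η ≠ ∞) :
    ∃ ε : ℝ≥0∞, ε ≠ 0 ∧ ε ≠ ∞ ∧ C * ε ≤ η := by
  refine ⟨η / (C + 1), ?_, ?_, ?_⟩
  · exact ENNReal.div_ne_zero.2 ⟨hη, by simp [hC]⟩
  · exact ENNReal.div_ne_top hη' (by simp)
  · calc C * (η / (C + 1)) ≤ (C + 1) * (η / (C + 1)) := by gcongr; exact le_self_add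
      _ ≤ η := ENNReal.mul_div_le

theorem continuous_comp_of_enorm_lipschitz {G : Cb d → Cb d} {m L : ℝ≥0∞} (hL : L ≠ ∞)
    (h : ∀ u v, ‖u‖ₑ ≤ m → ‖v‖ₑ ≤ m → ‖G u - G v‖ₑ ≤ L * ‖u - v‖ₑ) {U : ℝ → Cb d} (hU : Continuous U)
    (hm : ∀ τ, ‖U τ‖ₑ ≤ m) : Continuous fun τ => G (U τ) := by
  refine continuous_iff_continuousAt.2 fun τ => ?_
  rw [ContinuousAt, tendsto_iff_edist_tendsto_0]
  have h1 := (tendsto_iff_edist_tendsto_0.1 (hU.tendsto τ))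
  have h2 := ENNReal.Tendsto.const_mul (a := L) h1 (Or.inr hL)
  rw [mul_zero] at h2
  refine tendsto_of_tendsto_of_tendsto_of_le_of_le tendsto_const_nhds h2 (fun _ => by simp)
    fun t => ?_
  simp only [edist_eq_enorm_sub]
  exact h _ _ (hm t) (hm τ)

/-! ### The contraction estimate -/

/-- The constants `m` and `L` make the source term `ser c` Lipschitz on the ball of radius `m`, and
the solution map of the heat equation with this source contracting. -/
structure Contraction (χ : Cutoff d) (p : ℝ≥0∞) (κ : ℝ) (c : ℕ → ℝ) (m L : ℝ≥0∞) : Prop where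
  ne_zero : m ≠ 0
  ne_top : m ≠ ∞
  lip_ne_top : L ≠ ∞
  enorm_ser_sub_le : ∀ u v : Cb d, ‖u‖ₑ ≤ m → ‖v‖ₑ ≤ m → ‖ser c u - ser c v‖ₑ ≤ L * ‖u - v‖ₑ
  bes_ser_le : ∀ u : Cb d, ‖u‖ₑ ≤ m →
    bes χ (d / p.toReal + 2) p (ser c u) ≤ L * bes χ (d / p.toReal + 2) p u
  contract : ∀ (J : Set ℝ) (U V w z : ℝ → Cb d) (D : ℝ≥0∞), MeasurableSet J →
    (∀ t ∈ J, 0 ≤ t ∧ Icc 0 t ⊆ J) → Continuous U → Continuous V → Continuous w → Continuous z →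
    (∀ τ, ‖U τ‖ₑ ≤ m) → (∀ τ, ‖V τ‖ₑ ≤ m) →
    ∫⁻ τ in J, bes χ (d / p.toReal + 2) p (U τ) ≤ m →
    ∫⁻ τ in J, bes χ (d / p.toReal + 2) p (V τ) ≤ m →
    HeatOn κ J w (fun τ => ser c (U τ)) → HeatOn κ J z (fun τ => ser c (V τ)) → w 0 = z 0 →
    (∀ τ ∈ J, ‖U τ - V τ‖ₑ ≤ D) →
    (∀ t ∈ J, ‖w t - z t‖ₑ ≤
      4⁻¹ * (D + ∫⁻ τ in J, bes χ (d / p.toReal + 2) p (U τ - V τ))) ∧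
    ∫⁻ τ in J, bes χ (d / p.toReal + 2) p (w τ - z τ) ≤
      4⁻¹ * (D + ∫⁻ τ in J, bes χ (d / p.toReal + 2) p (U τ - V τ))

/-- With `D` and `E` the supremum and `L¹(B^{d/p+2})` distances of `U` and `V`, the sources differ
in `L¹(B^{d/p+2})` by at most a constant times `m (D + E)`. The heat estimate returns this bound for
`w - z`, and the embedding transfers it to the supremum norm. -/
theorem exists_contraction {p : ℝ≥0∞} (hp1 : 1 ≤ p) (hp : p ≠ ∞) (χ : Cutoff d) {κ : ℝ} (hκ : 0 < κ)
    {c : ℕ → ℝ} {K R : ℝ} (hR : 0 < R) (hc : ∀ k, |c k| ≤ K * R ^ k) :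
    ∃ m L : ℝ≥0∞, m < ENNReal.ofReal R⁻¹ ∧ Contraction χ p κ c m L := by
  set s := d / p.toReal with hs
  have hs0 : 0 ≤ s := by positivity
  obtain ⟨Ke, hKe, hemb⟩ := exists_enorm_le_bes hp1 hp χ
  obtain ⟨Ka, hKa, hap⟩ := exists_bes_apriori hp1 hp χ hκ
  obtain ⟨M₀, Cf, hM0, hMR, hCf, hser⟩ :=
    exists_ser_bounds hp1 hp χ (σ := s + 2) (by linarith) hR hc
  have hη : (4⁻¹ : ℝ≥0∞) ≠ 0 := by simp
  -- The factor `1 + Ke` treats both conclusions at once: `Ke` serves the supremum norm through the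
  -- embedding and `1` the Besov norm.
  obtain ⟨ε, hε0, hεt, hε⟩ := exists_pos_mul_le (C := (1 + Ke) * (Ka * (Cf * 2))) (η := 4⁻¹)
    (by
      refine ENNReal.mul_ne_top (ENNReal.add_ne_top.2 ⟨by simp, hKe⟩) (ENNReal.mul_ne_top hKa
        (ENNReal.mul_ne_top hCf (by simp)))) hη (by simp)
  set m := min ε (ENNReal.ofReal M₀) with hm
  have hmM : m ≤ ENNReal.ofReal M₀ := min_le_right _ _
  have hmt : m ≠ ∞ := ne_top_of_le_ne_top hεt (min_le_left _ _)
  have hm4 : (1 + Ke) * (Ka * (Cf * 2)) * m ≤ 4⁻¹ :=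
    (mul_le_mul_right (min_le_left _ _) _).trans hε
  have hLt : Cf * (2 * m) ≠ ∞ := ENNReal.mul_ne_top hCf (ENNReal.mul_ne_top (by simp) hmt)
  have hlip : ∀ u v : Cb d, ‖u‖ₑ ≤ m → ‖v‖ₑ ≤ m →
      ‖ser c u - ser c v‖ₑ ≤ Cf * (2 * m) * ‖u - v‖ₑ := fun u v hu hv =>
    (hser m hmM u v hu hv).1.trans (by
      rw [← mul_assoc]
      gcongr
      exact le_mul_of_one_le_left (by simp) (by norm_num))
  refine ⟨m, Cf * (2 * m), ?_, ?_, hmt, hLt, hlip, ?_, ?_⟩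
  · exact hmM.trans_lt ((ENNReal.ofReal_lt_ofReal_iff (by positivity)).2 hMR)
  · simp only [hm, ne_eq, ← pos_iff_ne_zero, lt_min_iff, ENNReal.ofReal_pos]
    exact ⟨pos_iff_ne_zero.2 hε0, hM0⟩
  · intro u hu
    have h1 := (hser m hmM u 0 hu (by simp)).2
    rw [ser_zero, sub_zero, sub_zero, bes_zero, add_zero] at h1
    refine h1.trans ?_
    calc _ ≤ Cf * (m * bes χ (s + 2) p u + m * bes χ (s + 2) p u) := by gcongr
      _ = _ := by ring
  intro J U V w z D hJm hJ hU hV hw hz hUm hVm hUi hVi hHw hHz h0 hD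
  set E := ∫⁻ τ in J, bes χ (s + 2) p (U τ - V τ) with hE
  have hcU := continuous_comp_of_enorm_lipschitz hLt hlip hU hUm
  have hcV := continuous_comp_of_enorm_lipschitz hLt hlip hV hVm
  have hH := hHw.sub hHz hw hz hcU hcV
  have hwz : Continuous fun t => w t - z t := hw.sub hz
  have hmU := measurable_bes hp1 hp χ (s + 2) hU
  have hmV := measurable_bes hp1 hp χ (s + 2) hV
  have hmUV : Measurable fun τ => bes χ (s + 2) p (U τ - V τ) :=
    measurable_bes hp1 hp χ (s + 2) (hU.sub hV)
  have hmS : Measurable fun τ => bes χ (s + 2) p (U τ) + bes χ (s + 2) p (V τ) := hmU.add hmV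
  have hmUV' : Measurable fun τ => m * bes χ (s + 2) p (U τ - V τ) := hmUV.const_mul m
  have hmT : Measurable fun τ => m * bes χ (s + 2) p (U τ - V τ) +
      D * (bes χ (s + 2) p (U τ) + bes χ (s + 2) p (V τ)) := hmUV'.add (hmS.const_mul D)
  have hsrc : ∫⁻ τ in J, bes χ (s + 2) p (ser c (U τ) - ser c (V τ)) ≤ Cf * 2 * m * (D + E) := by
    calc _ ≤ ∫⁻ τ in J, Cf * (m * bes χ (s + 2) p (U τ - V τ) +
          D * (bes χ (s + 2) p (U τ) + bes χ (s + 2) p (V τ))) := by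
          refine setLIntegral_mono' hJm fun τ hτ => ?_
          refine (hser m hmM _ _ (hUm τ) (hVm τ)).2.trans ?_
          gcongr
          exact hD τ hτ
      _ = Cf * (m * E + D * ((∫⁻ τ in J, bes χ (s + 2) p (U τ)) + ∫⁻ τ in J, bes χ (s + 2) p (V τ))) := by
          rw [lintegral_const_mul _ hmT, lintegral_add_left hmUV', lintegral_const_mul _ hmUV,
            lintegral_const_mul _ hmS, lintegral_add_left hmU]
      _ ≤ Cf * (m * E + D * (m + m)) := by gcongr
      _ ≤ Cf * (m * E + D * (m + m)) + Cf * (m * E) := le_self_add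
      _ = _ := by ring
  obtain ⟨ha1, ha2⟩ := hap s J _ _ hJm hH hwz (hcU.sub hcV) hJ
  simp only [h0, sub_self, bes_zero, zero_add] at ha1 ha2
  have hfin : ∀ B : ℝ≥0∞, B ≤ Ka * ∫⁻ τ in J, bes χ (s + 2) p (ser c (U τ) - ser c (V τ)) →
      (1 + Ke) * B ≤ 4⁻¹ * (D + E) := fun B hB => by
    calc _ ≤ (1 + Ke) * (Ka * (Cf * 2 * m * (D + E))) := by
          gcongr
          exact hB.trans (mul_le_mul_right hsrc _)
      _ = (1 + Ke) * (Ka * (Cf * 2)) * m * (D + E) := by ring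
      _ ≤ _ := by gcongr
  have h1 : ∀ B : ℝ≥0∞, B ≤ (1 + Ke) * B := fun B => le_mul_of_one_le_left (by simp) le_self_add
  refine ⟨fun t ht => ?_, (h1 _).trans (hfin _ ha2)⟩
  have hlv : LowVanish χ (w t - z t) :=
    hH.lowVanish hwz (hcU.sub hcV) (by simp only [h0, sub_self]; exact lowVanish_zero χ) ht
  refine (hemb _ hlv).trans (le_trans ?_ (hfin _ (ha1 t ht)))
  gcongr
  exact le_add_self

/-! ### Uniqueness, existence and time regularity -/

section Contraction

variable {p : ℝ≥0∞} {χ : Cutoff d} {κ : ℝ} {c : ℕ → ℝ} {m L : ℝ≥0∞}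

theorem Contraction.continuous_ser (h : Contraction χ p κ c m L) {U : ℝ → Cb d} (hU : Continuous U)
    (hm : ∀ τ, ‖U τ‖ₑ ≤ m) : Continuous fun τ => ser c (U τ) :=
  continuous_comp_of_enorm_lipschitz h.lip_ne_top h.enorm_ser_sub_le hU hm

/-- Applied to the two solutions themselves, the contraction bounds both `D` and `E` by `(D + E) /
4`. Both are finite thanks to the smallness assumptions, so both vanish. -/
theorem Contraction.eq_of_heatOn (h : Contraction χ p κ c m L) (hp1 : 1 ≤ p) (hp : p ≠ ∞) {J : Set ℝ}
    {u v : ℝ → Cb d} (hJm : MeasurableSet J)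
    (hJ : ∀ t ∈ J, 0 ≤ t ∧ Icc 0 t ⊆ J) (hu : Continuous u) (hv : Continuous v)
    (hum : ∀ τ, ‖u τ‖ₑ ≤ m) (hvm : ∀ τ, ‖v τ‖ₑ ≤ m)
    (hui : ∫⁻ τ in J, bes χ (d / p.toReal + 2) p (u τ) ≤ m)
    (hvi : ∫⁻ τ in J, bes χ (d / p.toReal + 2) p (v τ) ≤ m)
    (hHu : HeatOn κ J u fun τ => ser c (u τ)) (hHv : HeatOn κ J v fun τ => ser c (v τ))
    (h0 : u 0 = v 0) {t : ℝ} (ht : t ∈ J) : u t = v t := by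
  set D := ⨆ τ ∈ J, ‖u τ - v τ‖ₑ with hD
  set E := ∫⁻ τ in J, bes χ (d / p.toReal + 2) p (u τ - v τ) with hE
  have hDle : ∀ τ ∈ J, ‖u τ - v τ‖ₑ ≤ D := fun τ hτ =>
    le_iSup₂ (f := fun τ (_ : τ ∈ J) => ‖u τ - v τ‖ₑ) τ hτ
  have h2m : m + m ≠ ∞ := ENNReal.add_ne_top.2 ⟨h.ne_top, h.ne_top⟩
  have hDt : D ≠ ∞ := ne_top_of_le_ne_top h2m <| iSup₂_le fun τ _ =>
    (enorm_sub_le).trans (add_le_add (hum τ) (hvm τ))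
  have hEt : E ≠ ∞ := by
    refine ne_top_of_le_ne_top h2m ?_
    calc E ≤ ∫⁻ τ in J, (bes χ (d / p.toReal + 2) p (u τ) + bes χ (d / p.toReal + 2) p (v τ)) :=
          lintegral_mono fun τ => bes_sub_le hp1 χ _ _ _
      _ = _ := lintegral_add_left (measurable_bes hp1 hp χ _ hu) _
      _ ≤ _ := add_le_add hui hvi
  obtain ⟨h1, h2⟩ := h.contract J u v u v D hJm hJ hu hv hu hv hum hvm hui hvi hHu hHv h0 hDle
  have h3 : D ≤ 4⁻¹ * (D + E) := iSup₂_le h1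
  rw [← hE] at h2
  clear_value D E
  lift D to NNReal using hDt
  lift E to NNReal using hEt
  have e4 : (4⁻¹ : ℝ≥0∞) = ((4⁻¹ : NNReal) : ℝ≥0∞) := by simp
  rw [e4] at h2 h3
  norm_cast at h2 h3
  have h4 : (D : ℝ) ≤ 4⁻¹ * (D + E) := by exact_mod_cast h3
  have h5 : (E : ℝ) ≤ 4⁻¹ * (D + E) := by exact_mod_cast h2
  have h6 : D = 0 := by
    rw [← NNReal.coe_eq_zero]
    linarith [D.coe_nonneg, E.coe_nonneg]
  have h7 := hDle t ht
  rw [h6] at h7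
  exact sub_eq_zero.1 (by simpa using h7)

theorem four_inv_mul_add_self (x : ℝ≥0∞) : 4⁻¹ * (x + x) = x / 2 := by
  have h4 : (4⁻¹ : ℝ≥0∞) = 2⁻¹ * 2⁻¹ := by
    rw [← ENNReal.mul_inv (by simp) (by simp)]
    norm_num
  rw [h4, mul_assoc, ← mul_two, mul_comm x 2, ← mul_assoc 2⁻¹ 2 x,
    ENNReal.inv_mul_cancel (by simp) (by simp), one_mul, ENNReal.div_eq_inv_mul]

/-- Real-valued functions of time which are small in the solution space. -/
structure SmallCurve (χ : Cutoff d) (p a : ℝ≥0∞) (U : ℝ → Cb d) : Prop where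
  cont : Continuous U
  enorm_le : ∀ τ, ‖U τ‖ₑ ≤ a
  lintegral_le : ∫⁻ τ in Ici 0, bes χ (d / p.toReal + 2) p (U τ) ≤ a
  star_eq : ∀ τ, star (U τ) = U τ

theorem SmallCurve.zero (χ : Cutoff d) (p a : ℝ≥0∞) : SmallCurve χ p a fun _ => 0 where
  cont := continuous_const
  enorm_le _ := by simp
  lintegral_le := by simp [bes_zero]
  star_eq _ := star_zero _

theorem Ici_downward : ∀ t ∈ Ici (0 : ℝ), 0 ≤ t ∧ Icc 0 t ⊆ Ici 0 :=
  fun _ ht => ⟨ht, fun _ hx => hx.1⟩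

theorem Contraction.lintegral_bes_ser_le (h : Contraction χ p κ c m L) (hp1 : 1 ≤ p) (hp : p ≠ ∞)
    {J : Set ℝ} {U : ℝ → Cb d} (hU : Continuous U) (hUm : ∀ τ, ‖U τ‖ₑ ≤ m) :
    ∫⁻ τ in J, bes χ (d / p.toReal + 2) p (ser c (U τ)) ≤
      L * ∫⁻ τ in J, bes χ (d / p.toReal + 2) p (U τ) := by
  rw [← lintegral_const_mul _ (measurable_bes hp1 hp χ _ hU)]
  exact lintegral_mono fun τ => h.bes_ser_le _ (hUm τ)

/-- The heat equation with a source has a solution which is frozen for negative times. -/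
theorem exists_clamped_heat_solution (hp1 : 1 ≤ p) (hp : p ≠ ∞) (χ : Cutoff d) (hκ : 0 < κ)
    {v₀ : Cb d} (h0 : LowVanish χ v₀) (hb : bes χ (d / p.toReal) p v₀ ≠ ∞) {f : ℝ → Cb d}
    (hf : Continuous f) (hbf : ∫⁻ τ in Ici 0, bes χ (d / p.toReal + 2) p (f τ) ≠ ∞) :
    ∃ v : ℝ → Cb d, Continuous v ∧ v 0 = v₀ ∧ HeatOn κ (Ici 0) v f ∧ ∀ τ, v τ = v (max τ 0) := by
  obtain ⟨v, hv, hv0, hH⟩ := exists_heat_solution hp1 hp χ hκ h0 hb hf hbf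
  refine ⟨fun τ => v (max τ 0), hv.comp (by fun_prop), by simpa using hv0,
    hH.congr (fun t ht => ht) (fun t ht => by rw [max_eq_left ht]) fun _ _ => rfl, fun τ => by simp⟩

/-- The new curve is compared with the free evolution `z` of the data, which is the image of the
zero curve. Contraction gives `m / 4` for the difference and smallness of the data gives `m / 4` for
`z`. -/
theorem Contraction.exists_step (h : Contraction χ p κ c m L) (hp1 : 1 ≤ p) (hp : p ≠ ∞)
    (hκ : 0 < κ) : ∃ ε : ℝ≥0∞, ε ≠ 0 ∧ ε ≠ ∞ ∧ ∀ u₀ : Cb d, star u₀ = u₀ → LowVanish χ u₀ →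
      bes χ (d / p.toReal) p u₀ ≤ ε → ∀ U : ℝ → Cb d, SmallCurve χ p (m / 2) U →
      ∃ W : ℝ → Cb d, SmallCurve χ p (m / 2) W ∧ W 0 = u₀ ∧ HeatOn κ (Ici 0) W fun τ => ser c (U τ) := by
  obtain ⟨Ke, hKe, hemb⟩ := exists_enorm_le_bes hp1 hp χ
  obtain ⟨Ka, hKa, hap⟩ := exists_bes_apriori hp1 hp χ hκ
  have hm2 : m / 2 / 2 ≠ 0 := by simp [h.ne_zero]
  have hm2t : m / 2 / 2 ≠ ∞ := ENNReal.div_ne_top (ENNReal.div_ne_top h.ne_top (by simp)) (by simp)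
  obtain ⟨ε, hε0, hεt, hε⟩ := exists_pos_mul_le (C := (1 + Ke) * Ka) (η := m / 2 / 2)
    (ENNReal.mul_ne_top (ENNReal.add_ne_top.2 ⟨by simp, hKe⟩) hKa) hm2 hm2t
  refine ⟨ε, hε0, hεt, fun u₀ hs hlv hb U hU => ?_⟩
  have hbt := ne_top_of_le_ne_top hεt hb
  have ham : m / 2 ≤ m := ENNReal.half_le_self
  have hUm : ∀ τ, ‖U τ‖ₑ ≤ m := fun τ => (hU.enorm_le τ).trans ham
  have hcU := h.continuous_ser hU.cont hUm
  obtain ⟨z, hz, hz0, hHz, hzc⟩ := exists_clamped_heat_solution hp1 hp χ hκ hlv hbt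
    (f := fun _ => 0) continuous_const (by simp [bes_zero])
  obtain ⟨w, hw, hw0, hHw, hwc⟩ := exists_clamped_heat_solution hp1 hp χ hκ hlv hbt hcU
    (ne_top_of_le_ne_top (ENNReal.mul_ne_top h.lip_ne_top h.ne_top)
      ((h.lintegral_bes_ser_le hp1 hp hU.cont hUm).trans
        (mul_le_mul_right (hU.lintegral_le.trans ham) _)))
  have hHz' : HeatOn κ (Ici 0) z fun _ => ser c 0 := by simpa only [ser_zero] using hHz
  obtain ⟨h1, h2⟩ := h.contract (Ici 0) U (fun _ => 0) w z (m / 2) measurableSet_Ici Ici_downward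
    hU.cont continuous_const hw hz hUm (by simp) (hU.lintegral_le.trans ham) (by simp [bes_zero]) hHw
    hHz' (hw0.trans hz0.symm) (fun τ _ => by simpa using hU.enorm_le τ)
  simp only [sub_zero] at h1 h2
  have hq : 4⁻¹ * (m / 2 + ∫⁻ τ in Ici 0, bes χ (d / p.toReal + 2) p (U τ)) ≤ m / 2 / 2 :=
    (mul_le_mul_right (add_le_add le_rfl hU.lintegral_le) _).trans_eq (four_inv_mul_add_self _)
  obtain ⟨h3, h4⟩ := hap (d / p.toReal) (Ici 0) _ _ measurableSet_Ici hHz hz continuous_const Ici_downward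
  simp only [bes_zero, lintegral_zero, add_zero, hz0] at h3 h4
  have h5 : ∀ B : ℝ≥0∞, B ≤ Ka * bes χ (d / p.toReal) p u₀ → (1 + Ke) * B ≤ m / 2 / 2 := fun B hB =>
    calc (1 + Ke) * B ≤ (1 + Ke) * (Ka * ε) := by gcongr; exact hB.trans (mul_le_mul_right hb _)
      _ = (1 + Ke) * Ka * ε := by ring
      _ ≤ _ := hε
  refine ⟨w, ⟨hw, fun τ => ?_, ?_, fun τ => ?_⟩, hw0, hHw⟩
  · rw [hwc τ]
    have ht : max τ 0 ∈ Ici (0 : ℝ) := mem_Ici.2 (le_max_right _ _)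
    set t := max τ 0
    have e1 : w t = (w t - z t) + z t := by abel
    rw [e1, ← ENNReal.add_halves (m / 2)]
    refine (enorm_add_le _ _).trans (add_le_add ((h1 t ht).trans hq) ?_)
    refine (hemb _ (hHz.lowVanish hz continuous_const (by rwa [hz0]) ht)).trans ?_
    exact (mul_le_mul_left le_add_self _).trans (h5 _ (h3 t ht))
  · have hmwz : Measurable fun τ => bes χ (d / p.toReal + 2) p (w τ - z τ) :=
      measurable_bes hp1 hp χ _ (hw.sub hz)
    calc _ ≤ ∫⁻ τ in Ici 0, (bes χ (d / p.toReal + 2) p (w τ - z τ) +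
          bes χ (d / p.toReal + 2) p (z τ)) := by
          refine lintegral_mono fun τ => ?_
          have := bes_add_le hp1 χ (d / p.toReal + 2) (w τ - z τ) (z τ)
          rwa [sub_add_cancel] at this
      _ = _ := lintegral_add_left hmwz _
      _ ≤ m / 2 / 2 + m / 2 / 2 := add_le_add (h2.trans hq)
          ((le_mul_of_one_le_left (by simp) le_self_add).trans (h5 _ h4))
      _ = _ := ENNReal.add_halves _
  · rw [hwc τ]
    exact hHw.star_eq hκ hw hcU measurableSet_Ici Ici_downward (by rw [hw0, hs])
      (fun t => star_ser c (hU.star_eq t)) (mem_Ici.2 (le_max_right _ _))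

end Contraction

section Contraction

variable {p : ℝ≥0∞} {χ : Cutoff d} {κ : ℝ} {c : ℕ → ℝ} {m L : ℝ≥0∞}

/-- The uniform bound `m` dominates the integrands, so pointwise convergence in time is enough to
pass to the limit in the weak equation. -/
theorem HeatOn.of_tendsto {J : Set ℝ} {U W : ℕ → ℝ → Cb d} {u : ℝ → Cb d}
    (h : Contraction χ p κ c m L)
    (hU : ∀ n, Continuous (U n)) (hW : ∀ n, Continuous (W n)) (hUm : ∀ n τ, ‖U n τ‖ₑ ≤ m)
    (hWm : ∀ n τ, ‖W n τ‖ₑ ≤ m) (hum : ∀ τ, ‖u τ‖ₑ ≤ m)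
    (hUu : ∀ τ, Tendsto (fun n => U n τ) atTop (𝓝 (u τ)))
    (hWu : ∀ τ, Tendsto (fun n => W n τ) atTop (𝓝 (u τ)))
    (hH : ∀ n, HeatOn κ J (W n) fun τ => ser c (U n τ)) : HeatOn κ J u fun τ => ser c (u τ) := by
  intro t ht φ
  have hser : ∀ τ, Tendsto (fun n => ser c (U n τ)) atTop (𝓝 (ser c (u τ))) := fun τ => by
    rw [tendsto_iff_edist_tendsto_0]
    have h2 := ENNReal.Tendsto.const_mul (a := L) (tendsto_iff_edist_tendsto_0.1 (hUu τ))
      (Or.inr h.lip_ne_top)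
    rw [mul_zero] at h2
    refine tendsto_of_tendsto_of_tendsto_of_le_of_le tendsto_const_nhds h2 (fun _ => by simp)
      fun n => ?_
    simp only [edist_eq_enorm_sub]
    exact h.enorm_ser_sub_le _ _ (hUm n τ) (hum τ)
  have hnorm : ∀ {g : Cb d} {M : ℝ≥0∞}, M ≠ ∞ → ‖g‖ₑ ≤ M → ‖g‖ ≤ M.toReal := fun hM hg => by
    have := ENNReal.toReal_mono hM hg
    simpa using this
  have hbd : ∀ n τ, ‖toDist ((κ : ℂ) • W n τ + ser c (U n τ)) (Δ φ)‖ ≤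
      (∫ x, ‖(Δ φ) x‖) * (|κ| * m.toReal + (L * m).toReal) := fun n τ => by
    refine (norm_toDist_apply_le _ _).trans (mul_le_mul_of_nonneg_left ?_ (by positivity))
    refine (norm_add_le _ _).trans (add_le_add ?_ ?_)
    · rw [norm_smul, Complex.norm_real]
      exact mul_le_mul_of_nonneg_left (hnorm h.ne_top (hWm n τ)) (norm_nonneg _)
    · refine hnorm (ENNReal.mul_ne_top h.lip_ne_top h.ne_top) ?_
      have := h.enorm_ser_sub_le (U n τ) 0 (hUm n τ) (by simp)
      rw [ser_zero, sub_zero, sub_zero] at this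
      exact this.trans (mul_le_mul_right (hUm n τ) _)
  have hlim : Tendsto (fun n => toDist (W n 0) φ +
      ∫ τ in (0 : ℝ)..t, toDist ((κ : ℂ) • W n τ + ser c (U n τ)) (Δ φ)) atTop
      (𝓝 (toDist (u 0) φ + ∫ τ in (0 : ℝ)..t, toDist ((κ : ℂ) • u τ + ser c (u τ)) (Δ φ))) := by
    refine (tendsto_toDist (hWu 0) φ).add ?_
    refine intervalIntegral.tendsto_integral_filter_of_dominated_convergence
      (fun _ => (∫ x, ‖(Δ φ) x‖) * (|κ| * m.toReal + (L * m).toReal)) ?_ ?_ ?_ ?_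
    · refine Eventually.of_forall fun n => Continuous.aestronglyMeasurable ?_
      exact continuous_toDist (((hW n).const_smul (κ : ℂ)).add (h.continuous_ser (hU n) (hUm n))) (Δ φ)
    · exact Eventually.of_forall fun n => ae_of_all _ fun τ _ => hbd n τ
    · exact intervalIntegrable_const
    · exact ae_of_all _ fun τ _ => tendsto_toDist (((hWu τ).const_smul (κ : ℂ)).add (hser τ)) (Δ φ)
  refine tendsto_nhds_unique (tendsto_toDist (hWu t) φ) (hlim.congr fun n => ?_)
  exact (hH n t ht φ).symm

/-- Picard iteration from zero in the ball of radius `m / 2`, where consecutive differences halve at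
each step. The supremum bound `m / 2` passes to the limit and leaves the margin used for uniqueness;
the `L¹` bound is the full geometric sum `m`. -/
theorem Contraction.exists_fixedPoint (h : Contraction χ p κ c m L) (hp1 : 1 ≤ p) (hp : p ≠ ∞)
    (hκ : 0 < κ) : ∃ ε : ℝ≥0∞, ε ≠ 0 ∧ ε ≠ ∞ ∧ ∀ u₀ : Cb d, star u₀ = u₀ → LowVanish χ u₀ →
      bes χ (d / p.toReal) p u₀ ≤ ε → ∃ u : ℝ → Cb d, SmallCurve χ p m u ∧
        (∀ τ, ‖u τ‖ₑ ≤ m / 2) ∧ u 0 = u₀ ∧ HeatOn κ (Ici 0) u fun τ => ser c (u τ) := by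
  obtain ⟨ε, hε0, hεt, hstep⟩ := h.exists_step hp1 hp hκ
  refine ⟨ε, hε0, hεt, fun u₀ hs hlv hb => ?_⟩
  choose! next hnext hnext0 hnextH using hstep u₀ hs hlv hb
  set a := m / 2 with ha
  have ham : a ≤ m := ENNReal.half_le_self
  have hat : a ≠ ∞ := ne_top_of_le_ne_top h.ne_top ham
  set q : ℕ → ℝ → Cb d := fun n => next^[n] fun _ => 0 with hq
  have hq1 : ∀ n, q (n + 1) = next (q n) := fun n => Function.iterate_succ_apply' _ _ _
  have hqs : ∀ n, SmallCurve χ p a (q n) := fun n => by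
    induction n with
    | zero => exact SmallCurve.zero χ p a
    | succ n ih => rw [hq1]; exact hnext _ ih
  have hqH : ∀ n, HeatOn κ (Ici 0) (q (n + 1)) fun τ => ser c (q n τ) := fun n => by
    rw [hq1]; exact hnextH _ (hqs n)
  have hq0 : ∀ n, q (n + 1) 0 = u₀ := fun n => by rw [hq1]; exact hnext0 _ (hqs n)
  have hqm : ∀ n τ, ‖q n τ‖ₑ ≤ m := fun n τ => ((hqs n).enorm_le τ).trans ham
  have hdiff : ∀ n, (∀ τ ∈ Ici (0 : ℝ), ‖q (n + 1) τ - q n τ‖ₑ ≤ a * (2⁻¹) ^ n) ∧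
      ∫⁻ τ in Ici 0, bes χ (d / p.toReal + 2) p (q (n + 1) τ - q n τ) ≤ a * (2⁻¹) ^ n := by
    intro n
    induction n with
    | zero =>
      have e : ∀ τ, q 0 τ = 0 := fun τ => rfl
      simp only [e, sub_zero, pow_zero, mul_one]
      exact ⟨fun τ _ => (hqs 1).enorm_le τ, (hqs 1).lintegral_le⟩
    | succ n ih =>
      obtain ⟨h1, h2⟩ := h.contract (Ici 0) (q (n + 1)) (q n) (q (n + 2)) (q (n + 1)) _
        measurableSet_Ici Ici_downward (hqs _).cont (hqs _).cont (hqs _).cont (hqs _).cont (hqm _) (hqm _)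
        ((hqs _).lintegral_le.trans ham) ((hqs _).lintegral_le.trans ham) (hqH _) (hqH _)
        ((hq0 _).trans (hq0 _).symm) ih.1
      have e : ∀ B : ℝ≥0∞, B ≤ a * (2⁻¹) ^ n → 4⁻¹ * (a * (2⁻¹) ^ n + B) ≤ a * (2⁻¹) ^ (n + 1) :=
        fun B hB => (mul_le_mul_right (add_le_add le_rfl hB) _).trans_eq (by
          rw [four_inv_mul_add_self, pow_succ, ← mul_assoc, ENNReal.div_eq_inv_mul, mul_comm])
      exact ⟨fun τ hτ => (h1 τ hτ).trans (e _ ih.2), h2.trans (e _ ih.2)⟩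
  -- Differences are controlled only for nonnegative times, so the iterates are frozen before zero
  -- to obtain uniform convergence on the line.
  set r : ℕ → ℝ → Cb d := fun n τ => q n (max τ 0) with hr
  have hrc : ∀ n, Continuous (r n) := fun n => (hqs n).cont.comp (by fun_prop)
  have hreq : ∀ n τ, 0 ≤ τ → q n τ = r n τ := fun n τ hτ => by rw [hr]; simp only [max_eq_left hτ]
  have hrd : ∀ n τ, ‖r (n + 1) τ - r n τ‖ₑ ≤ a * (2⁻¹) ^ n := fun n τ =>
    (hdiff n).1 _ (mem_Ici.2 (le_max_right _ _))
  have hrm : ∀ n τ, ‖r n τ‖ₑ ≤ a := fun n τ => (hqs n).enorm_le _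
  have hrb : ∀ n τ, ‖r (n + 1) τ - r n τ‖ ≤ a.toReal * (1 / 2) ^ n := fun n τ => by
    have := ENNReal.toReal_mono (ENNReal.mul_ne_top hat (by simp)) (hrd n τ)
    simpa using this
  have hsum : Summable fun n : ℕ => a.toReal * (1 / 2 : ℝ) ^ n := summable_geometric_two.mul_left _
  set u : ℝ → Cb d := fun τ => ∑' n, (r (n + 1) τ - r n τ) with hu
  have huc : Continuous u := continuous_tsum (fun n => (hrc (n + 1)).sub (hrc n)) hsum hrb
  have hus : ∀ τ, HasSum (fun n => r (n + 1) τ - r n τ) (u τ) := fun τ =>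
    (Summable.of_norm_bounded hsum fun n => hrb n τ).hasSum
  have hlim : ∀ τ, Tendsto (fun n => r n τ) atTop (𝓝 (u τ)) := fun τ => by
    have h1 := (hus τ).tendsto_sum_nat
    simp only [Finset.sum_range_sub (fun n => r n τ)] at h1
    have e : r 0 τ = 0 := rfl
    simpa only [e, sub_zero] using h1
  have hlim1 : ∀ τ, Tendsto (fun n => r (n + 1) τ) atTop (𝓝 (u τ)) := fun τ =>
    (hlim τ).comp (tendsto_add_atTop_nat 1)
  have hua : ∀ τ, ‖u τ‖ₑ ≤ a := fun τ =>
    le_of_tendsto' ((continuous_enorm.tendsto _).comp (hlim τ)) fun n => hrm n τ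
  have hum : ∀ τ, ‖u τ‖ₑ ≤ m := fun τ => (hua τ).trans ham
  refine ⟨u, ⟨huc, hum, ?_, fun τ => ?_⟩, hua, ?_, ?_⟩
  · calc ∫⁻ τ in Ici 0, bes χ (d / p.toReal + 2) p (u τ)
        ≤ ∫⁻ τ in Ici 0, ∑' n, bes χ (d / p.toReal + 2) p (r (n + 1) τ - r n τ) :=
          lintegral_mono fun τ => bes_hasSum_le hp1 χ _ (hus τ)
      _ = ∑' n, ∫⁻ τ in Ici 0, bes χ (d / p.toReal + 2) p (r (n + 1) τ - r n τ) := by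
          refine lintegral_tsum fun n => Measurable.aemeasurable ?_
          exact measurable_bes hp1 hp χ _ ((hrc (n + 1)).sub (hrc n))
      _ ≤ ∑' n : ℕ, a * (2⁻¹) ^ n := by
          refine ENNReal.tsum_le_tsum fun n => le_trans (le_of_eq ?_) (hdiff n).2
          refine setLIntegral_congr_fun measurableSet_Ici fun τ hτ => ?_
          simp only [hreq _ τ hτ]
      _ = m := by
          rw [ENNReal.tsum_mul_left, ENNReal.tsum_geometric, ENNReal.one_sub_inv_two, inv_inv, ha,
            ENNReal.div_mul_cancel (by simp) (by simp)]
  · refine tendsto_nhds_unique ((continuous_star.tendsto _).comp (hlim τ)) ((hlim τ).congr fun n => ?_)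
    exact ((hqs n).star_eq _).symm
  · refine tendsto_nhds_unique (hlim1 0) (tendsto_const_nhds.congr fun n => ?_)
    rw [← hreq _ 0 le_rfl, hq0]
  · refine HeatOn.of_tendsto h hrc (fun n => hrc (n + 1)) (fun n τ => (hrm n τ).trans ham)
      (fun n τ => (hrm _ τ).trans ham) hum hlim hlim1 fun n => ?_
    exact (hqH n).congr (fun t ht => ht) (fun t ht => hreq _ t ht) fun t ht => by rw [hreq _ t ht]

end Contraction

/-! ### Continuity in time with values in the Besov space. -/

/-- Continuity in time of a block of a solution. -/
theorem HeatOn.tendsto_blk {p : ℝ≥0∞} (hp1 : 1 ≤ p) (hp : p ≠ ∞) {χ : Cutoff d} {κ : ℝ}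
    {v f : ℝ → Cb d} (h : HeatOn κ (Ici 0) v f) (hv : Continuous v) (hf : Continuous f) (k : ℤ)
    (hbv : ∫⁻ τ in Ici 0, blk χ p k (v τ) ≠ ∞) (hbf : ∫⁻ τ in Ici 0, blk χ p k (f τ) ≠ ∞)
    {t : ℝ} (ht : 0 ≤ t) :
    Tendsto (fun τ => blk χ p k (v τ - v t)) (𝓝[Ici 0] t) (𝓝 0) := by
  set g : ℝ → Cb d := fun r => (κ : ℂ) • v r + f r with hg
  have hgc : Continuous g := (hv.const_smul (κ : ℂ)).add hf
  set G : ℝ → Cb d := fun r => ((((2 : ℝ) ^ k) ^ 2 : ℝ) : ℂ) • lapOp χ k (Dl χ k (g r)) with hG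
  have hGc : Continuous G := (continuous_const_smul _).comp
    ((lapOp χ k).continuous.comp ((Dl χ k).continuous.comp hgc))
  have heq : ∀ τ, 0 ≤ τ → Dl χ k (v τ - v t) = ∫ r in t..τ, G r := fun τ hτ => by
    have e : ∀ τ, 0 ≤ τ → Dl χ k (v τ) = Dl χ k (v 0) + ∫ r in (0 : ℝ)..τ, G r := fun τ hτ => by
      have h2 := h.op_eq hv hf (mem_Ici.2 hτ) (freq_ne k) (phi χ)
      rw [two_pi_div_freq] at h2
      refine h2.trans ?_
      simp only [hG, lapOp_Dl]
      rfl
    rw [map_sub, e τ hτ, e t ht, add_sub_add_left_eq_sub, intervalIntegral.integral_interval_sub_left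
      (hGc.intervalIntegrable _ _) (hGc.intervalIntegrable _ _)]
  set C : ℝ≥0∞ := ‖((((2 : ℝ) ^ k) ^ 2 : ℝ) : ℂ)‖ₑ * ENNReal.ofReal (kerNorm (lap (phiT χ))) with hC
  have hCt : C ≠ ∞ := ENNReal.mul_ne_top (by simp) (by simp)
  have hGle : ∀ r, eLpNorm (G r) p volume ≤ C * (‖(κ : ℂ)‖ₑ * blk χ p k (v r) + blk χ p k (f r)) := by
    intro r
    have e1 : eLpNorm (G r) p volume =
        ‖((((2 : ℝ) ^ k) ^ 2 : ℝ) : ℂ)‖ₑ * eLpNorm (lapOp χ k (Dl χ k (g r))) p volume :=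
      eLpNorm_const_smul _ _ _ _
    rw [e1, hC, mul_assoc]
    refine mul_le_mul_right ((eLpNorm_op_le hp1 hp _ _ _).trans (mul_le_mul_right ?_ _)) _
    refine (blk_add_le hp1 χ k _ _).trans (add_le_add (le_of_eq ?_) le_rfl)
    simp only [blk, map_smul]
    exact eLpNorm_const_smul _ _ _ _
  have hmv := measurable_blk hp1 hp χ k hv
  set F : ℝ → ℝ≥0∞ := fun r => C * (‖(κ : ℂ)‖ₑ * blk χ p k (v r) + blk χ p k (f r)) with hF
  have hFt : ∫⁻ r in Ici 0, F r ≠ ∞ := by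
    have hm1 : Measurable fun r => ‖(κ : ℂ)‖ₑ * blk χ p k (v r) := hmv.const_mul _
    rw [lintegral_const_mul' _ _ hCt, lintegral_add_left hm1, lintegral_const_mul _ hmv]
    exact ENNReal.mul_ne_top hCt (ENNReal.add_ne_top.2 ⟨ENNReal.mul_ne_top (by simp) hbv, hbf⟩)
  -- The increment of the block is the integral of its time derivative between `t` and `τ`. The
  -- `L^p` norm of that derivative is integrable in time, so absolute continuity of the integral
  -- concludes.
  have hle : ∀ τ ∈ Ici (0 : ℝ), blk χ p k (v τ - v t) ≤ ∫⁻ r in uIoc t τ, F r ∂(volume.restrict (Ici 0)) := by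
    intro τ hτ
    have hsub : uIoc t τ ⊆ Ici 0 := fun x hx =>
      ((le_min ht hτ).trans_lt hx.1).le
    rw [Measure.restrict_restrict measurableSet_uIoc, inter_eq_left.2 hsub]
    have e2 : blk χ p k (v τ - v t) = eLpNorm (∫ r in uIoc t τ, G r : Cb d) p volume := by
      rw [blk, heq τ hτ, intervalIntegral.intervalIntegral_eq_integral_uIoc]
      split_ifs
      · rw [one_smul]
      · rw [neg_one_smul]
        exact eLpNorm_neg _ _ _
    rw [e2]
    refine (eLpNorm_integral_Cb_le hp1 hp hGc (hGc.integrableOn_uIoc)).trans ?_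
    exact lintegral_mono hGle
  refine tendsto_of_tendsto_of_tendsto_of_le_of_le' tendsto_const_nhds
    (tendsto_setLIntegral_zero hFt (s := fun τ => uIoc t τ) ?_) (Eventually.of_forall fun _ => by simp)
    (by filter_upwards [self_mem_nhdsWithin] with τ hτ using hle τ hτ)
  have h3 : Tendsto (fun τ => ENNReal.ofReal |τ - t|) (𝓝[Ici 0] t) (𝓝 0) := by
    have : Continuous fun τ => ENNReal.ofReal |τ - t| :=
      ENNReal.continuous_ofReal.comp (by fun_prop)
    have := this.tendsto t
    simp only [sub_self, abs_zero, ENNReal.ofReal_zero] at this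
    exact this.mono_left nhdsWithin_le_nhds
  refine tendsto_of_tendsto_of_tendsto_of_le_of_le tendsto_const_nhds h3 (fun _ => by simp) fun τ => ?_
  refine (Measure.restrict_apply_le _ _).trans (le_of_eq ?_)
  exact Real.volume_uIoc

/-- Dominated convergence for the counting measure on dyadic indices: each block is continuous, and
the a priori estimate gives a summable bound independent of time. -/
theorem HeatOn.tendsto_bes {p : ℝ≥0∞} (hp1 : 1 ≤ p) (hp : p ≠ ∞) {χ : Cutoff d} {κ : ℝ} (hκ : 0 < κ)
    {v f : ℝ → Cb d} (h : HeatOn κ (Ici 0) v f) (hv : Continuous v) (hf : Continuous f) {σ : ℝ}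
    (h0 : bes χ σ p (v 0) ≠ ∞) (hbf : ∫⁻ τ in Ici 0, bes χ (σ + 2) p (f τ) ≠ ∞)
    {t : ℝ} (ht : 0 ≤ t) :
    Tendsto (fun τ => bes χ σ p (v τ - v t)) (𝓝[Ici 0] t) (𝓝 0) := by
  obtain ⟨K, hK, hap⟩ := exists_blk_apriori hp1 hp χ hκ
  have hap := hap (Ici 0) v f measurableSet_Ici h hv hf Ici_downward
  set X : ℤ → ℝ≥0∞ := fun k => K * (blk χ p k (v 0) + wt 2 k * ∫⁻ τ in Ici 0, blk χ p k (f τ)) with hX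
  have hmf := fun k => measurable_blk hp1 hp χ k hf
  have hXsum : ∑' k, wt σ k * X k ≠ ∞ := by
    have e : ∀ k, wt σ k * X k = K * (wt σ k * blk χ p k (v 0)) +
        K * ∫⁻ τ in Ici 0, wt (σ + 2) k * blk χ p k (f τ) := fun k => by
      rw [lintegral_const_mul _ (hmf k), wt_add_exp, hX]
      ring
    simp only [e]
    rw [ENNReal.tsum_add, ENNReal.tsum_mul_left, ENNReal.tsum_mul_left,
      ← lintegral_tsum fun k => ((hmf k).const_mul _).aemeasurable]
    exact ENNReal.add_ne_top.2 ⟨ENNReal.mul_ne_top hK h0, ENNReal.mul_ne_top hK hbf⟩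
  have hXk : ∀ k, X k ≠ ∞ := fun k hk => by
    have := ENNReal.ne_top_of_tsum_ne_top hXsum k
    rw [hk, ENNReal.mul_top (wt_ne_zero σ k)] at this
    exact this rfl
  have hbfk : ∀ k, ∫⁻ τ in Ici 0, blk χ p k (f τ) ≠ ∞ := fun k hk => by
    refine hbf (top_le_iff.1 ?_)
    calc (∞ : ℝ≥0∞) = ∫⁻ τ in Ici 0, wt (σ + 2) k * blk χ p k (f τ) := by
          rw [lintegral_const_mul _ (hmf k), hk, ENNReal.mul_top (wt_ne_zero _ k)]
      _ ≤ _ := lintegral_mono fun τ => ENNReal.le_tsum k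
  have hbvk : ∀ k, ∫⁻ τ in Ici 0, blk χ p k (v τ) ≠ ∞ := fun k hk => by
    have := (hap k).2
    rw [hk, ENNReal.mul_top (wt_ne_zero _ k)] at this
    exact hXk k (top_le_iff.1 this)
  have hlim : ∀ k, Tendsto (fun τ => wt σ k * blk χ p k (v τ - v t)) (𝓝[Ici 0] t) (𝓝 0) := fun k => by
    have := ENNReal.Tendsto.const_mul (h.tendsto_blk hp1 hp hv hf k (hbvk k) (hbfk k) ht)
      (a := wt σ k) (Or.inr (wt_ne_top σ k))
    rwa [mul_zero] at this
  simp only [bes, ← lintegral_count]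
  have := tendsto_lintegral_filter_of_dominated_convergence (μ := Measure.count)
    (l := 𝓝[Ici 0] t) (F := fun τ k => wt σ k * blk χ p k (v τ - v t)) (f := fun _ : ℤ => 0)
    (fun k => wt σ k * (X k + X k)) (Eventually.of_forall fun τ => measurable_from_top) ?_ ?_
    (ae_of_all _ hlim)
  · simpa using this
  · filter_upwards [self_mem_nhdsWithin] with τ hτ
    refine ae_of_all _ fun k => mul_le_mul_right ((blk_sub_le hp1 χ k _ _).trans ?_) _
    exact add_le_add ((hap k).1 τ hτ) ((hap k).1 t ht)
  · rw [lintegral_count]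
    simp only [mul_add]
    rw [ENNReal.tsum_add]
    exact ENNReal.add_ne_top.2 ⟨hXsum, hXsum⟩

/-! ### Approximation of the identity on the Fourier side -/

theorem norm_iteratedFDeriv_dilation_sub_one_le (m : 𝓢(Space d, ℂ)) {c : ℝ} (hc0 : 0 ≤ c) (hc1 : c ≤ 1)
    (i : ℕ) (x : Space d) :
    ‖iteratedFDeriv ℝ i (fun x => m (c • x) - 1) x‖ ≤ SchwartzMap.seminorm ℝ 0 i m + 1 := by
  have hm : ContDiff ℝ i fun x => m (c • x) := (m.smooth i).comp (contDiff_const_smul c)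
  rw [fun_iteratedFDeriv_sub_apply hm.contDiffAt contDiff_const.contDiffAt]
  refine (norm_sub_le _ _).trans (add_le_add ?_ ?_)
  · rw [iteratedFDeriv_comp_const_smul c (m.smooth i), norm_smul, norm_pow, Real.norm_of_nonneg hc0]
    refine (mul_le_of_le_one_left (norm_nonneg _) (pow_le_one₀ hc0 hc1)).trans ?_
    exact SchwartzMap.norm_iteratedFDeriv_le_seminorm ℝ m i _
  · cases i with
    | zero => simp
    | succ i => simp [iteratedFDeriv_const_of_ne (Nat.succ_ne_zero i)]

/-- The factor `m(c x) - 1` vanishes for `‖x‖ < r / c`. Beyond that radius one more power of `‖x‖`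
is worth a factor `c / r`, paid for by the Schwartz semi-norm of order `k + 1`. -/
theorem tendsto_smulLeftCLM_dilation {ι : Type*} {l : Filter ι} {c : ι → ℝ} (hc : Tendsto c l (𝓝 0))
    (hc0 : ∀ i, 0 < c i) {m : 𝓢(Space d, ℂ)} {r : ℝ} (hr : 0 < r) (hm : ∀ ξ, ‖ξ‖ ≤ r → m ξ = 1)
    (ψ : 𝓢(Space d, ℂ)) :
    Tendsto (fun i => SchwartzMap.smulLeftCLM ℂ (fun η => m (c i • η)) ψ) l (𝓝 ψ) := by
  rw [(schwartz_withSeminorms ℝ (Space d) ℂ).tendsto_nhds _ ψ]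
  rintro ⟨k, n⟩ ε hε
  set B : ℝ := ∑ i ∈ Finset.range (n + 1), (n.choose i : ℝ) * (SchwartzMap.seminorm ℝ 0 i m + 1) *
    SchwartzMap.seminorm ℝ (k + 1) (n - i) ψ with hB
  have hB0 : 0 ≤ B := Finset.sum_nonneg fun i _ => by positivity
  have hle : ∀ c : ℝ, 0 < c → c ≤ 1 →
      SchwartzMap.seminorm ℝ k n (SchwartzMap.smulLeftCLM ℂ (fun η => m (c • η)) ψ - ψ) ≤ c / r * B := by
    intro c hc0 hc1
    refine SchwartzMap.seminorm_le_bound ℝ k n _ (by positivity) fun x => ?_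
    have e : ((SchwartzMap.smulLeftCLM ℂ (fun η => m (c • η)) ψ - ψ : 𝓢(Space d, ℂ)) : Space d → ℂ) =
        fun x => (m (c • x) - 1) * ψ x := by
      ext x
      rw [sub_apply, SchwartzMap.smulLeftCLM_apply_apply (hasTemperateGrowth_dilation c m), smul_eq_mul]
      ring
    rw [e]
    have hf : ContDiff ℝ n fun x => m (c • x) - 1 :=
      ((m.smooth n).comp (contDiff_const_smul c)).sub contDiff_const
    by_cases hx : ‖x‖ < r / c
    · have h0 : (fun x => (m (c • x) - 1) * ψ x) =ᶠ[𝓝 x] fun _ => 0 := by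
        filter_upwards [(isOpen_lt continuous_norm continuous_const).mem_nhds hx] with y hy
        have hy' : ‖y‖ < r / c := hy
        rw [hm, sub_self, zero_mul]
        rw [norm_smul, Real.norm_of_nonneg hc0.le, mul_comm]
        exact ((lt_div_iff₀ hc0).1 hy').le
      rw [(h0.iteratedFDeriv ℝ n).eq_of_nhds]
      simp only [iteratedFDeriv_fun_zero, Pi.zero_apply, norm_zero, mul_zero]
      positivity
    · push Not at hx
      have h1 : 1 ≤ c / r * ‖x‖ := by
        rw [div_le_iff₀ hc0] at hx
        rw [div_mul_eq_mul_div, le_div_iff₀ hr]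
        linarith
      have h2 : ‖x‖ ^ k ≤ c / r * ‖x‖ ^ (k + 1) := by
        calc ‖x‖ ^ k = 1 * ‖x‖ ^ k := (one_mul _).symm
          _ ≤ c / r * ‖x‖ * ‖x‖ ^ k := by gcongr
          _ = _ := by ring
      calc _ ≤ ‖x‖ ^ k * ∑ i ∈ Finset.range (n + 1), (n.choose i : ℝ) *
            ‖iteratedFDeriv ℝ i (fun x => m (c • x) - 1) x‖ * ‖iteratedFDeriv ℝ (n - i) ψ x‖ := by
            gcongr
            exact norm_iteratedFDeriv_mul_le hf (ψ.smooth n) x le_rfl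
        _ ≤ c / r * ‖x‖ ^ (k + 1) * ∑ i ∈ Finset.range (n + 1), (n.choose i : ℝ) *
            (SchwartzMap.seminorm ℝ 0 i m + 1) * ‖iteratedFDeriv ℝ (n - i) ψ x‖ := by
            refine mul_le_mul h2 (Finset.sum_le_sum fun i _ => ?_)
              (Finset.sum_nonneg fun i _ => by positivity) (by positivity)
            gcongr
            exact norm_iteratedFDeriv_dilation_sub_one_le m hc0.le hc1 i x
        _ = c / r * ∑ i ∈ Finset.range (n + 1), (n.choose i : ℝ) *
            (SchwartzMap.seminorm ℝ 0 i m + 1) * (‖x‖ ^ (k + 1) * ‖iteratedFDeriv ℝ (n - i) ψ x‖) := by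
            rw [mul_assoc, Finset.mul_sum]
            congr 1
            exact Finset.sum_congr rfl fun i _ => by ring
        _ ≤ c / r * B := by
            refine mul_le_mul_of_nonneg_left (Finset.sum_le_sum fun i _ => ?_) (by positivity)
            gcongr
            exact SchwartzMap.le_seminorm ℝ (k + 1) (n - i) ψ x
  have h3 : Tendsto (fun i => c i / r * B) l (𝓝 0) := by
    simpa using (hc.div_const r).mul_const B
  filter_upwards [h3.eventually_lt_const hε, hc.eventually_le_const one_pos] with i hi hi1
  exact (hle _ (hc0 i) hi1).trans_lt hi

/-! ### The norms of the distribution given by a bounded continuous function -/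

/-- A set of full measure is dense, so by continuity an almost sure bound holds everywhere. -/
theorem eLpNorm_top_Cb (f : Cb d) : eLpNorm f ∞ volume = ‖f‖ₑ := by
  refine le_antisymm ?_ ?_
  · refine eLpNormEssSup_le_of_ae_enorm_bound (Eventually.of_forall fun x => ?_)
    exact enorm_le_iff_norm_le.2 (f.norm_coe_le_norm x)
  · set C := eLpNorm f ∞ volume with hC
    have hCt : C ≠ ∞ := (memLp_top_Cb f).2.ne
    have h1 : ∀ᵐ x, ‖f x‖ₑ ≤ C := ae_le_eLpNormEssSup
    have h2 : IsClosed {x | ‖f x‖ₑ ≤ C} := isClosed_le f.continuous.enorm continuous_const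
    have h3 : {x | ‖f x‖ₑ ≤ C} = univ := by
      rw [← h2.closure_eq]; exact (Measure.dense_of_ae h1).closure_eq
    rw [← ofReal_norm, ← ENNReal.ofReal_toReal hCt]
    refine ENNReal.ofReal_le_ofReal
      ((BoundedContinuousFunction.norm_le ENNReal.toReal_nonneg).2 fun x => ?_)
    have h4 : ‖f x‖ₑ ≤ C := by
      have : x ∈ {x | ‖f x‖ₑ ≤ C} := h3 ▸ mem_univ x
      exact this
    simpa using ENNReal.toReal_mono hCt h4

theorem ae_eq_of_integral_schwartz_eq {f g : Space d → ℂ} (hf : LocallyIntegrable f)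
    (hg : LocallyIntegrable g) (h : ∀ φ : 𝓢(Space d, ℂ), ∫ x, φ x * f x = ∫ x, φ x * g x) :
    f =ᵐ[volume] g := by
  refine ae_eq_of_integral_contDiff_smul_eq hf hg fun φ hφ hφc => ?_
  have h1 : HasCompactSupport (Complex.ofRealCLM ∘ φ) := hφc.comp_left rfl
  have h2 : ContDiff ℝ (⊤ : ℕ∞) (Complex.ofRealCLM ∘ φ) := by fun_prop
  have h3 := h (h1.toSchwartzMap h2)
  simpa using h3

/-! ### Distributional norms of bounded continuous functions. -/

section Dictionary

variable {p : ℝ≥0∞} [Fact (1 ≤ p)]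

theorem toTemperedDistribution_injective :
    Function.Injective (Lp.toTemperedDistribution : Lp ℂ p (volume : Measure (Space d)) → 𝓢'(Space d, ℂ)) :=
  LinearMap.ker_eq_bot.1 (Lp.ker_toTemperedDistributionCLM_eq_bot (F := ℂ) (p := p)
    (μ := (volume : Measure (Space d))))

theorem lpNorm_toTemperedDistribution (f : Lp ℂ p (volume : Measure (Space d))) :
    lpNorm p (Lp.toTemperedDistribution f) = ‖f‖ₑ :=
  le_antisymm (iInf₂_le_of_le f rfl le_rfl)
    (le_iInf₂ fun g hg => by rw [toTemperedDistribution_injective hg])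

theorem exists_of_lpNorm_ne_top {T : 𝓢'(Space d, ℂ)} (h : lpNorm p T ≠ ∞) :
    ∃ f : Lp ℂ p (volume : Measure (Space d)), T = Lp.toTemperedDistribution f := by
  by_contra! hT
  refine h (top_le_iff.1 (le_iInf₂ fun g hg => absurd hg (hT g)))

theorem toTemperedDistribution_toLp {f : Cb d} (hf : MemLp f p volume) :
    Lp.toTemperedDistribution hf.toLp = toDist f := by
  ext φ
  rw [toDist_apply, Lp.toTemperedDistribution_apply]
  refine integral_congr_ae ?_
  filter_upwards [hf.coeFn_toLp] with x hx
  rw [hx, smul_eq_mul]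

/-- In the infinite case, an `L^p` representative of the distribution would agree with `f` almost
everywhere and put `f` in `L^p`. -/
theorem lpNorm_toDist (f : Cb d) : lpNorm p (toDist f) = eLpNorm f p volume := by
  by_cases hf : MemLp f p volume
  · rw [← toTemperedDistribution_toLp hf, lpNorm_toTemperedDistribution, Lp.enorm_toLp]
  · have htop : eLpNorm f p volume = ∞ := by
      by_contra h
      exact hf ⟨aestronglyMeasurable_Cb f, lt_top_iff_ne_top.2 h⟩
    rw [htop]
    by_contra h
    obtain ⟨g, hg⟩ := exists_of_lpNorm_ne_top h
    refine hf ((memLp_congr_ae ?_).2 (Lp.memLp g))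
    refine ae_eq_of_integral_schwartz_eq f.continuous.locallyIntegrable
      ((Lp.memLp g).locallyIntegrable Fact.out) fun φ => ?_
    rw [← toDist_apply, hg, Lp.toTemperedDistribution_apply]
    rfl

theorem lowSymbol_eq (χ : Cutoff d) (j : ℤ) : lowSymbol χ j = fun η => chiD χ 0 (freq j • η) := by
  ext η
  rw [lowSymbol, chiD_apply]
  simp [freq]

theorem lowFreq_toDist (χ : Cutoff d) (j : ℤ) (f : Cb d) : lowFreq χ j (toDist f) = toDist (S χ j f) := by
  rw [lowFreq, lowSymbol_eq, S, toDist_op (freq_ne j)]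

theorem dyadicBlock_eq (χ : Cutoff d) (j : ℤ) (T : 𝓢'(Space d, ℂ)) :
    dyadicBlock χ j T = lowFreq χ (j + 1) T - lowFreq χ j T := by
  have e : blockSymbol χ j = lowSymbol χ (j + 1) - lowSymbol χ j := rfl
  ext φ
  rw [dyadicBlock, e, TemperedDistribution.fourierMultiplierCLM_apply_apply,
    SchwartzMap.smulLeftCLM_sub (lowSymbol_hasTemperateGrowth _ _) (lowSymbol_hasTemperateGrowth _ _)]
  have h := map_sub (fourierCLM ℂ 𝓢(Space d, ℂ)) (SchwartzMap.smulLeftCLM ℂ (lowSymbol χ (j + 1)) (𝓕⁻ φ))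
    (SchwartzMap.smulLeftCLM ℂ (lowSymbol χ j) (𝓕⁻ φ))
  simp only [fourierCLM_apply] at h
  rw [sub_apply, h, map_sub]
  rfl

theorem blockSymbol_eq (χ : Cutoff d) (j : ℤ) : blockSymbol χ j = fun η => phi χ (freq j • η) := by
  ext η
  rw [blockSymbol, lowSymbol, lowSymbol, phi_apply, chiD_apply, chiD_apply]
  simp only [freq, smul_smul]
  congr 4
  · rw [show -(j + 1) = -1 + -j by ring, zpow_add₀ (two_ne_zero' ℝ)]
    ring
  · simp

theorem dyadicBlock_toDist (χ : Cutoff d) (j : ℤ) (f : Cb d) :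
    dyadicBlock χ j (toDist f) = toDist (Dl χ j f) := by
  rw [dyadicBlock, blockSymbol_eq, Dl, toDist_op (freq_ne j)]

theorem besovNorm_toDist (χ : Cutoff d) (σ : ℝ) (f : Cb d) :
    besovNorm χ σ p (toDist f) = bes χ σ p f := by
  simp only [besovNorm, dyadicBlock_toDist, lpNorm_toDist]
  rfl

theorem memSh_toDist {χ : Cutoff d} {f : Cb d} : MemSh χ (toDist f) ↔ LowVanish χ f := by
  simp only [MemSh, lowFreq_toDist, lpNorm_toDist, eLpNorm_top_Cb, LowVanish]
  refine ⟨fun h => ?_, fun h => ?_⟩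
  · simpa [Function.comp_def] using (ENNReal.tendsto_toReal ENNReal.zero_ne_top).comp h
  · simpa using ENNReal.tendsto_ofReal h

end Dictionary

/-! ### Critical Besov distributions are bounded continuous functions. -/

section Realization

variable {p : ℝ≥0∞} [Fact (1 ≤ p)]

theorem enorm_apply_le_lpNorm_top {T : 𝓢'(Space d, ℂ)} (hT : lpNorm ∞ T ≠ ∞) (φ : 𝓢(Space d, ℂ)) :
    ‖T φ‖ₑ ≤ (∫⁻ x, ‖φ x‖ₑ) * lpNorm ∞ T := by
  obtain ⟨g, rfl⟩ := exists_of_lpNorm_ne_top hT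
  rw [lpNorm_toTemperedDistribution, Lp.toTemperedDistribution_apply, Lp.enorm_def]
  refine (enorm_integral_le_lintegral_enorm _).trans ?_
  rw [← lintegral_mul_const _ φ.continuous.enorm.measurable]
  refine lintegral_mono_ae ?_
  filter_upwards [ae_le_eLpNormEssSup (f := g) (μ := volume)] with x hx
  rw [enorm_smul]
  exact mul_le_mul_right hx _

theorem continuous_toTemperedDistribution_apply (φ : 𝓢(Space d, ℂ)) :
    Continuous fun g : Lp ℂ p (volume : Measure (Space d)) => Lp.toTemperedDistribution g φ :=
  (PointwiseConvergenceCLM.evalCLM (RingHom.id ℂ) ℂ φ).continuous.comp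
    (Lp.toTemperedDistributionCLM ℂ (volume : Measure (Space d)) p).continuous

/-- A Fourier multiplier with Schwartz symbol maps an `L^p` function to a bounded continuous
function. -/
theorem exists_Cb_of_Lp (hp : p ≠ ∞) (m : 𝓢(Space d, ℂ)) :
    ∃ C : ℝ≥0∞, C ≠ ∞ ∧ ∀ (j : ℤ) (g : Lp ℂ p (volume : Measure (Space d))), ∃ b : Cb d,
      toDist b = TemperedDistribution.fourierMultiplierCLM ℂ (fun η => m (freq j • η))
        (Lp.toTemperedDistribution g) ∧ ‖b‖ₑ ≤ C * wt (d / p.toReal) j * ‖g‖ₑ := by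
  obtain ⟨C, hC, h⟩ := exists_enorm_op_freq_le (p := p) Fact.out hp m
  refine ⟨C, hC, fun j g => ?_⟩
  set M := C * wt (d / p.toReal) j with hM
  have hMt : M ≠ ∞ := ENNReal.mul_ne_top hC (wt_ne_top _ _)
  -- Schwartz functions are dense in `L^p` because `p` is finite. On them the multiplier is an
  -- explicit convolution, and Bernstein's inequality makes the images a Cauchy sequence in the
  -- supremum norm.
  obtain ⟨x, hx, hxg⟩ := mem_closure_iff_seq_limit.1
    (SchwartzMap.denseRange_toLpCLM (F := ℂ) (μ := (volume : Measure (Space d))) hp g)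
  choose ψ hψ using hx
  have hψ : ∀ n, (ψ n).toLp p volume = x n := hψ
  set b : ℕ → Cb d := fun n => op (freq j) m (ψ n).toBoundedContinuousFunction with hb
  have hble : ∀ n k, ‖b n - b k‖ₑ ≤ M * ‖x n - x k‖ₑ := fun n k => by
    rw [hb]
    simp only []
    rw [← map_sub]
    refine (h j _).trans (mul_le_mul_right (le_of_eq ?_) _)
    rw [← hψ, ← hψ, Lp.enorm_def]
    refine eLpNorm_congr_ae ?_
    filter_upwards [Lp.coeFn_sub ((ψ n).toLp p volume) ((ψ k).toLp p volume),
      (ψ n).coeFn_toLp p volume, (ψ k).coeFn_toLp p volume] with y h1 h2 h3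
    rw [h1, Pi.sub_apply, h2, h3]
    rfl
  have hble' : ∀ n, ‖b n‖ₑ ≤ M * ‖x n‖ₑ := fun n => by
    refine (h j _).trans (mul_le_mul_right (le_of_eq ?_) _)
    rw [← hψ, Lp.enorm_def]
    refine eLpNorm_congr_ae ?_
    filter_upwards [(ψ n).coeFn_toLp p volume] with y h2
    rw [h2]
    rfl
  have hcauchy : CauchySeq b := by
    rw [cauchySeq_iff_tendsto_dist_atTop_0]
    have h1 := (cauchySeq_iff_tendsto_dist_atTop_0.1 hxg.cauchySeq).const_mul M.toReal
    rw [mul_zero] at h1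
    refine squeeze_zero (fun _ => dist_nonneg) (fun n => ?_) h1
    rw [dist_eq_norm, dist_eq_norm]
    have := ENNReal.toReal_mono (ENNReal.mul_ne_top hMt (by simp)) (hble n.1 n.2)
    simpa using this
  obtain ⟨b', hb'⟩ := cauchySeq_tendsto_of_complete hcauchy
  refine ⟨b', ?_, ?_⟩
  · ext φ
    refine tendsto_nhds_unique (tendsto_toDist hb' φ) ?_
    rw [TemperedDistribution.fourierMultiplierCLM_apply_apply]
    refine (((continuous_toTemperedDistribution_apply _).tendsto g).comp hxg).congr fun n => ?_
    simp only [hb, Function.comp]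
    rw [toDist_op (freq_ne j), TemperedDistribution.fourierMultiplierCLM_apply_apply, ← hψ,
      toDist_apply, Lp.toTemperedDistribution_apply]
    refine integral_congr_ae ?_
    filter_upwards [(ψ n).coeFn_toLp p volume] with y h2
    rw [h2]
    rfl
  · refine le_of_tendsto_of_tendsto' ((continuous_enorm.tendsto _).comp hb')
      (ENNReal.Tendsto.const_mul ((continuous_enorm.tendsto _).comp hxg) (Or.inr hMt)) hble'

theorem sum_win_dyadicBlock (χ : Cutoff d) (n : ℕ) (T : 𝓢'(Space d, ℂ)) (φ : 𝓢(Space d, ℂ)) :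
    ∑ j ∈ win n, dyadicBlock χ j T φ = lowFreq χ n T φ - lowFreq χ (-(n : ℤ)) T φ := by
  rw [win, Finset.sum_map]
  have h := Finset.sum_range_sub (fun i : ℕ => lowFreq χ (-(n : ℤ) + i) T φ) (2 * n)
  simp only [Nat.cast_zero, add_zero] at h
  rw [show (-(n : ℤ) + ((2 * n : ℕ) : ℤ)) = n by push_cast; ring] at h
  rw [← h]
  refine Finset.sum_congr rfl fun i _ => ?_
  change dyadicBlock χ (-(n : ℤ) + i) T φ = _
  rw [dyadicBlock_eq]
  push_cast
  rw [← add_assoc]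
  rfl

/-- By duality the limit takes place on the test function, whose inverse transform multiplied by the
dilated cut-offs converges in the Schwartz topology. -/
theorem tendsto_lowFreq (χ : Cutoff d) (T : 𝓢'(Space d, ℂ)) (φ : 𝓢(Space d, ℂ)) :
    Tendsto (fun j : ℤ => lowFreq χ j T φ) atTop (𝓝 (T φ)) := by
  have h1 := tendsto_smulLeftCLM_dilation tendsto_freq_atTop freq_pos (m := chiD χ 0) (r := 3 / 4)
    (by norm_num) (fun ξ hξ => chiD_eq_one χ (by simpa using hξ)) (𝓕⁻ φ)
  have h2 := (T.continuous.tendsto _).comp (((fourierCLM ℂ 𝓢(Space d, ℂ)).continuous.tendsto _).comp h1)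
  simp only [fourierCLM_apply, FourierTransform.fourier_fourierInv_eq] at h2
  refine h2.congr fun j => ?_
  rw [lowFreq, TemperedDistribution.fourierMultiplierCLM_apply_apply, lowSymbol_eq]
  rfl

theorem MemSh.tendsto_lowFreq_neg {χ : Cutoff d} {T : 𝓢'(Space d, ℂ)} (h : MemSh χ T)
    (φ : 𝓢(Space d, ℂ)) : Tendsto (fun n : ℕ => lowFreq χ (-(n : ℤ)) T φ) atTop (𝓝 0) := by
  have h0 : Tendsto (fun j : ℤ => lpNorm ∞ (lowFreq χ j T)) atBot (𝓝 0) := h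
  have h1 : Tendsto (fun n : ℕ => lpNorm ∞ (lowFreq χ (-(n : ℤ)) T)) atTop (𝓝 0) :=
    h0.comp (tendsto_neg_atTop_atBot.comp tendsto_natCast_atTop_atTop)
  have hφ : ∫⁻ x, ‖φ x‖ₑ ≠ ∞ := φ.integrable.2.ne
  have h2 := ENNReal.Tendsto.const_mul h1 (a := ∫⁻ x, ‖φ x‖ₑ) (Or.inr hφ)
  rw [mul_zero] at h2
  rw [tendsto_zero_iff_enorm_tendsto_zero]
  refine tendsto_of_tendsto_of_tendsto_of_le_of_le' tendsto_const_nhds h2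
    (Eventually.of_forall fun _ => by simp) ?_
  filter_upwards [h1.eventually_lt_const (ENNReal.zero_lt_top)] with n hn
  exact enorm_apply_le_lpNorm_top hn.ne φ

/-- The elements of the critical Besov space are bounded continuous functions. -/
theorem exists_Cb_of_memBesov (hp : p ≠ ∞) {χ : Cutoff d} {T : 𝓢'(Space d, ℂ)}
    (hT : MemBesov χ (d / p.toReal) p T) : ∃ f : Cb d, toDist f = T := by
  obtain ⟨C, hC, hb⟩ := exists_Cb_of_Lp (d := d) hp (phiT χ)
  have hfin : ∀ j, lpNorm p (dyadicBlock χ j T) ≠ ∞ := fun j hj => by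
    have := ENNReal.ne_top_of_tsum_ne_top hT.2.ne j
    rw [hj] at this
    exact this (ENNReal.mul_top (wt_ne_zero _ j))
  choose g hg using fun j => exists_of_lpNorm_ne_top (hfin j)
  choose b hb1 hb2 using fun j => hb j (g j)
  have hbT : ∀ j, toDist (b j) = dyadicBlock χ j T := fun j => by
    rw [hb1, ← hg, dyadicBlock, TemperedDistribution.fourierMultiplierCLM_fourierMultiplierCLM_apply
      (blockSymbol_hasTemperateGrowth χ j) (hasTemperateGrowth_dilation _ _), blockSymbol_eq]
    congr 1
    congr 1
    ext η
    rw [Pi.mul_apply, mul_comm, phiT_mul_phi]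
  have hsum : Summable b := by
    refine Summable.of_norm_bounded (g := fun j => (C * wt (d / p.toReal) j * ‖g j‖ₑ).toReal)
      (ENNReal.summable_toReal ?_) fun j => ?_
    · simp only [mul_assoc]
      rw [ENNReal.tsum_mul_left]
      refine ENNReal.mul_ne_top hC (ne_of_eq_of_ne ?_ hT.2.ne)
      refine tsum_congr fun j => ?_
      rw [← lpNorm_toTemperedDistribution, ← hg]
      rfl
    · have := ENNReal.toReal_mono (ENNReal.mul_ne_top (ENNReal.mul_ne_top hC (wt_ne_top _ _)) (by simp))
        (hb2 j)
      simpa using this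
  -- Windowed sums of blocks equal `lowFreq χ n T - lowFreq χ (-n) T`. The first term tends to `T`;
  -- the second tends to zero precisely because `T` belongs to `𝓢'_h`.
  refine ⟨∑' j, b j, ?_⟩
  ext φ
  have h1 : Tendsto (fun n => ∑ j ∈ win n, dyadicBlock χ j T φ) atTop (𝓝 (toDist (∑' j, b j) φ)) := by
    have h2 := (((pairCLM φ).hasSum hsum.hasSum).comp tendsto_win)
    refine h2.congr fun n => Finset.sum_congr rfl fun j _ => ?_
    simp only []
    rw [pairCLM_apply, hbT]
  have h3 := ((tendsto_lowFreq χ T φ).comp tendsto_natCast_atTop_atTop).sub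
    (hT.1.tendsto_lowFreq_neg φ)
  rw [sub_zero] at h3
  exact tendsto_nhds_unique h1 (h3.congr fun n => (sum_win_dyadicBlock χ n T φ).symm)

end Realization

/-! ### Functions represented by distributions -/

theorem Represents.locallyIntegrable {h : Space d → ℝ} {T : 𝓢'(Space d, ℂ)} (hr : Represents h T) :
    LocallyIntegrable fun x => (h x : ℂ) := by
  rw [locallyIntegrable_iff]
  intro K hK
  obtain ⟨r, hr0, hKr⟩ := hK.isBounded.subset_closedBall_lt 0 0
  let φ : ContDiffBump (0 : Space d) := ⟨r, r + 1, hr0, by linarith⟩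
  have h1 : HasCompactSupport (Complex.ofRealCLM ∘ φ) := φ.hasCompactSupport.comp_left rfl
  have h2 : ContDiff ℝ (⊤ : ℕ∞) (Complex.ofRealCLM ∘ φ) := Complex.ofRealCLM.contDiff.comp φ.contDiff
  refine ((hr (h1.toSchwartzMap h2)).1.integrableOn (s := K)).congr_fun (fun x hx => ?_) hK.measurableSet
  have : φ x = 1 := φ.one_of_mem_closedBall (hKr hx)
  simp [this]

theorem Represents.ae_eq {h : Space d → ℝ} {f : Cb d} (hr : Represents h (toDist f)) :
    ∀ᵐ x, (h x : ℂ) = f x :=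
  ae_eq_of_integral_schwartz_eq hr.locallyIntegrable f.continuous.locallyIntegrable fun φ => by
    rw [← (hr φ).2, toDist_apply]

theorem Represents.star_eq {h : Space d → ℝ} {f : Cb d} (hr : Represents h (toDist f)) : star f = f := by
  have h1 : (fun x => star f x) =ᵐ[volume] fun x => f x := by
    filter_upwards [hr.ae_eq] with x hx
    rw [BoundedContinuousFunction.star_apply, ← hx]
    exact Complex.conj_ofReal _
  have h2 := (Continuous.ae_eq_iff_eq volume (star f).continuous f.continuous).1 h1
  ext x
  exact congrFun h2 x

theorem ofReal_re_of_star_eq {f : Cb d} (h : star f = f) (x : Space d) : ((f x).re : ℂ) = f x := by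
  have h1 : star (f x) = f x := by rw [← BoundedContinuousFunction.star_apply, h]
  exact Complex.conj_eq_iff_re.1 h1

theorem represents_toDist {h : Space d → ℝ} {f : Cb d} (hf : ∀ᵐ x, (h x : ℂ) = f x) :
    Represents h (toDist f) := by
  intro φ
  have e : (fun x => φ x * (h x : ℂ)) =ᵐ[volume] fun x => φ x * f x := by
    filter_upwards [hf] with x hx
    rw [hx]
  exact ⟨(integrable_schwartz_mul φ f).congr e.symm, by rw [toDist_apply, integral_congr_ae e]⟩

/-! ### Uniqueness of continuous solutions -/

section Uniqueness

variable {p : ℝ≥0∞} {χ : Cutoff d} {κ : ℝ} {c : ℕ → ℝ} {m L : ℝ≥0∞}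

/-- The curve `v` solves `∂_t v - κ Δ v = Δ (ser c v)` as long as it stays in the ball of
radius `m`. -/
def LocalHeat (κ : ℝ) (c : ℕ → ℝ) (m : ℝ≥0∞) (v : ℝ → Cb d) : Prop :=
  ∀ x t, 0 ≤ x → x ≤ t → (∀ τ ∈ Icc x t, ‖v τ‖ₑ ≤ m) → ∀ φ : 𝓢(Space d, ℂ),
    toDist (v t) φ = toDist (v x) φ +
      ∫ τ in x..t, toDist ((κ : ℂ) • v τ + ser c (v τ)) (Δ φ)

theorem HeatOn.localHeat {v : ℝ → Cb d} (h : HeatOn κ (Ici 0) v fun τ => ser c (v τ))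
    (hv : Continuous v) (hs : Continuous fun τ => ser c (v τ)) : LocalHeat κ c m v := by
  intro x t hx hxt _ φ
  have hc : Continuous fun τ => toDist ((κ : ℂ) • v τ + ser c (v τ)) (Δ φ) :=
    continuous_toDist ((hv.const_smul (κ : ℂ)).add hs) (Δ φ)
  rw [h t (mem_Ici.2 (hx.trans hxt)) φ, h x (mem_Ici.2 hx) φ, add_assoc,
    intervalIntegral.integral_add_adjacent_intervals (hc.intervalIntegrable _ _)
      (hc.intervalIntegrable _ _)]

/-- The contraction estimate requires curves small at all real times. Clamping the shifted time to
`[0, η]` leaves the equation on that interval unchanged and keeps the curve in the ball. -/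
theorem LocalHeat.heatOn_shift {v : ℝ → Cb d} (h : LocalHeat κ c m v) {x η : ℝ} (hx : 0 ≤ x)
    (hm : ∀ τ ∈ Icc x (x + η), ‖v τ‖ₑ ≤ m) :
    HeatOn κ (Icc 0 η) (fun τ => v (x + max 0 (min τ η))) fun τ => ser c (v (x + max 0 (min τ η))) := by
  intro t ht φ
  have hcl : ∀ τ ∈ Icc 0 η, max 0 (min τ η) = τ := fun τ hτ => by
    rw [min_eq_left hτ.2, max_eq_right hτ.1]
  have h0 : max 0 (min (0 : ℝ) η) = 0 := hcl 0 ⟨le_rfl, ht.1.trans ht.2⟩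
  beta_reduce
  rw [hcl t ht, h0, add_zero, h x (x + t) hx (by linarith [ht.1])
    (fun τ hτ => hm τ ⟨hτ.1, hτ.2.trans (by linarith [ht.2])⟩) φ]
  congr 1
  have h1 := intervalIntegral.integral_comp_add_left (a := 0) (b := t)
    (fun τ => toDist ((κ : ℂ) • v τ + ser c (v τ)) (Δ φ)) x
  rw [add_zero] at h1
  rw [← h1]
  refine intervalIntegral.integral_congr fun τ hτ => ?_
  rw [uIcc_of_le ht.1] at hτ
  simp only [hcl τ ⟨hτ.1, hτ.2.trans ht.2⟩]

theorem eventually_setLIntegral_Icc_le {F : ℝ → ℝ≥0∞} (hF : ∫⁻ τ in Ici 0, F τ ≠ ∞) {x : ℝ} (hx : 0 ≤ x)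
    (hm : m ≠ 0) : ∀ᶠ η in 𝓝[>] (0 : ℝ), ∫⁻ τ in Icc x (x + η), F τ ≤ m := by
  have h1 : Tendsto (fun η : ℝ => ENNReal.ofReal η) (𝓝[>] 0) (𝓝 0) := by
    have := (ENNReal.continuous_ofReal.tendsto 0).mono_left (nhdsWithin_le_nhds (s := Ioi 0))
    rwa [ENNReal.ofReal_zero] at this
  have h2 := tendsto_setLIntegral_zero hF (s := fun η => Icc x (x + η)) (l := 𝓝[>] (0 : ℝ))
    (tendsto_of_tendsto_of_tendsto_of_le_of_le tendsto_const_nhds h1 (fun _ => by simp) fun η => by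
      refine (Measure.restrict_apply_le _ _).trans (le_of_eq ?_)
      rw [Real.volume_Icc, add_sub_cancel_left])
  filter_upwards [h2.eventually_le_const (pos_iff_ne_zero.2 hm)] with η hη
  rwa [Measure.restrict_restrict measurableSet_Icc,
    inter_eq_left.2 fun y hy => mem_Ici.2 (hx.trans hy.1)] at hη

theorem setLIntegral_shift (F : ℝ → ℝ≥0∞) (x η : ℝ) :
    ∫⁻ τ in Icc 0 η, F (x + max 0 (min τ η)) = ∫⁻ τ in Icc x (x + η), F τ := by
  have h1 : ∫⁻ τ in Icc 0 η, F (x + max 0 (min τ η)) = ∫⁻ τ in Icc 0 η, F (x + τ) := by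
    refine setLIntegral_congr_fun measurableSet_Icc fun τ hτ => ?_
    simp only [min_eq_left hτ.2, max_eq_right hτ.1]
  rw [h1]
  have h2 := (measurePreserving_add_left volume x).setLIntegral_comp_preimage_emb
    (measurableEmbedding_addLeft x) F (Icc x (x + η))
  rw [← h2]
  congr 2
  ext τ
  simp

/-- Two solutions with the same data coincide if one of them stays in a small ball. -/
theorem Contraction.eq_of_localHeat (h : Contraction χ p κ c m L) (hp1 : 1 ≤ p) (hp : p ≠ ∞)
    {u v : ℝ → Cb d} (hu : Continuous u) (hv : Continuous v) (hum : ∀ τ, ‖u τ‖ₑ ≤ m / 2)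
    (hui : ∫⁻ τ in Ici 0, bes χ (d / p.toReal + 2) p (u τ) ≠ ∞)
    (hvi : ∫⁻ τ in Ici 0, bes χ (d / p.toReal + 2) p (v τ) ≠ ∞)
    (hHu : LocalHeat κ c m u) (hHv : LocalHeat κ c m v) (h0 : u 0 = v 0) {t : ℝ} (ht : 0 ≤ t) :
    u t = v t := by
  -- Continuous induction: the set of coincidence times is closed, contains zero, and is shown to
  -- contain a right neighbourhood of each of its points in `[0, t)`.
  have hclosed : IsClosed ({τ | u τ = v τ} ∩ Icc 0 t) := (isClosed_eq hu hv).inter isClosed_Icc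
  refine hclosed.Icc_subset_of_forall_mem_nhdsWithin (a := 0) (b := t) h0 (fun x hx => ?_)
    (right_mem_Icc.2 ht)
  obtain ⟨hxe, hx⟩ := hx
  have hxe : u x = v x := hxe
  -- The bound `m / 2` of `u` passes to `v` at the coincidence time `x`; continuity then keeps `v`
  -- in the ball of radius `m` for a while.
  have hlt : ‖v x‖ₑ < m := by
    rw [← hxe]
    exact (hum x).trans_lt (ENNReal.half_lt_self h.ne_zero h.ne_top)
  have hnear : ∀ᶠ τ in 𝓝 x, ‖v τ‖ₑ < m := (hv.enorm.tendsto x).eventually_lt_const hlt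
  obtain ⟨δ, hδ, hball⟩ := Metric.eventually_nhds_iff.1 hnear
  have hev : ∀ᶠ η in 𝓝[>] (0 : ℝ), η < δ := nhdsWithin_le_nhds (Iio_mem_nhds hδ)
  -- The length `η` is also small enough for both `L¹` norms over `[x, x + η]` to be at most `m`, by
  -- absolute continuity of the integral.
  obtain ⟨η, ⟨⟨hηδ, hη1⟩, hη2⟩, hη0⟩ := (((hev.and (eventually_setLIntegral_Icc_le hui hx.1 h.ne_zero)).and
    (eventually_setLIntegral_Icc_le hvi hx.1 h.ne_zero)).and self_mem_nhdsWithin).exists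
  have hη0 : 0 < η := hη0
  have hvm : ∀ τ ∈ Icc x (x + η), ‖v τ‖ₑ ≤ m := fun τ hτ => by
    refine (hball ?_).le
    rw [Real.dist_eq, abs_of_nonneg (by linarith [hτ.1])]
    linarith [hτ.2]
  have hum' : ∀ τ, ‖u τ‖ₑ ≤ m := fun τ => (hum τ).trans ENNReal.half_le_self
  have hcl : Continuous fun τ : ℝ => x + max 0 (min τ η) := by fun_prop
  have hmem : ∀ τ, x + max 0 (min τ η) ∈ Icc x (x + η) := fun τ =>
    ⟨by linarith [le_max_left 0 (min τ η)], by
      linarith [max_le hη0.le (min_le_right τ η)]⟩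
  have heq : ∀ τ ∈ Icc 0 η, u (x + max 0 (min τ η)) = v (x + max 0 (min τ η)) := fun τ hτ =>
    h.eq_of_heatOn hp1 hp (J := Icc 0 η) (u := fun τ => u (x + max 0 (min τ η)))
      (v := fun τ => v (x + max 0 (min τ η))) measurableSet_Icc
      (fun t ht => ⟨ht.1, Icc_subset_Icc le_rfl ht.2⟩) (hu.comp hcl) (hv.comp hcl) (fun τ => hum' _)
      (fun τ => hvm _ (hmem τ))
      ((setLIntegral_shift (fun τ => bes χ (d / p.toReal + 2) p (u τ)) x η).trans_le hη1)
      ((setLIntegral_shift (fun τ => bes χ (d / p.toReal + 2) p (v τ)) x η).trans_le hη2)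
      (hHu.heatOn_shift hx.1 fun τ _ => hum' τ) (hHv.heatOn_shift hx.1 hvm)
      (by simp only [min_eq_left hη0.le, max_self, add_zero, hxe]) hτ
  have hsub : Ioo x (x + η) ⊆ {τ | u τ = v τ} := fun τ hτ => by
    have h1 := heq (τ - x) ⟨by linarith [hτ.1], by linarith [hτ.2]⟩
    rwa [min_eq_left (by linarith [hτ.2]), max_eq_right (by linarith [hτ.1]), add_sub_cancel] at h1
  exact mem_of_superset (Ioo_mem_nhdsGT (by linarith)) hsub

end Uniqueness

/-! ### The pressure as a function of the perturbation -/

/-- The integral is the Fourier transform at frequency zero, where the symbol of the Laplacian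
vanishes. This removes the constant `P(Nbar)` from the tested equation. -/
theorem integral_laplacian_eq_zero (φ : 𝓢(Space d, ℂ)) : ∫ x, (Δ φ) x = 0 := by
  have h1 : (𝓕 (Δ φ) : 𝓢(Space d, ℂ)) 0 = ∫ x, (Δ φ) x := by
    rw [SchwartzMap.fourier_coe, Real.fourier_eq]
    simp
  have h2 := map_smul (fourierCLM ℝ 𝓢(Space d, ℂ)) (-(2 * Real.pi) ^ 2)
    (SchwartzMap.fourierMultiplierCLM ℂ (fun ξ : Space d => ‖ξ‖ ^ 2) φ)
  rw [fourierCLM_apply, fourierCLM_apply] at h2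
  rw [← h1, SchwartzMap.laplacian_eq_fourierMultiplierCLM, h2, SchwartzMap.fourierMultiplierCLM_apply,
    FourierTransform.fourier_fourierInv_eq, smul_apply,
    SchwartzMap.smulLeftCLM_apply_apply (Function.hasTemperateGrowth_norm_sq _)]
  simp

theorem pressure_eq {A γ Nbar K : ℝ} (hN : 0 < Nbar)
    (hK : ∀ k, |presCoeff A γ Nbar k| ≤ K * (2 / Nbar) ^ k) {f : Cb d} (hf : star f = f)
    (hm : ‖f‖ₑ < ENNReal.ofReal (2 / Nbar)⁻¹) (x : Space d) :
    (pressure A γ (Nbar + (f x).re) : ℂ) = pressure A γ Nbar +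
      (((A * γ * Nbar ^ (γ - 1) : ℝ) : ℂ) • f + ser (presCoeff A γ Nbar) f) x := by
  have hR : (0 : ℝ) < 2 / Nbar := by positivity
  have hm' : ‖f‖ < (2 / Nbar)⁻¹ := by
    rw [← ofReal_norm] at hm
    exact (ENNReal.ofReal_lt_ofReal_iff (by positivity)).1 hm
  have hre := ofReal_re_of_star_eq hf x
  have hlt : |(f x).re| < Nbar := by
    have h1 : |(f x).re| ≤ ‖f x‖ := Complex.abs_re_le_norm _
    have h2 := f.norm_coe_le_norm x
    have h3 : (2 / Nbar)⁻¹ ≤ Nbar := by rw [inv_div]; linarith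
    linarith
  have h1 := (continuous_eval_const x : Continuous fun g : Cb d => g x)
  have h2 : HasSum (fun k => (presCoeff A γ Nbar k : ℂ) * (f x) ^ (k + 2))
      (ser (presCoeff A γ Nbar) f x) := by
    have h3 := (hasSum_ser hR hK hm').map
      (⟨⟨fun g : Cb d => g x, rfl⟩, fun _ _ => rfl⟩ : Cb d →+ ℂ) h1
    exact h3
  have h4 := (Complex.hasSum_ofReal).2 (hasSum_pressure (A := A) (γ := γ) hN hlt)
  have h5 := h2.unique (by
    convert h4 using 2 with k
    push_cast
    rw [hre])
  rw [BoundedContinuousFunction.add_apply, h5, BoundedContinuousFunction.smul_apply, smul_eq_mul]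
  push_cast
  rw [hre]
  ring

/-! ### Passage between densities and perturbations. -/

section Solutions

variable {A γ Nbar K : ℝ} {m : ℝ≥0∞}

theorem integral_mul_density {f : Cb d} {h : Space d → ℝ} (hf : star f = f)
    (hh : ∀ᵐ x, h x = Nbar + (f x).re) (φ : 𝓢(Space d, ℂ)) :
    Integrable (fun x => φ x * (h x : ℂ)) ∧
      ∫ x, φ x * (h x : ℂ) = (∫ x, φ x) * Nbar + toDist f φ := by
  have e : (fun x => φ x * (h x : ℂ)) =ᵐ[volume] fun x => φ x * (Nbar : ℂ) + φ x * f x := by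
    filter_upwards [hh] with x hx
    rw [hx, Complex.ofReal_add, ofReal_re_of_star_eq hf, mul_add]
  have h1 : Integrable fun x => φ x * (Nbar : ℂ) := φ.integrable.mul_const _
  have h2 := integrable_schwartz_mul φ f
  refine ⟨(h1.add h2).congr e.symm, ?_⟩
  rw [integral_congr_ae e, integral_add h1 h2, integral_mul_const, toDist_apply]

theorem integral_mul_pressure (hN : 0 < Nbar) (hK : ∀ k, |presCoeff A γ Nbar k| ≤ K * (2 / Nbar) ^ k)
    {f : Cb d} {h : Space d → ℝ} (hf : star f = f) (hm : ‖f‖ₑ < ENNReal.ofReal (2 / Nbar)⁻¹)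
    (hh : ∀ᵐ x, h x = Nbar + (f x).re) (φ : 𝓢(Space d, ℂ)) :
    Integrable (fun x => φ x * (pressure A γ (h x) : ℂ)) ∧
      ∫ x, φ x * (pressure A γ (h x) : ℂ) = (∫ x, φ x) * pressure A γ Nbar +
        toDist (((A * γ * Nbar ^ (γ - 1) : ℝ) : ℂ) • f + ser (presCoeff A γ Nbar) f) φ := by
  set g : Cb d := ((A * γ * Nbar ^ (γ - 1) : ℝ) : ℂ) • f + ser (presCoeff A γ Nbar) f with hg
  have e : (fun x => φ x * (pressure A γ (h x) : ℂ)) =ᵐ[volume]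
      fun x => φ x * (pressure A γ Nbar : ℂ) + φ x * g x := by
    filter_upwards [hh] with x hx
    rw [hx, pressure_eq hN hK hf hm, mul_add]
  have h1 : Integrable fun x => φ x * (pressure A γ Nbar : ℂ) := φ.integrable.mul_const _
  have h2 := integrable_schwartz_mul φ g
  refine ⟨(h1.add h2).congr e.symm, ?_⟩
  rw [integral_congr_ae e, integral_add h1 h2, integral_mul_const, toDist_apply]

theorem isSolution_of_heatOn (hN : 0 < Nbar) (hK : ∀ k, |presCoeff A γ Nbar k| ≤ K * (2 / Nbar) ^ k)
    {u : ℝ → Cb d} (hu : Continuous u) (hs : Continuous fun τ => ser (presCoeff A γ Nbar) (u τ))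
    (hstar : ∀ τ, star (u τ) = u τ) (hm : ∀ τ, ‖u τ‖ₑ < ENNReal.ofReal (2 / Nbar)⁻¹)
    (hH : HeatOn (A * γ * Nbar ^ (γ - 1)) (Ici 0) u fun τ => ser (presCoeff A γ Nbar) (u τ))
    {N₀ : Space d → ℝ} (h0 : (fun x => Nbar + (u 0 x).re) =ᵐ[volume] N₀) :
    IsSolution A γ N₀ fun t x => Nbar + (u t x).re := by
  have hd := fun t (φ : 𝓢(Space d, ℂ)) => integral_mul_density (h := fun x => Nbar + (u t x).re)
    (hstar t) (Eventually.of_forall fun _ => rfl) φ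
  have hp := fun t (φ : 𝓢(Space d, ℂ)) => integral_mul_pressure (h := fun x => Nbar + (u t x).re)
    hN hK (hstar t) (hm t) (Eventually.of_forall fun _ => rfl) φ
  have hc : ∀ φ : 𝓢(Space d, ℂ), Continuous fun τ => toDist (((A * γ * Nbar ^ (γ - 1) : ℝ) : ℂ) • u τ +
      ser (presCoeff A γ Nbar) (u τ)) φ := fun φ =>
    continuous_toDist ((hu.const_smul ((A * γ * Nbar ^ (γ - 1) : ℝ) : ℂ)).add hs) φ
  refine ⟨fun t _ => Eventually.of_forall fun x => ?_, h0, fun t _ φ => (hd t φ).1,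
    fun t _ φ => (hp t φ).1, fun t _ φ => ?_, fun t ht φ => ?_⟩
  -- The perturbation stays below `Nbar / 2`, so the density is nonnegative without any maximum
  -- principle.
  · have h1 : ‖u t‖ < (2 / Nbar)⁻¹ := by
      have := hm t
      rw [← ofReal_norm] at this
      exact (ENNReal.ofReal_lt_ofReal_iff (by positivity)).1 this
    have h2 := (abs_le.1 ((Complex.abs_re_le_norm (u t x)).trans ((u t).norm_coe_le_norm x))).1
    have h3 : (2 / Nbar)⁻¹ ≤ Nbar := by rw [inv_div]; linarith
    linarith
  · simp only [(hp _ φ).2]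
    exact ((continuous_const.add (hc φ)).intervalIntegrable _ _)
  · simp only [(hp _ (Δ φ)).2, integral_laplacian_eq_zero, zero_mul, zero_add]
    rw [(hd t φ).2, (hd 0 φ).2, hH t (mem_Ici.2 ht) φ, add_assoc]

/-- The pressure of an arbitrary solution equals its Taylor series only while the perturbation is
small. This is why the perturbed equation is asserted only on intervals where the curve stays in the
ball. -/
theorem IsSolution.localHeat (hN : 0 < Nbar)
    (hK : ∀ k, |presCoeff A γ Nbar k| ≤ K * (2 / Nbar) ^ k) (hm : m < ENNReal.ofReal (2 / Nbar)⁻¹)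
    {N₀ : Space d → ℝ} {N : ℝ → Space d → ℝ} (h : IsSolution A γ N₀ N) {v : ℝ → Cb d}
    (hstar : ∀ τ, 0 ≤ τ → star (v τ) = v τ)
    (hv : ∀ t, 0 ≤ t → ∀ᵐ x, N t x = Nbar + (v t x).re) :
    LocalHeat (A * γ * Nbar ^ (γ - 1)) (presCoeff A γ Nbar) m v := by
  intro x t hx hxt hvm φ
  have ht := hx.trans hxt
  have e1 := h.equation t ht φ
  have e2 := h.equation x hx φ
  rw [(integral_mul_density (hstar t ht) (hv t ht) φ).2] at e1
  rw [(integral_mul_density (hstar x hx) (hv x hx) φ).2] at e2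
  have e3 := intervalIntegral.integral_interval_sub_left (h.time_integrable t ht (Δ φ))
    (h.time_integrable x hx (Δ φ))
  have e4 : (∫ τ in x..t, ∫ y, (Δ φ) y * (pressure A γ (N τ y) : ℂ)) =
      ∫ τ in x..t, toDist (((A * γ * Nbar ^ (γ - 1) : ℝ) : ℂ) • v τ +
        ser (presCoeff A γ Nbar) (v τ)) (Δ φ) := by
    refine intervalIntegral.integral_congr fun τ hτ => ?_
    rw [uIcc_of_le hxt] at hτ
    have hτ0 := hx.trans hτ.1
    beta_reduce
    rw [(integral_mul_pressure hN hK (hstar τ hτ0) ((hvm τ hτ).trans_lt hm) (hv τ hτ0) (Δ φ)).2,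
      integral_laplacian_eq_zero, zero_mul, zero_add]
  rw [← e4, ← e3]
  linear_combination e1 - e2

theorem inSolutionSpace_of_heatOn {p : ℝ≥0∞} [Fact (1 ≤ p)] (hp : p ≠ ∞) {χ : Cutoff d} {κ : ℝ}
    (hκ : 0 < κ) {u f : ℝ → Cb d} (hu : Continuous u) (hf : Continuous f) (hH : HeatOn κ (Ici 0) u f)
    (hstar : ∀ τ, star (u τ) = u τ) (hlv : LowVanish χ (u 0))
    (h0 : bes χ (d / p.toReal) p (u 0) ≠ ∞)
    (hbf : ∫⁻ τ in Ici 0, bes χ (d / p.toReal + 2) p (f τ) ≠ ∞) :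
    InSolutionSpace χ p Nbar fun t x => Nbar + (u t x).re := by
  have hp1 : 1 ≤ p := Fact.out
  obtain ⟨Ka, hKa, hap⟩ := exists_bes_apriori hp1 hp χ hκ
  obtain ⟨h1, h2⟩ := hap (d / p.toReal) (Ici 0) u f measurableSet_Ici hH hu hf Ici_downward
  have hB : Ka * (bes χ (d / p.toReal) p (u 0) + ∫⁻ τ in Ici 0, bes χ (d / p.toReal + 2) p (f τ)) ≠ ∞ :=
    ENNReal.mul_ne_top hKa (ENNReal.add_ne_top.2 ⟨h0, hbf⟩)
  have hlow : ∀ t, 0 ≤ t → MemSh χ (toDist (u t)) := fun t ht =>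
    memSh_toDist.2 (hH.lowVanish hu hf hlv (mem_Ici.2 ht))
  have hmeas := measurable_bes hp1 hp χ (d / p.toReal + 2) hu
  have hint : ∫⁻ τ in Ioi 0, bes χ (d / p.toReal + 2) p (u τ) ≠ ∞ :=
    ne_top_of_le_ne_top hB ((lintegral_mono_set Ioi_subset_Ici_self).trans h2)
  refine ⟨fun t => toDist (u t), fun t _ => represents_toDist (Eventually.of_forall fun x => ?_),
    ⟨fun t ht => ⟨hlow t ht, ?_⟩, fun t ht => ?_, _, lt_top_iff_ne_top.2 hB, fun t ht => ?_⟩, ?_, ?_, ?_⟩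
  · rw [add_sub_cancel_left]
    exact ofReal_re_of_star_eq (hstar t) x
  · rw [besovNorm_toDist]
    exact (h1 t ht).trans_lt (lt_top_iff_ne_top.2 hB)
  · simp only [← toDist_sub, besovNorm_toDist]
    exact hH.tendsto_bes hp1 hp hκ hu hf h0 hbf ht
  · rw [besovNorm_toDist]
    exact h1 t ht
  · filter_upwards [ae_lt_top hmeas hint, ae_restrict_mem measurableSet_Ioi] with t ht ht0
    exact ⟨hlow t (mem_Ioi.1 ht0).le, by rwa [besovNorm_toDist]⟩
  · simp only [besovNorm_toDist]
    exact hmeas.aemeasurable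
  · simp only [besovNorm_toDist]
    exact lt_top_iff_ne_top.2 hint

/-- A function in the solution space is given by a continuous curve of bounded continuous
functions. -/
theorem InSolutionSpace.exists_curve {p : ℝ≥0∞} [Fact (1 ≤ p)] (hp : p ≠ ∞) {χ : Cutoff d}
    {N : ℝ → Space d → ℝ} (h : InSolutionSpace χ p Nbar N) :
    ∃ v : ℝ → Cb d, Continuous v ∧ (∀ τ, star (v τ) = v τ) ∧
      (∀ t, 0 ≤ t → ∀ᵐ x, N t x = Nbar + (v t x).re) ∧
      ∫⁻ τ in Ici 0, bes χ (d / p.toReal + 2) p (v τ) ≠ ∞ := by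
  obtain ⟨T, hrep, hCb, hL1⟩ := h
  choose! w hw using fun t (ht : 0 ≤ t) => exists_Cb_of_memBesov hp (hCb.mem t ht)
  have hrep' : ∀ t, 0 ≤ t → Represents (fun x => N t x - Nbar) (toDist (w t)) := fun t ht => by
    rw [hw t ht]; exact hrep t ht
  obtain ⟨Ke, hKe, hemb⟩ := exists_enorm_le_bes (p := p) Fact.out hp χ
  have hlv : ∀ t, 0 ≤ t → LowVanish χ (w t) := fun t ht =>
    memSh_toDist.1 (by rw [hw t ht]; exact (hCb.mem t ht).1)
  -- Differences of the curve have vanishing low frequencies, so the embedding turns Besov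
  -- continuity into continuity in the supremum norm.
  have hcont : ContinuousOn w (Ici 0) := fun t ht => by
    have ht : 0 ≤ t := ht
    rw [ContinuousWithinAt, tendsto_iff_edist_tendsto_0]
    have h1 := ENNReal.Tendsto.const_mul (a := Ke) (hCb.cont t ht) (Or.inr hKe)
    rw [mul_zero] at h1
    refine tendsto_of_tendsto_of_tendsto_of_le_of_le' tendsto_const_nhds h1
      (Eventually.of_forall fun _ => by simp) ?_
    filter_upwards [self_mem_nhdsWithin] with τ hτ
    have hτ : 0 ≤ τ := hτ
    rw [edist_eq_enorm_sub, ← hw τ hτ, ← hw t ht, ← toDist_sub, besovNorm_toDist]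
    exact hemb _ ((hlv τ hτ).sub (hlv t ht))
  have hclamp : ∀ τ : ℝ, 0 ≤ max τ 0 := fun τ => le_max_right _ _
  refine ⟨fun τ => w (max τ 0), hcont.comp_continuous (by fun_prop) hclamp,
    fun τ => (hrep' _ (hclamp τ)).star_eq, fun t ht => ?_, ?_⟩
  · simp only [max_eq_left ht]
    filter_upwards [(hrep' t ht).ae_eq] with x hx
    rw [← hx, Complex.ofReal_re]
    ring
  · refine ne_of_eq_of_ne ?_ hL1.finite.ne
    rw [setLIntegral_congr Ioi_ae_eq_Ici.symm]
    refine setLIntegral_congr_fun measurableSet_Ioi fun τ hτ => ?_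
    have hτ : 0 < τ := hτ
    simp only [max_eq_left hτ.le]
    rw [← hw τ hτ.le, besovNorm_toDist]

end Solutions

end PorousMedia

end

/-! ### Existence and uniqueness for small data. -/

theorem mainTheorem7 (d : ℕ) (hd : 1 ≤ d) (χ : PorousMedia.Cutoff d)
    (p : ℝ≥0∞) [Fact (1 ≤ p)] (hp : p ≠ ∞)
    (A γ Nbar : ℝ) (hA : 0 < A) (hγ : 1 < γ) (hNbar : 0 < Nbar) :
    ∃ c₀ : ℝ, 0 < c₀ ∧
      ∀ (N₀ : PorousMedia.Space d → ℝ) (u₀ : 𝓢'(PorousMedia.Space d, ℂ)),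
        PorousMedia.Represents (fun x => N₀ x - Nbar) u₀ →
        PorousMedia.MemBesov χ (d / p.toReal) p u₀ →
        PorousMedia.besovNorm χ (d / p.toReal) p u₀ ≤ ENNReal.ofReal c₀ →
        ∃ N : ℝ → PorousMedia.Space d → ℝ,
          (PorousMedia.IsSolution A γ N₀ N ∧ PorousMedia.InSolutionSpace χ p Nbar N) ∧
          ∀ N' : ℝ → PorousMedia.Space d → ℝ,
            PorousMedia.IsSolution A γ N₀ N' → PorousMedia.InSolutionSpace χ p Nbar N' →
            ∀ t, 0 ≤ t → N' t =ᵐ[volume] N t := by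
  have hp1 : 1 ≤ p := Fact.out
  have hR : (0 : ℝ) < 2 / Nbar := by positivity
  have hκ : 0 < A * γ * Nbar ^ (γ - 1) := by positivity
  obtain ⟨K, hK⟩ := PorousMedia.exists_presCoeff_bound (A := A) (γ := γ) hNbar
  obtain ⟨m, L, hm, hC⟩ := PorousMedia.exists_contraction hp1 hp χ hκ hR hK
  obtain ⟨ε, hε0, hεt, hfix⟩ := hC.exists_fixedPoint hp1 hp hκ
  refine ⟨ε.toReal, ENNReal.toReal_pos hε0 hεt, fun N₀ u₀ hrep hmem hsmall => ?_⟩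
  obtain ⟨f₀, rfl⟩ := PorousMedia.exists_Cb_of_memBesov hp hmem
  rw [ENNReal.ofReal_toReal hεt, PorousMedia.besovNorm_toDist] at hsmall
  have hlv := PorousMedia.memSh_toDist.1 hmem.1
  obtain ⟨u, hu, hua, hu0, hH⟩ := hfix f₀ hrep.star_eq hlv hsmall
  have hser := hC.continuous_ser hu.cont hu.enorm_le
  have hN₀ : ∀ᵐ x, N₀ x = Nbar + (f₀ x).re := by
    filter_upwards [hrep.ae_eq] with x hx
    rw [← hx, Complex.ofReal_re]
    ring
  have hui := ne_top_of_le_ne_top hC.ne_top hu.lintegral_le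
  refine ⟨fun t x => Nbar + (u t x).re, ⟨?_, ?_⟩, fun N' hN' hS' t ht => ?_⟩
  · refine PorousMedia.isSolution_of_heatOn hNbar hK hu.cont hser hu.star_eq
      (fun τ => (hu.enorm_le τ).trans_lt hm) hH ?_
    rw [hu0]
    filter_upwards [hN₀] with x hx using hx.symm
  · refine PorousMedia.inSolutionSpace_of_heatOn hp hκ hu.cont hser hH hu.star_eq (by rwa [hu0])
      (by rw [hu0]; exact ne_top_of_le_ne_top hεt hsmall) ?_
    exact ne_top_of_le_ne_top (ENNReal.mul_ne_top hC.lip_ne_top hui)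
      (hC.lintegral_bes_ser_le hp1 hp hu.cont hu.enorm_le)
  · obtain ⟨v, hv, hvs, hvN, hvi⟩ := hS'.exists_curve hp
    -- Initial data are prescribed only almost everywhere; both curves take continuous values, so
    -- they agree at every point.
    have h0 : u 0 = v 0 := by
      rw [hu0]
      refine BoundedContinuousFunction.ext fun x => ?_
      have h1 : (fun x => f₀ x) =ᵐ[volume] fun x => v 0 x := by
        filter_upwards [hN₀, hvN 0 le_rfl, hN'.initial] with x h1 h2 h3
        rw [← PorousMedia.ofReal_re_of_star_eq hrep.star_eq x,
          ← PorousMedia.ofReal_re_of_star_eq (hvs 0) x]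
        congr 1
        linarith
      exact congrFun ((Continuous.ae_eq_iff_eq volume f₀.continuous (v 0).continuous).1 h1) x
    have h2 := hC.eq_of_localHeat hp1 hp hu.cont hv hua hui hvi (hH.localHeat hu.cont hser)
      (hN'.localHeat hNbar hK hm (fun τ _ => hvs τ) hvN) h0 ht
    filter_upwards [hvN t ht] with x hx
    rw [hx, h2]
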